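/- Let $Z=\big(Z_0\sqcup\bigsqcup_{\lambda\in\Lambda}[0,1]\big)/\phi$ be a connected finite one-dimensional CW complex: $Z_0$ is a finite discrete set, $\Lambda$ is finite, and $\phi$ glues the endpoints of the intervals to points of $Z_0$. Let $\Phi_\lambda:[0,1]\to Z$ be the characteristic maps. Let $f:Z\to\mathbb{R}^d$ be a $C^2$ map, i.e. $f$ is continuous and every $f\circ\Phi_\lambda$ is $C^2$ on $[0,1]$. Let $M\ge 0$ and suppose that $f$ has curvature bounded by $M$, i.e. every curve $f\circ\Phi_\lambda$ has nowhere vanishing derivative (so that its curvature is defined) and curvature at most $M$ everywhere. Let $L$ be the sum over $\lambda\in\Lambda$ of the arc lengths of the curves $f\circ\Phi_\lambda$. Let $\varepsilon>0$ with $M\varepsilon<\pi$ (i.e. $\varepsilon<\pi/M$ if $M>0$), and let $A\subseteq Z$ be a finite $\varepsilon$-dense compatible subset for $f$; that is, $Z_0\subseteq A$, each 1-cell $\Phi_\lambda([0,1])$ contains a point of $A\setminus Z_0$, and each of the finitely many disjoint open curves of which $Z\setminus A$ consists is mapped by $f$ to a curve of arc length less than $\varepsilon$. For $v\in S^{d-1}$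 and $t\in\mathbb{R}$ put $$\mathrm{ECT}_f(v,t)=\chi\big(\{z\in Z:\langle f(z),v\rangle\le t\}\big),$$ where $\chi(Y)=\sum_{k\ge 0}(-1)^k\,\mathrm{rank}\,H_k(Y;\mathbb{Z})$ (singular homology) if the homology of $Y$ is finitely generated and $\chi(Y)=\infty$ otherwise, and let $$\mathrm{ECT}^A_f(v,t)=\#\{b\in A:\langle f(b),v\rangle\le t\}-\#\{e:\max(\langle f(b_e),v\rangle,\langle f(b'_e),v\rangle)\le t\},$$ where $e$ ranges over the open curves of $Z\setminus A$, and $b_e,b'_e\in A$ are the endpoints of $e$. For $a>\max_{z\in Z}\|f(z)\|$ define $$\|F\|=\sup_{v\in S^{d-1}}\int_{-a}^{a}|F(v,t)|\,\mathrm{d}t$$ for functions $F:S^{d-1}\times\mathbb{R}\to\mathbb{Z}\cup\{\infty\}$, with the conventions $\infty-n=\infty$ and $|\infty|=\infty$. Then, for every such $a$ and every $v$, the function $t\mapsto|\mathrm{ECT}_f(v,t)-\mathrm{ECT}^A_f(v,t)|$ is Lebesgue measurable on $[-a,a]$, and $$\big\|\mathrm{ECT}_f-\mathrm{ECT}^A_f\big\|\le\frac{1}{\sqrt{12}}\,M\,L\,\varepsilon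 .$$ -/

import Mathlib

open Set MeasureTheory
open scoped ENNReal

noncomputable section

/-! ### One-dimensional CW complexes -/

/-- The gluing data of a one-dimensional CW complex with set of 0-cells `V` and set of 1-cells `Λ`:
the map `φ` from the endpoints of the intervals to `V`, given as `init l = φ (0 in the l-th interval)`
and `term l = φ (1 in the l-th interval)`. -/
structure OneComplex (V Λ : Type) where
  init : Λ → V
  term : Λ → V

namespace OneComplex

variable {V Λ : Type} (G : OneComplex V Λ)

/-- The identifications made in `V ⊔ ⨆_l [0,1]`. -/
inductive Glue : V ⊕ (Σ _ : Λ, unitInterval) → V ⊕ (Σ _ : Λ, unitInterval) → Prop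
  | zero (l : Λ) : Glue (Sum.inr ⟨l, 0⟩) (Sum.inl (G.init l))
  | one (l : Λ) : Glue (Sum.inr ⟨l, 1⟩) (Sum.inl (G.term l))

/-- The underlying space `Z = (V ⊔ ⨆_l [0,1]) / φ`. -/
def Space : Type := Quot G.Glue

/-- The quotient topology, where `V` is discrete. -/
instance : TopologicalSpace G.Space :=
  letI : TopologicalSpace V := ⊥
  inferInstanceAs (TopologicalSpace (Quot G.Glue))

/-- The 0-cell of `Z` given by `x : V`. -/
def vertex (x : V) : G.Space := Quot.mk _ (Sum.inl x)

/-- The characteristic map `Φ_l : [0,1] → Z`. -/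
def cell (l : Λ) (s : unitInterval) : G.Space := Quot.mk _ (Sum.inr ⟨l, s⟩)

variable {d : ℕ}

/-- The curve `f ∘ Φ_l`, extended from `[0,1]` to `ℝ` by constants; only its restriction to
`[0,1]` is ever used. -/
def edgeCurve (f : G.Space → EuclideanSpace ℝ (Fin d)) (l : Λ) : ℝ → EuclideanSpace ℝ (Fin d) :=
  IccExtend zero_le_one (fun s : unitInterval => f (G.cell l s))

/-- `f` is a `C^r` map under the given CW structure: it is continuous and its restriction to each
copy of `[0,1]` is `C^r` (up to the endpoints). -/
def IsCrMap (r : ℕ) (f : G.Space → EuclideanSpace ℝ (Fin d)) : Prop :=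
  Continuous f ∧ ∀ l, ContDiffOn ℝ r (G.edgeCurve f l) (Icc 0 1)

end OneComplex

/-! ### Curves `[0,1] → ℝ^d` -/

section Curves

variable {d : ℕ} (γ : ℝ → EuclideanSpace ℝ (Fin d))

/-- The velocity of a curve on `[0,1]` (one-sided at the endpoints). -/
def velocity (t : ℝ) : EuclideanSpace ℝ (Fin d) := derivWithin γ (Icc 0 1) t

/-- The unit tangent vector `T = γ' / ‖γ'‖`. -/
def unitTangent (t : ℝ) : EuclideanSpace ℝ (Fin d) := ‖velocity γ t‖⁻¹ • velocity γ t

/-- The curvature `κ = ‖T'‖ / ‖γ'‖` (meaningful where `γ' ≠ 0`). -/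
def curvature (t : ℝ) : ℝ := ‖derivWithin (unitTangent γ) (Icc 0 1) t‖ / ‖velocity γ t‖

/-- The curvature of `γ : [0,1] → ℝ^d` is defined everywhere (`γ` is regular) and is at
most `M`. -/
def HasCurvatureLE (M : ℝ) : Prop :=
  ∀ t ∈ Icc (0 : ℝ) 1, velocity γ t ≠ 0 ∧ curvature γ t ≤ M

/-- The arc length of a `C¹` curve between the parameters `p ≤ q` in `[0,1]`. -/
def arcLength (p q : ℝ) : ℝ := ∫ t in p..q, ‖velocity γ t‖

end Curves

/-! ### Euler characteristic -/

/-- The `k`-th singular homology group of `X` with coefficients in `ℤ`. -/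
abbrev singularH (k : ℕ) (X : Type) [TopologicalSpace X] : ModuleCat.{0} ℤ :=
  ((AlgebraicTopology.singularHomologyFunctor (ModuleCat.{0} ℤ) k).obj
    (ModuleCat.of ℤ ℤ)).obj (TopCat.of X)

/-- The (total) singular homology of `X` is finitely generated. -/
def HasFiniteHomology (X : Type) [TopologicalSpace X] : Prop :=
  (∀ k, Module.Finite ℤ (singularH k X)) ∧ ∃ N, ∀ k, N ≤ k → Subsingleton (singularH k X)

open Classical in
/-- The Euler characteristic `∑ (-1)^k rank H_k(X; ℤ)`, with value `⊤ = ∞` where it is not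
defined. -/
def eulerCharacteristic (X : Type) [TopologicalSpace X] : WithTop ℤ :=
  if HasFiniteHomology X then
    ((∑ᶠ k : ℕ, (-1 : ℤ) ^ k * (Module.finrank ℤ (singularH k X) : ℤ) : ℤ) : WithTop ℤ)
  else ⊤

/-! ### Euler characteristic transforms -/

/-- The unit sphere `S^{d-1}` in `ℝ^d`. -/
abbrev UnitSphere (d : ℕ) : Type := Metric.sphere (0 : EuclideanSpace ℝ (Fin d)) 1

/-- `ECT_f (v, t) = χ (f⁻¹ {x : ⟨x, v⟩ ≤ t})`. -/
def ECT {X : Type} [TopologicalSpace X] {d : ℕ} (f : X → EuclideanSpace ℝ (Fin d))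
    (v : UnitSphere d) (t : ℝ) : WithTop ℤ :=
  eulerCharacteristic
    (f ⁻¹' {x : EuclideanSpace ℝ (Fin d) | inner ℝ x (v : EuclideanSpace ℝ (Fin d)) ≤ t})

/-- Difference of two elements of `ℤ ∪ {∞}`, equal to `∞` as soon as one of them is `∞`. -/
def extSub (x y : WithTop ℤ) : WithTop ℤ := WithTop.map₂ (fun m n : ℤ => m - n) x y

/-- Absolute value on `ℤ ∪ {∞}`. -/
def extAbs : WithTop ℤ → ℝ≥0∞
  | none => ⊤
  | some n => (n.natAbs : ℝ≥0∞)

/-- The norm `sup_v ∫_{-a}^a |F(v, t)| dt`. -/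
def ectNorm {d : ℕ} (a : ℝ) (F : UnitSphere d → ℝ → WithTop ℤ) : ℝ≥0∞ :=
  ⨆ v : UnitSphere d, ∫⁻ t in Icc (-a) a, extAbs (F v t)

namespace OneComplex

variable {V Λ : Type} (G : OneComplex V Λ) {d : ℕ}

/-- `f` has curvature bounded by `M`: every curve `f ∘ Φ_l` has. -/
def CurvatureBoundedBy (f : G.Space → EuclideanSpace ℝ (Fin d)) (M : ℝ) : Prop :=
  ∀ l, HasCurvatureLE (G.edgeCurve f l) M

/-- The sum of the arc lengths of the curves `f ∘ Φ_l`. -/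
def totalLength [Fintype Λ] (f : G.Space → EuclideanSpace ℝ (Fin d)) : ℝ :=
  ∑ l, arcLength (G.edgeCurve f l) 0 1

/-- `A` is a compatible subset: it contains all 0-cells, and each 1-cell contains a point
of `A` that is not a 0-cell. -/
def Compatible (A : Finset G.Space) : Prop :=
  (∀ x, G.vertex x ∈ A) ∧ ∀ l, ∃ s, G.cell l s ∈ A ∧ G.cell l s ∉ range G.vertex

/-- The open curves of which `Z - A` consists when `A` is compatible: a triple `(l, p, q)` stands
for the curve `Φ_l ((p, q))`, where `p < q` are consecutive parameters of points of `A` on the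
`l`-th 1-cell. The endpoints of the curve are `Φ_l p` and `Φ_l q`. -/
def openCurves (A : Finset G.Space) : Set (Λ × unitInterval × unitInterval) :=
  {e | e.2.1 < e.2.2 ∧ G.cell e.1 e.2.1 ∈ A ∧ G.cell e.1 e.2.2 ∈ A ∧
    ∀ s, e.2.1 < s → s < e.2.2 → G.cell e.1 s ∉ A}

/-- `A` is an `ε`-dense subset for `f`: it is compatible, and each of the open curves of `Z - A`
is mapped by `f` to a curve of length less than `ε`. -/
def EpsDense (f : G.Space → EuclideanSpace ℝ (Fin d)) (A : Finset G.Space) (ε : ℝ) : Prop :=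
  G.Compatible A ∧
    ∀ e ∈ G.openCurves A, arcLength (G.edgeCurve f e.1) (e.2.1 : ℝ) (e.2.2 : ℝ) < ε

/-- The transform `ECT^A_f` of the piecewise linear interpolation of `f` on `A`: the number of
points `a ∈ A` with `⟨f a, v⟩ ≤ t` minus the number of open curves of `Z - A` for both of whose
endpoints `b` one has `⟨f b, v⟩ ≤ t`. -/
def interpolatedECT (f : G.Space → EuclideanSpace ℝ (Fin d)) (A : Finset G.Space)
    (v : UnitSphere d) (t : ℝ) : ℤ :=
  ({a | a ∈ A ∧ inner ℝ (f a) (v : EuclideanSpace ℝ (Fin d)) ≤ t}.ncard : ℤ) -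
    ({e | e ∈ G.openCurves A ∧
      max (inner ℝ (f (G.cell e.1 e.2.1)) (v : EuclideanSpace ℝ (Fin d)))
        (inner ℝ (f (G.cell e.1 e.2.2)) (v : EuclideanSpace ℝ (Fin d))) ≤ t}.ncard : ℤ)

/-- The difference `ECT_f - ECT^A_f`. -/
def ectError (f : G.Space → EuclideanSpace ℝ (Fin d)) (A : Finset G.Space)
    (v : UnitSphere d) (t : ℝ) : WithTop ℤ :=
  extSub (ECT f v t) (G.interpolatedECT f A v t : WithTop ℤ)

end OneComplex

end

/-!
Fix a direction `v` and write `h z = ⟪f z, v⟫`. For almost every `t` the level set `{h = t}` is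
finite, misses `A` and consists of regular points of `h` on open 1-cells, by Sard's theorem in
dimension one. For such `t` the sublevel set `{h ≤ t}` is a finite graph, whose vertices are the
0-cells in it and the points of the level set, so its Euler characteristic is the number of vertices
minus the number of edges. Counting the edges by their two ends, where each regular crossing of the
level `t` is the end of exactly one edge, shows that the Euler characteristic is `K(t) + N(t) / 2`.
Here `N(t)` is the number of points in the level set, and `K(t)` only depends on the values of `h`
on the 0-cells. The same count for the piecewise linear interpolation on `A` gives `K(t)` plus half
of the number of open curves `e` of `Z - A` such that `t` lies between the values of `h` at the
ends of `e`. Hence the error is almost everywhere half of the sum over `e` of the excess number of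
preimages of `t` in `e` (`OneComplex.ae_extAbs_ectError_eq`).

If `h` has no critical point on `e`, it is monotone there and the excess vanishes almost
everywhere. Otherwise the integral of the excess is at most the variation of `h` along `e`, by
Banach's indicatrix theorem (`lintegral_preimageCount_le`). At a critical point the unit tangent
vector is orthogonal to `v`, and by the curvature bound it turns by at most `M u` within arc length
`u`, so that the variation is at most `M ℓ² / 2`, where `ℓ < ε` is the length of `e`
(`lintegral_abs_inner_velocity_le`). Summing over `e`, the integral of the error is at most
`M L ε / 4`.

The topological input is that the singular homology of a finite graph has Euler characteristic
`#V - #Λ` (`OneComplex.eulerCharacteristic_space`). It follows from the Mayer-Vietoris sequence of the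
cover by a neighbourhood of the 0-cells and the union of the open 1-cells, since these two sets and
their intersection are homotopy equivalent to finite discrete spaces. The Mayer-Vietoris sequence
rests on the theorem of small simplices (`SingularChain.exists_sub_bd_mem_small`), proved by
barycentric subdivision.
-/

noncomputable section

/-! ### Chains of ordered tuples and their subdivision -/

namespace TupleChain

variable {E F : Type*}

/-- Integral chains on ordered `n`-tuples of points of `E`; these are the `(n-1)`-dimensional
chains of the augmented ordered complex of `E`. -/
abbrev Chain (E : Type*) (n : ℕ) : Type _ := (Fin n → E) →₀ ℤ

/-- The alternating sum of the tuples obtained by leaving out one entry. For `n = 0` this is the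
augmentation. -/
def boundary (n : ℕ) : Chain E (n + 1) →ₗ[ℤ] Chain E n :=
  ∑ i : Fin (n + 1), (-1 : ℤ) ^ (i : ℕ) •
    Finsupp.lmapDomain ℤ ℤ (fun w : Fin (n + 1) → E => w ∘ i.succAbove)

/-- The cone operator: put the point `b` in front of every tuple. -/
def cone (b : E) (n : ℕ) : Chain E n →ₗ[ℤ] Chain E (n + 1) :=
  Finsupp.lmapDomain ℤ ℤ (fun w => (Fin.cons b w : Fin (n + 1) → E))

/-- The chain map induced by a map of points. -/
def push (φ : E → F) (n : ℕ) : Chain E n →ₗ[ℤ] Chain F n :=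
  Finsupp.lmapDomain ℤ ℤ (fun w => φ ∘ w)

lemma boundary_single {n : ℕ} (w : Fin (n + 1) → E) :
    boundary n (Finsupp.single w 1) =
      ∑ i : Fin (n + 1), (-1 : ℤ) ^ (i : ℕ) • Finsupp.single (w ∘ i.succAbove) 1 := by
  simp [boundary, LinearMap.sum_apply, Finsupp.mapDomain_single]

lemma cone_single (b : E) {n : ℕ} (w : Fin n → E) :
    cone b n (Finsupp.single w 1) = Finsupp.single (Fin.cons b w : Fin (n + 1) → E) 1 := by
  simp [cone, Finsupp.mapDomain_single]

lemma push_single (φ : E → F) {n : ℕ} (w : Fin n → E) :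
    push φ n (Finsupp.single w 1) = Finsupp.single (φ ∘ w) 1 := by
  simp [push, Finsupp.mapDomain_single]

lemma boundary_cone_zero (b : E) (c : Chain E 0) : boundary 0 (cone b 0 c) = c := by
  have : boundary 0 ∘ₗ cone b 0 = LinearMap.id := by
    ext1 w
    ext1
    simp only [LinearMap.comp_apply, Finsupp.lsingle_apply, cone_single, boundary_single]
    simp [Subsingleton.elim _ w]
  exact LinearMap.congr_fun this c

lemma boundary_cone (b : E) (n : ℕ) (c : Chain E (n + 1)) :
    boundary (n + 1) (cone b (n + 1) c) = c - cone b n (boundary n c) := by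
  have : boundary (n + 1) ∘ₗ cone b (n + 1) = LinearMap.id - cone b n ∘ₗ boundary n := by
    ext1 w
    ext1
    simp only [LinearMap.comp_apply, Finsupp.lsingle_apply, cone_single, boundary_single,
      LinearMap.sub_apply, LinearMap.id_apply, map_sum, map_zsmul]
    rw [Fin.sum_univ_succ, sub_eq_add_neg, ← Finset.sum_neg_distrib]
    congr 1
    · simp only [Fin.val_zero, pow_zero, one_smul]
      congr 1
    · refine Finset.sum_congr rfl fun i _ => ?_
      rw [Fin.val_succ, pow_succ, mul_neg_one, neg_smul]
      congr 3
      funext j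
      refine Fin.cases ?_ (fun j => ?_) j <;> simp
  exact LinearMap.congr_fun this c

lemma boundary_boundary (n : ℕ) (c : Chain E (n + 2)) : boundary n (boundary (n + 1) c) = 0 := by
  have h : boundary n ∘ₗ boundary (n + 1) = (0 : Chain E (n + 2) →ₗ[ℤ] Chain E n) := by
    clear c
    induction n with
    | zero =>
      ext1 w
      ext1
      simp only [LinearMap.comp_apply, Finsupp.lsingle_apply, LinearMap.zero_apply]
      rw [← Fin.cons_self_tail w, ← cone_single, boundary_cone, map_sub, boundary_cone_zero,
        sub_self]
    | succ n ih =>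
      ext1 w
      ext1
      simp only [LinearMap.comp_apply, Finsupp.lsingle_apply, LinearMap.zero_apply]
      rw [← Fin.cons_self_tail w, ← cone_single, boundary_cone, map_sub, boundary_cone,
        ← LinearMap.comp_apply (boundary n), ih]
      simp
  exact LinearMap.congr_fun h c

lemma push_boundary (φ : E → F) (n : ℕ) (c : Chain E (n + 1)) :
    push φ n (boundary n c) = boundary n (push φ (n + 1) c) := by
  have : push φ n ∘ₗ boundary n = boundary n ∘ₗ push φ (n + 1) := by
    ext1 w
    ext1
    simp only [LinearMap.comp_apply, Finsupp.lsingle_apply, push_single, boundary_single,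
      map_sum, map_zsmul]
    rfl
  exact LinearMap.congr_fun this c

lemma push_cone (φ : E → F) (b : E) (n : ℕ) (c : Chain E n) :
    push φ (n + 1) (cone b n c) = cone (φ b) n (push φ n c) := by
  have : push φ (n + 1) ∘ₗ cone b n = cone (φ b) n ∘ₗ push φ n := by
    ext1 w
    ext1
    simp only [LinearMap.comp_apply, Finsupp.lsingle_apply, push_single, cone_single]
    congr 1
    funext j
    refine Fin.cases ?_ (fun j => ?_) j <;> simp
  exact LinearMap.congr_fun this c

variable (β : ∀ n : ℕ, (Fin (n + 1) → E) → E) (β' : ∀ n : ℕ, (Fin (n + 1) → F) → F)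

/-- The barycentric subdivision with respect to a choice `β` of a centre for every nonempty tuple:
subdivide the boundary and take the cone from the centre. -/
def subdivision : ∀ n : ℕ, Chain E n →ₗ[ℤ] Chain E n
  | 0 => LinearMap.id
  | n + 1 => Finsupp.linearCombination ℤ fun w =>
      cone (β n w) n (subdivision n (boundary n (Finsupp.single w 1)))

/-- The chain homotopy from the subdivision to the identity. -/
def subdivisionHomotopy : ∀ n : ℕ, Chain E n →ₗ[ℤ] Chain E (n + 1)
  | 0 => 0
  | n + 1 => Finsupp.linearCombination ℤ fun w =>
      cone (β n w) (n + 1) (Finsupp.single w 1 -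
        subdivisionHomotopy n (boundary n (Finsupp.single w 1)))

lemma subdivision_single {n : ℕ} (w : Fin (n + 1) → E) :
    subdivision β (n + 1) (Finsupp.single w 1) =
      cone (β n w) n (subdivision β n (boundary n (Finsupp.single w 1))) := by
  simp [subdivision]

lemma subdivisionHomotopy_single {n : ℕ} (w : Fin (n + 1) → E) :
    subdivisionHomotopy β (n + 1) (Finsupp.single w 1) =
      cone (β n w) (n + 1) (Finsupp.single w 1 -
        subdivisionHomotopy β n (boundary n (Finsupp.single w 1))) := by
  simp [subdivisionHomotopy]

lemma boundary_subdivision (n : ℕ) (c : Chain E (n + 1)) :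
    boundary n (subdivision β (n + 1) c) = subdivision β n (boundary n c) := by
  have h : boundary n ∘ₗ subdivision β (n + 1) = subdivision β n ∘ₗ boundary n := by
    clear c
    induction n with
    | zero =>
      ext1 w
      ext1
      simp only [LinearMap.comp_apply, Finsupp.lsingle_apply, subdivision_single,
        boundary_cone_zero]
    | succ n ih =>
      ext1 w
      ext1
      simp only [LinearMap.comp_apply, Finsupp.lsingle_apply]
      rw [subdivision_single, boundary_cone, ← LinearMap.comp_apply (boundary n), ih,
        LinearMap.comp_apply, boundary_boundary, map_zero, map_zero, sub_zero]
  exact LinearMap.congr_fun h c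

lemma boundary_subdivisionHomotopy (n : ℕ) (c : Chain E (n + 1)) :
    boundary (n + 1) (subdivisionHomotopy β (n + 1) c) +
      subdivisionHomotopy β n (boundary n c) = c - subdivision β (n + 1) c := by
  have h : boundary (n + 1) ∘ₗ subdivisionHomotopy β (n + 1) +
      subdivisionHomotopy β n ∘ₗ boundary n = LinearMap.id - subdivision β (n + 1) := by
    clear c
    induction n with
    | zero =>
      ext1 w
      ext1
      simp only [LinearMap.comp_apply, LinearMap.add_apply, LinearMap.sub_apply,
        LinearMap.id_apply, Finsupp.lsingle_apply, subdivisionHomotopy_single, boundary_cone,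
        subdivision_single]
      simp [subdivisionHomotopy, subdivision]
    | succ n ih =>
      ext1 w
      ext1
      simp only [LinearMap.comp_apply, LinearMap.add_apply, LinearMap.sub_apply,
        LinearMap.id_apply, Finsupp.lsingle_apply]
      rw [subdivisionHomotopy_single, boundary_cone, subdivision_single]
      have := LinearMap.congr_fun ih (boundary (n + 1) (Finsupp.single w 1))
      simp only [LinearMap.comp_apply, LinearMap.add_apply, LinearMap.sub_apply,
        LinearMap.id_apply, boundary_boundary, map_zero, add_zero] at this
      rw [map_sub (boundary (n + 1)), this, map_sub (cone _ _), map_sub (cone _ _)]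
      abel
  exact LinearMap.congr_fun h c

lemma push_subdivision {φ : E → F} (hφ : ∀ n w, φ (β n w) = β' n (φ ∘ w)) (n : ℕ)
    (c : Chain E n) : push φ n (subdivision β n c) = subdivision β' n (push φ n c) := by
  have h : push φ n ∘ₗ subdivision β n = subdivision β' n ∘ₗ push φ n := by
    clear c
    induction n with
    | zero => rfl
    | succ n ih =>
      ext1 w
      ext1
      simp only [LinearMap.comp_apply, Finsupp.lsingle_apply]
      rw [subdivision_single, push_cone, push_single, subdivision_single, hφ,
        ← LinearMap.comp_apply (push φ n), ih, LinearMap.comp_apply, push_boundary, push_single]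
  exact LinearMap.congr_fun h c

lemma push_subdivisionHomotopy {φ : E → F} (hφ : ∀ n w, φ (β n w) = β' n (φ ∘ w)) (n : ℕ)
    (c : Chain E n) :
    push φ (n + 1) (subdivisionHomotopy β n c) = subdivisionHomotopy β' n (push φ n c) := by
  have h : push φ (n + 1) ∘ₗ subdivisionHomotopy β n = subdivisionHomotopy β' n ∘ₗ push φ n := by
    clear c
    induction n with
    | zero => simp [subdivisionHomotopy]
    | succ n ih =>
      ext1 w
      ext1
      simp only [LinearMap.comp_apply, Finsupp.lsingle_apply]
      rw [subdivisionHomotopy_single, push_cone, push_single, subdivisionHomotopy_single, hφ,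
        map_sub, ← LinearMap.comp_apply (push φ (n + 1)), ih, LinearMap.comp_apply,
        push_boundary, push_single]
  exact LinearMap.congr_fun h c

end TupleChain

/-! ### Affine simplices and the mesh of their subdivision -/

namespace AffineSimplex

/-- The topological simplex with `n` vertices (of dimension `n - 1`; empty for `n = 0`). -/
abbrev Simplex (n : ℕ) : Type := stdSimplex ℝ (Fin n)

/-- The affine combination of the points `w` with barycentric coordinates `x`. -/
def comb {n k : ℕ} (w : Fin n → Simplex k) (x : Simplex n) : Simplex k :=
  ⟨∑ i, x i • (w i : Fin k → ℝ),
    (convex_stdSimplex ℝ (Fin k)).sum_mem (fun i _ => x.2.1 i) x.2.2 fun i _ => (w i).2⟩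

lemma comb_coe {n k : ℕ} (w : Fin n → Simplex k) (x : Simplex n) :
    (comb w x : Fin k → ℝ) = ∑ i, x i • (w i : Fin k → ℝ) := rfl

lemma comb_apply {n k : ℕ} (w : Fin n → Simplex k) (x : Simplex n) (j : Fin k) :
    comb w x j = ∑ i, x i * w i j := by
  rw [comb_coe, Finset.sum_apply]
  rfl

/-- The affine simplex with vertices `w`. -/
def affine {n k : ℕ} (w : Fin n → Simplex k) : C(Simplex n, Simplex k) where
  toFun := comb w
  continuous_toFun := by
    refine Continuous.subtype_mk ?_ _
    refine continuous_finsetSum _ fun i _ => ?_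
    exact ((continuous_apply i).comp continuous_subtype_val).smul continuous_const

lemma comb_comb {m n k : ℕ} (w : Fin n → Simplex k) (u : Fin m → Simplex n) (x : Simplex m) :
    comb w (comb u x) = comb (comb w ∘ u) x := by
  apply stdSimplex.ext
  funext j
  simp only [comb_apply, Function.comp_apply, Finset.sum_mul, Finset.mul_sum]
  rw [Finset.sum_comm]
  exact Finset.sum_congr rfl fun _ _ => Finset.sum_congr rfl fun _ _ => by ring

lemma comb_vertex {n : ℕ} (x : Simplex n) : comb (fun i => stdSimplex.vertex i) x = x := by
  apply stdSimplex.ext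
  funext j
  rw [comb_apply]
  simp [Pi.single_apply]

lemma vertex_comb {n k : ℕ} (w : Fin n → Simplex k) :
    comb w ∘ (fun i => stdSimplex.vertex i) = w := by
  funext i
  apply stdSimplex.ext
  funext j
  rw [Function.comp_apply, comb_apply]
  simp [Pi.single_apply]

/-- The inclusion of the face opposite to the `i`-th vertex. -/
def face {n : ℕ} (i : Fin (n + 1)) : C(Simplex n, Simplex (n + 1)) :=
  ⟨stdSimplex.map i.succAbove, stdSimplex.continuous_map _⟩

lemma comb_face {n k : ℕ} (w : Fin (n + 1) → Simplex k) (i : Fin (n + 1)) (x : Simplex n) :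
    comb w (face i x) = comb (w ∘ i.succAbove) x := by
  apply stdSimplex.ext
  funext j
  rw [comb_apply, comb_apply, Fin.sum_univ_succAbove _ i]
  have h (l : Fin (n + 1)) : face i x l =
      ∑ m ∈ Finset.univ.filter (fun m => i.succAbove m = l), x m := by
    change (FunOnFinite.linearMap ℝ ℝ i.succAbove x) l = _
    rw [FunOnFinite.linearMap_apply_apply]
  simp [h, Fin.succAbove_ne, Finset.filter_eq']

/-- The barycenter of a nonempty tuple of points. -/
def centre {k : ℕ} (n : ℕ) (w : Fin (n + 1) → Simplex k) : Simplex k :=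
  comb w stdSimplex.barycenter

lemma comb_centre {k l : ℕ} (u : Fin k → Simplex l) (n : ℕ) (w : Fin (n + 1) → Simplex k) :
    comb u (centre n w) = centre n (comb u ∘ w) := comb_comb _ _ _

lemma comb_mem_convexHull {n k : ℕ} (w : Fin n → Simplex k) (x : Simplex n) :
    (comb w x : Fin k → ℝ) ∈ convexHull ℝ (range fun i => (w i : Fin k → ℝ)) :=
  (convex_convexHull ℝ _).sum_mem (fun i _ => x.2.1 i) x.2.2
    fun i _ => subset_convexHull _ _ (mem_range_self i)

lemma dist_centre_le {k n : ℕ} (w : Fin (n + 1) → Simplex k) {r : ℝ}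
    (hw : ∀ i j, dist (w i) (w j) ≤ r) (j : Fin (n + 1)) :
    dist (centre n w) (w j) ≤ n / (n + 1) * r := by
  rw [Subtype.dist_eq, dist_eq_norm]
  have h1 : (centre n w : Fin k → ℝ) - w j =
      ∑ i, ((n : ℝ) + 1)⁻¹ • ((w i : Fin k → ℝ) - w j) := by
    have hb (i : Fin (n + 1)) :
        (stdSimplex.barycenter : Simplex (n + 1)) i = ((n : ℝ) + 1)⁻¹ := by
      change (stdSimplex.barycenter : Simplex (n + 1)).val i = _
      simp
    rw [centre, comb_coe]
    simp only [hb, smul_sub, Finset.sum_sub_distrib]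
    congr 1
    rw [Finset.sum_const, Finset.card_univ, Fintype.card_fin, ← Nat.cast_smul_eq_nsmul ℝ, smul_smul]
    push_cast
    rw [mul_inv_cancel₀ (by positivity), one_smul]
  change ‖(centre n w : Fin k → ℝ) - w j‖ ≤ _
  rw [h1, Fin.sum_univ_succAbove _ j, sub_self, smul_zero, zero_add]
  refine (norm_sum_le _ _).trans ?_
  have : ∀ i : Fin n, ‖((n : ℝ) + 1)⁻¹ • ((w (j.succAbove i) : Fin k → ℝ) - w j)‖ ≤
      ((n : ℝ) + 1)⁻¹ * r := fun i => by
    rw [norm_smul, Real.norm_of_nonneg (by positivity), ← dist_eq_norm]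
    exact mul_le_mul_of_nonneg_left (hw _ _) (by positivity)
  refine (Finset.sum_le_sum fun i _ => this i).trans ?_
  rw [Finset.sum_const, Finset.card_univ, Fintype.card_fin, nsmul_eq_mul]
  apply le_of_eq
  ring

open TupleChain

/-- One barycentric subdivision of a simplex with `n` vertices shrinks the mesh by the factor
`(n - 1) / n`, and does not leave the convex hull. -/
lemma subdivision_mem_supported {k : ℕ} (n : ℕ) (w : Fin n → Simplex k) {r : ℝ} (hr : 0 ≤ r)
    (hw : ∀ i j, dist (w i) (w j) ≤ r) :
    subdivision centre n (Finsupp.single w 1) ∈ Finsupp.supported ℤ ℤ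
      {u : Fin n → Simplex k |
        (∀ i, (u i : Fin k → ℝ) ∈ convexHull ℝ (range fun i => (w i : Fin k → ℝ))) ∧
        ∀ i j, dist (u i) (u j) ≤ ((n : ℝ) - 1) / n * r} := by
  induction n with
  | zero => exact Finsupp.single_mem_supported _ _ ⟨fun i => i.elim0, fun i => i.elim0⟩
  | succ n ih =>
    rw [subdivision_single]
    have hρ : ((n : ℝ) - 1) / n ≤ n / (n + 1) := by
      rcases Nat.eq_zero_or_pos n with rfl | hn
      · simp
      · have : (0 : ℝ) < n := by exact_mod_cast hn
        rw [div_le_div_iff₀ this (by positivity)]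
        nlinarith
    have key : subdivision centre n (boundary n (Finsupp.single w 1)) ∈ Finsupp.supported ℤ ℤ
        {u : Fin n → Simplex k |
          (∀ i, (u i : Fin k → ℝ) ∈ convexHull ℝ (range fun i => (w i : Fin k → ℝ))) ∧
          ∀ i j, dist (u i) (u j) ≤ n / (n + 1) * r} := by
      rw [boundary_single, map_sum]
      refine Submodule.sum_mem _ fun i _ => ?_
      rw [map_zsmul]
      refine Submodule.smul_mem _ _ ?_
      refine Finsupp.supported_mono ?_ (ih (w ∘ i.succAbove) fun a b => hw _ _)
      rintro u ⟨h1, h2⟩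
      refine ⟨fun a => convexHull_mono ?_ (h1 a), fun a b => (h2 a b).trans
        (mul_le_mul_of_nonneg_right hρ hr)⟩
      rintro _ ⟨b, rfl⟩
      exact ⟨_, rfl⟩
    have hcone : ∀ c ∈ Finsupp.supported ℤ ℤ
        {u : Fin n → Simplex k |
          (∀ i, (u i : Fin k → ℝ) ∈ convexHull ℝ (range fun i => (w i : Fin k → ℝ))) ∧
          ∀ i j, dist (u i) (u j) ≤ n / (n + 1) * r},
        cone (centre n w) n c ∈ Finsupp.supported ℤ ℤ
      {u : Fin (n + 1) → Simplex k |
        (∀ i, (u i : Fin k → ℝ) ∈ convexHull ℝ (range fun i => (w i : Fin k → ℝ))) ∧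
        ∀ i j, dist (u i) (u j) ≤ (((n + 1 : ℕ) : ℝ) - 1) / ((n + 1 : ℕ) : ℝ) * r} := by
      intro c hc
      rw [Finsupp.supported_eq_span_single] at hc
      induction hc using Submodule.span_induction with
      | zero => rw [map_zero]; exact Submodule.zero_mem _
      | add x y _ _ hx hy => rw [map_add]; exact Submodule.add_mem _ hx hy
      | smul a x _ hx => rw [map_smul]; exact Submodule.smul_mem _ _ hx
      | mem x hx =>
        obtain ⟨u, ⟨hu1, hu2⟩, rfl⟩ := hx
        rw [cone_single]
        refine Finsupp.single_mem_supported _ _ ?_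
        have hball : ∀ j, dist (centre n w) (u j) ≤ n / (n + 1) * r := by
          intro j
          have hc : convexHull ℝ (range fun i => (w i : Fin k → ℝ)) ⊆
              Metric.closedBall (centre n w : Fin k → ℝ) (n / (n + 1) * r) := by
            refine convexHull_min ?_ (convex_closedBall _ _)
            rintro _ ⟨i, rfl⟩
            rw [Metric.mem_closedBall, dist_comm]
            exact dist_centre_le w hw i
          have := hc (hu1 j)
          rwa [Metric.mem_closedBall, dist_comm] at this
        have hpos : 0 ≤ (n : ℝ) / (n + 1) * r := by positivity
        push_cast
        simp only [add_sub_cancel_right]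
        refine ⟨fun i => ?_, fun i j => ?_⟩
        · refine Fin.cases ?_ (fun i => ?_) i
          · exact comb_mem_convexHull _ _
          · simpa using hu1 i
        · refine Fin.cases ?_ (fun i => ?_) i <;> refine Fin.cases ?_ (fun j => ?_) j
          · simpa using hpos
          · simpa using hball j
          · simpa [dist_comm] using hball i
          · simpa using hu2 i j
    exact hcone _ key

lemma iterate_subdivision_mem_supported {k : ℕ} (n : ℕ) (hn : 0 < n) (w : Fin n → Simplex k)
    {r : ℝ} (hr : 0 ≤ r) (hw : ∀ i j, dist (w i) (w j) ≤ r) (m : ℕ) :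
    (subdivision centre n)^[m] (Finsupp.single w 1) ∈ Finsupp.supported ℤ ℤ
      {u : Fin n → Simplex k | ∀ i j, dist (u i) (u j) ≤ (((n : ℝ) - 1) / n) ^ m * r} := by
  have hn' : (1 : ℝ) ≤ n := by exact_mod_cast hn
  have hρ : 0 ≤ ((n : ℝ) - 1) / n := div_nonneg (by linarith) (by linarith)
  induction m with
  | zero => exact Finsupp.single_mem_supported _ _ (by simpa using hw)
  | succ m ih =>
    rw [Function.iterate_succ_apply']
    rw [Finsupp.supported_eq_span_single] at ih
    generalize (subdivision centre n)^[m] (Finsupp.single w 1) = c at ih ⊢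
    induction ih using Submodule.span_induction with
    | zero => rw [map_zero]; exact Submodule.zero_mem _
    | add x y _ _ hx hy => rw [map_add]; exact Submodule.add_mem _ hx hy
    | smul a x _ hx => rw [map_smul]; exact Submodule.smul_mem _ _ hx
    | mem x hx =>
      obtain ⟨u, hu, rfl⟩ := hx
      refine Finsupp.supported_mono ?_
        (subdivision_mem_supported n u (mul_nonneg (pow_nonneg hρ m) hr) hu)
      rintro v ⟨-, hv⟩ i j
      rw [pow_succ', mul_assoc]
      exact hv i j

end AffineSimplex

/-! ### Small singular chains -/

namespace SingularChain

open AffineSimplex TupleChain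

variable {X Y : Type*} [TopologicalSpace X] [TopologicalSpace Y]

/-- Singular chains on simplices with `n` vertices; thus `n = 0` is the augmentation degree. -/
abbrev SChain (X : Type*) [TopologicalSpace X] (n : ℕ) : Type _ := C(Simplex n, X) →₀ ℤ

/-- The singular boundary operator. -/
def bd (n : ℕ) : SChain X (n + 1) →ₗ[ℤ] SChain X n :=
  ∑ i : Fin (n + 1), (-1 : ℤ) ^ (i : ℕ) •
    Finsupp.lmapDomain ℤ ℤ (fun σ : C(Simplex (n + 1), X) => σ.comp (face i))

lemma bd_single {n : ℕ} (σ : C(Simplex (n + 1), X)) :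
    bd n (Finsupp.single σ 1) =
      ∑ i : Fin (n + 1), (-1 : ℤ) ^ (i : ℕ) • Finsupp.single (σ.comp (face i)) 1 := by
  simp [bd, LinearMap.sum_apply, Finsupp.mapDomain_single]

/-- The singular chain obtained by composing affine simplices of a simplex with `σ`. -/
def realize {k : ℕ} (σ : C(Simplex k, X)) (n : ℕ) :
    Chain (Simplex k) n →ₗ[ℤ] SChain X n :=
  Finsupp.lmapDomain ℤ ℤ fun w => σ.comp (affine w)

lemma realize_single {k : ℕ} (σ : C(Simplex k, X)) {n : ℕ} (w : Fin n → Simplex k) :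
    realize σ n (Finsupp.single w 1) = Finsupp.single (σ.comp (affine w)) 1 := by
  simp [realize, Finsupp.mapDomain_single]

lemma bd_realize {k : ℕ} (σ : C(Simplex k, X)) (n : ℕ) (c : Chain (Simplex k) (n + 1)) :
    bd n (realize σ (n + 1) c) = realize σ n (boundary n c) := by
  have : bd n ∘ₗ realize σ (n + 1) = realize σ n ∘ₗ boundary n := by
    ext1 w
    ext1
    simp only [LinearMap.comp_apply, Finsupp.lsingle_apply, realize_single, boundary_single,
      bd_single, map_sum, map_zsmul]
    refine Finset.sum_congr rfl fun i _ => ?_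
    congr 2
    ext1 x
    exact congrArg σ (comb_face w i x)
  exact LinearMap.congr_fun this c

lemma realize_comp_affine {k l : ℕ} (σ : C(Simplex l, X)) (w : Fin k → Simplex l) (n : ℕ)
    (c : Chain (Simplex k) n) :
    realize (σ.comp (affine w)) n c = realize σ n (push (comb w) n c) := by
  have : realize (σ.comp (affine w)) n = realize σ n ∘ₗ push (comb w) n := by
    ext1 u
    ext1
    simp only [LinearMap.comp_apply, Finsupp.lsingle_apply, realize_single, push_single]
    congr 1
    ext1 x
    exact congrArg σ (comb_comb w u x)
  exact LinearMap.congr_fun this c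

/-- The tuple of vertices of the simplex. -/
def vertices (n : ℕ) : Fin n → Simplex n := fun i => stdSimplex.vertex i

lemma comb_vertices {n k : ℕ} (w : Fin n → Simplex k) : comb w ∘ vertices n = w :=
  vertex_comb w

lemma realize_vertices {n : ℕ} (σ : C(Simplex n, X)) :
    realize σ n (Finsupp.single (vertices n) 1) = Finsupp.single σ 1 := by
  rw [realize_single]
  congr 1
  ext1 x
  exact congrArg σ (comb_vertex x)

/-- Barycentric subdivision of singular chains. -/
def sd (n : ℕ) : SChain X n →ₗ[ℤ] SChain X n :=
  Finsupp.linearCombination ℤ fun σ =>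
    realize σ n (subdivision centre n (Finsupp.single (vertices n) 1))

/-- The chain homotopy from barycentric subdivision to the identity. -/
def sdHomotopy (n : ℕ) : SChain X n →ₗ[ℤ] SChain X (n + 1) :=
  Finsupp.linearCombination ℤ fun σ =>
    realize σ (n + 1) (subdivisionHomotopy centre n (Finsupp.single (vertices n) 1))

lemma sd_realize {k : ℕ} (σ : C(Simplex k, X)) (n : ℕ) (c : Chain (Simplex k) n) :
    sd n (realize σ n c) = realize σ n (subdivision centre n c) := by
  have : sd n ∘ₗ realize σ n = realize σ n ∘ₗ subdivision centre n := by
    ext1 w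
    ext1
    simp only [LinearMap.comp_apply, Finsupp.lsingle_apply, realize_single, sd,
      Finsupp.linearCombination_single, one_smul]
    rw [realize_comp_affine, push_subdivision centre centre (comb_centre w), push_single,
      comb_vertices]
  exact LinearMap.congr_fun this c

lemma sdHomotopy_realize {k : ℕ} (σ : C(Simplex k, X)) (n : ℕ) (c : Chain (Simplex k) n) :
    sdHomotopy n (realize σ n c) = realize σ (n + 1) (subdivisionHomotopy centre n c) := by
  have : sdHomotopy n ∘ₗ realize σ n = realize σ (n + 1) ∘ₗ subdivisionHomotopy centre n := by
    ext1 w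
    ext1
    simp only [LinearMap.comp_apply, Finsupp.lsingle_apply, realize_single, sdHomotopy,
      Finsupp.linearCombination_single, one_smul]
    rw [realize_comp_affine, push_subdivisionHomotopy centre centre (comb_centre w), push_single,
      comb_vertices]
  exact LinearMap.congr_fun this c

lemma bd_sd (n : ℕ) (c : SChain X (n + 1)) : bd n (sd (n + 1) c) = sd n (bd n c) := by
  have : bd n ∘ₗ sd (n + 1) = sd n ∘ₗ (bd n : SChain X (n + 1) →ₗ[ℤ] _) := by
    ext1 σ
    ext1
    simp only [LinearMap.comp_apply, Finsupp.lsingle_apply]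
    rw [← realize_vertices, sd_realize, bd_realize, bd_realize, sd_realize, boundary_subdivision]
  exact LinearMap.congr_fun this c

lemma bd_sdHomotopy (n : ℕ) (c : SChain X (n + 1)) :
    bd (n + 1) (sdHomotopy (n + 1) c) + sdHomotopy n (bd n c) = c - sd (n + 1) c := by
  have : bd (n + 1) ∘ₗ sdHomotopy (n + 1) + sdHomotopy n ∘ₗ bd n =
      LinearMap.id - (sd (n + 1) : SChain X (n + 1) →ₗ[ℤ] _) := by
    ext1 σ
    ext1
    simp only [LinearMap.comp_apply, Finsupp.lsingle_apply, LinearMap.add_apply,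
      LinearMap.sub_apply, LinearMap.id_apply]
    rw [← realize_vertices, sdHomotopy_realize, sd_realize, bd_realize, bd_realize,
      sdHomotopy_realize, ← map_add, ← map_sub, boundary_subdivisionHomotopy]
  exact LinearMap.congr_fun this c

/-- The chains on simplices that lie in one of the two sets `U` and `V`. -/
def small (U V : Set X) (n : ℕ) : Submodule ℤ (SChain X n) :=
  Finsupp.supported ℤ ℤ {σ | range σ ⊆ U ∨ range σ ⊆ V}

lemma realize_mem_small {U V : Set X} {k : ℕ} {σ : C(Simplex k, X)}
    (hσ : range σ ⊆ U ∨ range σ ⊆ V) (n : ℕ) (c : Chain (Simplex k) n) :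
    realize σ n c ∈ small U V n := by
  induction c using Finsupp.induction_linear with
  | zero => rw [map_zero]; exact Submodule.zero_mem _
  | add x y hx hy => rw [map_add]; exact Submodule.add_mem _ hx hy
  | single w a =>
    have : Finsupp.single w a = a • Finsupp.single w (1 : ℤ) := by simp
    rw [this, map_smul, realize_single]
    refine Submodule.smul_mem _ _ (Finsupp.single_mem_supported _ _ ?_)
    have h : range (σ.comp (affine w)) ⊆ range σ := by
      rintro _ ⟨x, rfl⟩
      exact ⟨_, rfl⟩
    exact hσ.imp h.trans h.trans

lemma linearCombination_mem_small {U V : Set X} {m n : ℕ} {g : C(Simplex m, X) → SChain X n}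
    (hg : ∀ σ : C(Simplex m, X), range σ ⊆ U ∨ range σ ⊆ V → g σ ∈ small U V n) {c : SChain X m}
    (hc : c ∈ small U V m) : Finsupp.linearCombination ℤ g c ∈ small U V n := by
  rw [Finsupp.linearCombination_apply]
  exact Submodule.sum_mem _ fun σ hσ => Submodule.smul_mem _ _ (hg σ (hc hσ))

lemma sd_mem_small {U V : Set X} {n : ℕ} {c : SChain X n} (hc : c ∈ small U V n) :
    sd n c ∈ small U V n :=
  linearCombination_mem_small (fun _ hσ => realize_mem_small hσ _ _) hc

lemma sdHomotopy_mem_small {U V : Set X} {n : ℕ} {c : SChain X n} (hc : c ∈ small U V n) :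
    sdHomotopy n c ∈ small U V (n + 1) :=
  linearCombination_mem_small (fun _ hσ => realize_mem_small hσ _ _) hc

/-- By Lebesgue's number lemma, a sufficiently fine subdivision of a singular simplex is small. -/
lemma exists_iterate_sd_single_mem_small {U V : Set X} (hU : IsOpen U) (hV : IsOpen V)
    (hUV : U ∪ V = univ) {n : ℕ} (σ : C(Simplex (n + 1), X)) :
    ∃ m, (sd (n + 1))^[m] (Finsupp.single σ 1) ∈ small U V (n + 1) := by
  obtain ⟨δ, hδ, hball⟩ := lebesgue_number_lemma_of_metric (s := (univ : Set (Simplex (n + 1))))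
    (c := fun b : Bool => σ ⁻¹' (if b then U else V)) isCompact_univ
    (fun b => by cases b <;> simpa using IsOpen.preimage σ.continuous ‹_›)
    (fun x _ => by
      have : σ x ∈ U ∪ V := hUV ▸ mem_univ _
      rcases this with h | h
      · exact mem_iUnion.2 ⟨true, by simpa using h⟩
      · exact mem_iUnion.2 ⟨false, by simpa using h⟩)
  have hρ0 : 0 ≤ (((n + 1 : ℕ) : ℝ) - 1) / ((n + 1 : ℕ) : ℝ) := by
    push_cast
    simp only [add_sub_cancel_right]
    positivity
  have hρ1 : (((n + 1 : ℕ) : ℝ) - 1) / ((n + 1 : ℕ) : ℝ) < 1 := by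
    rw [div_lt_one (by positivity)]
    linarith
  obtain ⟨r, hr⟩ : ∃ r, ∀ i j, dist (vertices (n + 1) i) (vertices (n + 1) j) ≤ r :=
    ⟨Metric.diam (univ : Set (Simplex (n + 1))), fun i j =>
      Metric.dist_le_diam_of_mem isCompact_univ.isBounded (mem_univ _) (mem_univ _)⟩
  have hr0 : 0 ≤ r := dist_nonneg.trans (hr 0 0)
  obtain ⟨m, hm⟩ : ∃ m : ℕ, ((((n + 1 : ℕ) : ℝ) - 1) / ((n + 1 : ℕ) : ℝ)) ^ m * r < δ := by
    have := (tendsto_pow_atTop_nhds_zero_of_lt_one hρ0 hρ1).mul_const r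
    rw [zero_mul] at this
    exact (this.eventually (gt_mem_nhds hδ)).exists
  refine ⟨m, ?_⟩
  have hit : ∀ (k : ℕ) c, (sd (n + 1))^[k] (realize σ (n + 1) c) =
      realize σ (n + 1) ((subdivision centre (n + 1))^[k] c) := by
    intro k c
    induction k with
    | zero => rfl
    | succ k ih =>
      rw [Function.iterate_succ_apply', Function.iterate_succ_apply', ih, sd_realize]
  rw [← realize_vertices, hit]
  have hmem := iterate_subdivision_mem_supported (n + 1) n.succ_pos (vertices (n + 1)) hr0 hr m
  rw [Finsupp.supported_eq_span_single] at hmem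
  generalize (subdivision centre (n + 1))^[m] (Finsupp.single (vertices (n + 1)) 1) = c at hmem ⊢
  induction hmem using Submodule.span_induction with
  | zero => rw [map_zero]; exact Submodule.zero_mem _
  | add x y _ _ hx hy => rw [map_add]; exact Submodule.add_mem _ hx hy
  | smul a x _ hx => rw [map_smul]; exact Submodule.smul_mem _ _ hx
  | mem x hx =>
    obtain ⟨u, hu, rfl⟩ := hx
    rw [realize_single]
    refine Finsupp.single_mem_supported _ _ ?_
    obtain ⟨b, hb⟩ := hball (u 0) (mem_univ _)
    have hsub : range (σ.comp (affine u)) ⊆ (if b then U else V) := by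
      rintro _ ⟨x, rfl⟩
      refine hb ?_
      have hc : convexHull ℝ (range fun i => (u i : Fin (n + 1) → ℝ)) ⊆
          Metric.ball (u 0 : Fin (n + 1) → ℝ) δ := by
        refine convexHull_min ?_ (convex_ball _ _)
        rintro _ ⟨i, rfl⟩
        exact (hu i 0).trans_lt hm
      exact hc (comb_mem_convexHull u x)
    cases b
    · exact Or.inr hsub
    · exact Or.inl hsub

lemma exists_iterate_sd_mem_small {U V : Set X} (hU : IsOpen U) (hV : IsOpen V)
    (hUV : U ∪ V = univ) {n : ℕ} (c : SChain X (n + 1)) :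
    ∃ m, (sd (n + 1))^[m] c ∈ small U V (n + 1) := by
  have hmono : ∀ (k : ℕ) (c : SChain X (n + 1)), c ∈ small U V (n + 1) →
      (sd (n + 1))^[k] c ∈ small U V (n + 1) := by
    intro k
    induction k with
    | zero => exact fun c hc => hc
    | succ k ih => exact fun c hc => ih _ (sd_mem_small hc)
  have hadd : ∀ (k : ℕ) (c c' : SChain X (n + 1)), (sd (n + 1))^[k] (c + c') =
      (sd (n + 1))^[k] c + (sd (n + 1))^[k] c' := fun k c c' => iterate_map_add _ k c c'
  induction c using Finsupp.induction_linear with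
  | zero => exact ⟨0, Submodule.zero_mem _⟩
  | add x y hx hy =>
    obtain ⟨a, ha⟩ := hx
    obtain ⟨b, hb⟩ := hy
    refine ⟨a + b, ?_⟩
    rw [hadd]
    refine Submodule.add_mem _ ?_ ?_
    · rw [add_comm a b, Function.iterate_add_apply]
      exact hmono _ _ ha
    · rw [Function.iterate_add_apply]
      exact hmono _ _ hb
  | single σ a =>
    obtain ⟨m, hm⟩ := exists_iterate_sd_single_mem_small hU hV hUV σ
    refine ⟨m, ?_⟩
    have : Finsupp.single σ a = a • Finsupp.single σ (1 : ℤ) := by simp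
    rw [this, iterate_map_zsmul]
    exact Submodule.smul_mem _ _ hm

/-- The small simplices theorem: a chain with small boundary is homologous to a small chain. -/
theorem exists_sub_bd_mem_small {U V : Set X} (hU : IsOpen U) (hV : IsOpen V)
    (hUV : U ∪ V = univ) {n : ℕ} (z : SChain X (n + 1)) (hz : bd n z ∈ small U V n) :
    ∃ c : SChain X (n + 2), z - bd (n + 1) c ∈ small U V (n + 1) := by
  obtain ⟨m, hm⟩ := exists_iterate_sd_mem_small hU hV hUV z
  have key : ∀ k, bd n ((sd (n + 1))^[k] z) ∈ small U V n ∧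
      ∃ c : SChain X (n + 2), z - (sd (n + 1))^[k] z - bd (n + 1) c ∈ small U V (n + 1) := by
    intro k
    induction k with
    | zero => exact ⟨hz, 0, by simp⟩
    | succ k ih =>
      obtain ⟨h1, c, hc⟩ := ih
      rw [Function.iterate_succ_apply']
      refine ⟨by rw [bd_sd]; exact sd_mem_small h1, c + sdHomotopy (n + 1) ((sd (n + 1))^[k] z), ?_⟩
      have h2 := bd_sdHomotopy n ((sd (n + 1))^[k] z)
      have h3 := Submodule.add_mem _ hc (sdHomotopy_mem_small h1)
      convert h3 using 1
      rw [map_add, eq_sub_of_add_eq h2]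
      abel
  obtain ⟨-, c, hc⟩ := key m
  refine ⟨c, ?_⟩
  convert Submodule.add_mem _ hc hm using 1
  abel

end SingularChain

/-! ### Exact sequences of chain complexes -/

namespace ChainHomology

open CategoryTheory Limits HomologicalComplex

/-- A degreewise injective chain map is a quasi-isomorphism as soon as every relative cycle is a
relative boundary. -/
lemma isIso_homologyMap_of_relative_cycles {A B : ChainComplex (ModuleCat.{0} ℤ) ℕ} (φ : A ⟶ B)
    [Mono φ]
    (h : ∀ (n : ℕ) (z : B.X n), (∀ m, m + 1 = n → ∃ a, B.d n m z = φ.f m a) →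
      ∃ c a, z = B.d (n + 1) n c + φ.f n a) (n : ℕ) :
    IsIso (homologyMap φ n) := by
  let S : ShortComplex (ChainComplex (ModuleCat.{0} ℤ) ℕ) :=
    ShortComplex.mk φ (cokernel.π φ) (cokernel.condition φ)
  have hS : S.ShortExact :=
    { exact := ShortComplex.exact_cokernel φ
      mono_f := inferInstanceAs (Mono φ)
      epi_g := inferInstanceAs (Epi (cokernel.π φ)) }
  have hdeg (n : ℕ) : (S.map (HomologicalComplex.eval _ _ n)).ShortExact :=
    hS.map_of_exact (HomologicalComplex.eval _ _ n)
  have hker (n : ℕ) (x : B.X n) (hx : S.g.f n x = 0) : ∃ a, φ.f n a = x :=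
    (ShortComplex.moduleCat_exact_iff _).1 (hdeg n).exact x hx
  have hsurj (n : ℕ) (x : S.X₃.X n) : ∃ b : B.X n, S.g.f n b = x :=
    (hdeg n).moduleCat_surjective_g x
  -- the hypothesis says that the quotient complex is acyclic
  have hacyc (n : ℕ) : S.X₃.ExactAt n := by
    rw [S.X₃.exactAt_iff' (n + 1) n (n - 1) (by simp) (by cases n <;> simp),
      ShortComplex.moduleCat_exact_iff]
    intro r hr
    obtain ⟨z, rfl⟩ := hsurj n r
    obtain ⟨c, a, hca⟩ := h n z (fun m hm => by
      subst hm
      have h1 : S.g.f m (B.d (m + 1) m z) = 0 := by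
        have := congr($(S.g.comm (m + 1) m) z)
        refine this.symm.trans hr
      obtain ⟨a, ha⟩ := hker m _ h1
      exact ⟨a, ha.symm⟩)
    refine ⟨S.g.f (n + 1) c, ?_⟩
    have h2 := congr($(S.g.comm (n + 1) n) c)
    have h3 : S.g.f n (φ.f n a) = 0 := by
      have := congr(($(S.zero).f n) a)
      exact this
    rw [hca, map_add, h3, add_zero]
    exact h2
  have hepi : Epi (homologyMap φ n) :=
    (hS.homology_exact₂ n).epi_f ((hacyc n).isZero_homology.eq_zero_of_tgt _)
  have hmono : Mono (homologyMap φ n) :=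
    (hS.homology_exact₁ (n + 1) n rfl).mono_g ((hacyc (n + 1)).isZero_homology.eq_zero_of_src _)
  exact isIso_of_mono_of_epi _

lemma finrank_range_add_finrank_ker_of_isDomain {R M N : Type*} [CommRing R] [IsDomain R]
    [AddCommGroup M] [AddCommGroup N] [Module R M] [Module R N] [Module.Finite R M]
    (f : M →ₗ[R] N) :
    Module.finrank R (LinearMap.range f) + Module.finrank R (LinearMap.ker f) =
      Module.finrank R M := by
  rw [← f.quotKerEquivRange.finrank_eq, Submodule.finrank_quotient_add_finrank]

lemma finrank_add_finrank_ker_of_surjective {R M N : Type*} [CommRing R] [IsDomain R]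
    [AddCommGroup M] [AddCommGroup N] [Module R M] [Module R N] [Module.Finite R M]
    {f : M →ₗ[R] N} (hf : Function.Surjective f) :
    Module.finrank R N + Module.finrank R (LinearMap.ker f) = Module.finrank R M := by
  rw [← (f.quotKerEquivOfSurjective hf).finrank_eq, Submodule.finrank_quotient_add_finrank]

/-- The long exact sequence when the first two complexes have homology in degree `0` only. -/
lemma finite_and_finrank_of_shortExact {S : ShortComplex (ChainComplex (ModuleCat.{0} ℤ) ℕ)}
    (hS : S.ShortExact) (h₁ : ∀ n, n ≠ 0 → IsZero (S.X₁.homology n))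
    (h₂ : ∀ n, n ≠ 0 → IsZero (S.X₂.homology n)) (hf₁ : Module.Finite ℤ (S.X₁.homology 0))
    (hf₂ : Module.Finite ℤ (S.X₂.homology 0)) :
    (∀ n, 2 ≤ n → IsZero (S.X₃.homology n)) ∧ Module.Finite ℤ (S.X₃.homology 0) ∧
      Module.Finite ℤ (S.X₃.homology 1) ∧
      (Module.finrank ℤ (S.X₃.homology 0) : ℤ) - Module.finrank ℤ (S.X₃.homology 1) =
        Module.finrank ℤ (S.X₂.homology 0) - Module.finrank ℤ (S.X₁.homology 0) := by
  have hmonoδ (n : ℕ) : Mono (hS.δ (n + 1) n rfl) := hS.mono_δ _ _ _ (h₂ _ n.succ_ne_zero)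
  have hinj : Function.Injective (hS.δ 1 0 rfl).hom :=
    (ModuleCat.mono_iff_injective _).1 (hmonoδ 0)
  have hex₁ : LinearMap.range (hS.δ 1 0 rfl).hom = LinearMap.ker (homologyMap S.f 0).hom :=
    (hS.homology_exact₁ 1 0 rfl).moduleCat_range_eq_ker
  have hex₂ : LinearMap.range (homologyMap S.f 0).hom = LinearMap.ker (homologyMap S.g 0).hom :=
    (hS.homology_exact₂ 0).moduleCat_range_eq_ker
  have := hS.epi_g
  have hepi : Epi (homologyMap S.g 0) :=
    HomologicalComplex.epi_homologyMap_of_epi_of_not_rel S.g 0 (by simp)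
  have hsurj : Function.Surjective (homologyMap S.g 0).hom :=
    (ModuleCat.epi_iff_surjective _).1 hepi
  refine ⟨fun n hn => ?_, Module.Finite.of_surjective _ hsurj,
    Module.Finite.of_injective _ hinj, ?_⟩
  · obtain ⟨m, rfl⟩ : ∃ m, n = m + 1 := ⟨n - 1, by omega⟩
    have := hmonoδ m
    exact (h₁ m (by omega)).of_mono (hS.δ (m + 1) m rfl)
  · have e1 := finrank_range_add_finrank_ker_of_isDomain (homologyMap S.f 0).hom
    have e2 := finrank_add_finrank_ker_of_surjective hsurj
    have e3 := LinearMap.finrank_range_of_inj hinj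
    rw [← hex₂] at e2
    rw [hex₁] at e3
    omega

/-! ### Chains of simplicial sets in coordinates -/

open Simplicial

/-- The chains of a simplicial set are the finitely supported functions on its simplices. -/
def chainEquiv (K : SSet.{0}) (n : ℕ) :
    (K.chainComplex (ModuleCat.of ℤ ℤ)).X n ≃ₗ[ℤ] (K _⦋n⦌ →₀ ℤ) :=
  (IsColimit.coconePointUniqueUpToIso (K.isColimitChainComplexXCofan (ModuleCat.of ℤ ℤ) n)
    (ModuleCat.finsuppCoconeIsColimit ℤ ℤ (K _⦋n⦌))).toLinearEquiv

lemma chainEquiv_ι (K : SSet.{0}) {n : ℕ} (x : K _⦋n⦌) (a : ℤ) :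
    chainEquiv K n ((K.ιChainComplex (R := ModuleCat.of ℤ ℤ) x) a) = Finsupp.single x a := by
  have := IsColimit.comp_coconePointUniqueUpToIso_hom
    (K.isColimitChainComplexXCofan (ModuleCat.of ℤ ℤ) n)
    (ModuleCat.finsuppCoconeIsColimit ℤ ℤ (K _⦋n⦌)) ⟨x⟩
  exact congr($this a)

lemma chainEquiv_symm_single (K : SSet.{0}) {n : ℕ} (x : K _⦋n⦌) (a : ℤ) :
    (chainEquiv K n).symm (Finsupp.single x a) =
      (K.ιChainComplex (R := ModuleCat.of ℤ ℤ) x) a := by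
  rw [LinearEquiv.symm_apply_eq, chainEquiv_ι]

lemma chainEquiv_map {K L : SSet.{0}} (f : K ⟶ L) (n : ℕ)
    (c : (K.chainComplex (ModuleCat.of ℤ ℤ)).X n) :
    chainEquiv L n ((SSet.chainComplexMap f (ModuleCat.of ℤ ℤ)).f n c) =
      Finsupp.lmapDomain ℤ ℤ (fun x : K _⦋n⦌ => f.app _ x) (chainEquiv K n c) := by
  obtain ⟨c, rfl⟩ := (chainEquiv K n).symm.surjective c
  rw [LinearEquiv.apply_symm_apply]
  induction c using Finsupp.induction_linear with
  | zero => simp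
  | add x y hx hy => simp only [map_add, hx, hy]
  | single x a =>
    have := congr($(SSet.ι_chainComplexMap_f K L f (ModuleCat.of ℤ ℤ) x) a)
    rw [chainEquiv_symm_single]
    erw [this]
    rw [chainEquiv_ι]
    simp [Finsupp.mapDomain_single]

lemma chainEquiv_d (K : SSet.{0}) (n : ℕ)
    (c : (K.chainComplex (ModuleCat.of ℤ ℤ)).X (n + 1)) :
    chainEquiv K n ((K.chainComplex (ModuleCat.of ℤ ℤ)).d (n + 1) n c) =
      (∑ i : Fin (n + 2), (-1 : ℤ) ^ (i : ℕ) • Finsupp.lmapDomain ℤ ℤ (K.δ i))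
        (chainEquiv K (n + 1) c) := by
  obtain ⟨c, rfl⟩ := (chainEquiv K (n + 1)).symm.surjective c
  rw [LinearEquiv.apply_symm_apply]
  induction c using Finsupp.induction_linear with
  | zero => simp
  | add x y hx hy => simp only [map_add, hx, hy]
  | single x a =>
    have := congr($(SSet.ιChainComplex_d K (R := ModuleCat.of ℤ ℤ) x) a)
    rw [chainEquiv_symm_single]
    erw [this]
    simp only [ModuleCat.hom_sum, LinearMap.sum_apply, map_sum]
    refine Finset.sum_congr rfl fun i _ => ?_
    rw [LinearMap.smul_apply, Finsupp.lmapDomain_apply, Finsupp.mapDomain_single,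
      ← chainEquiv_ι, ← map_zsmul]
    rfl

end ChainHomology

/-! ### Homotopy invariance and homology of homotopically discrete spaces -/

namespace ChainHomology

open CategoryTheory Limits HomologicalComplex AlgebraicTopology

/-- The singular chain complex of a space with integral coefficients. -/
abbrev singularComplex (X : Type) [TopologicalSpace X] : ChainComplex (ModuleCat.{0} ℤ) ℕ :=
  ((singularChainComplexFunctor (ModuleCat.{0} ℤ)).obj (ModuleCat.of ℤ ℤ)).obj (TopCat.of X)

/-- The chain map induced by a continuous map. -/
abbrev singularMap {X Y : Type} [TopologicalSpace X] [TopologicalSpace Y] (f : C(X, Y)) :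
    singularComplex X ⟶ singularComplex Y :=
  ((singularChainComplexFunctor (ModuleCat.{0} ℤ)).obj (ModuleCat.of ℤ ℤ)).map (TopCat.ofHom f)

/-- Homotopy equivalent spaces have isomorphic singular homology. -/
lemma nonempty_singularH_iso {X Y : Type} [TopologicalSpace X] [TopologicalSpace Y]
    (e : ContinuousMap.HomotopyEquiv X Y) (k : ℕ) : Nonempty (singularH k X ≅ singularH k Y) := by
  have aux {Z W : Type} [TopologicalSpace Z] [TopologicalSpace W] (f : C(Z, W)) (g : C(W, Z))
      (h : (g.comp f).Homotopic (ContinuousMap.id Z)) :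
      homologyMap (singularMap f) k ≫ homologyMap (singularMap g) k = 𝟙 _ := by
    obtain ⟨H⟩ := h
    have := TopCat.Homotopy.congr_homologyMap_singularChainComplexFunctor
      (f := TopCat.ofHom (g.comp f)) (g := 𝟙 (TopCat.of Z)) H (ModuleCat.of ℤ ℤ) k
    rw [CategoryTheory.Functor.map_id, homologyMap_id, TopCat.ofHom_comp, Functor.map_comp,
      homologyMap_comp] at this
    exact this
  exact ⟨⟨homologyMap (singularMap e.toFun) k, homologyMap (singularMap e.invFun) k,
    aux _ _ e.left_inv, aux _ _ e.right_inv⟩⟩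

/-- The homology of `X` is that of a discrete space with `m` points. -/
def HasDiscreteHomology (X : Type) [TopologicalSpace X] (m : ℕ) : Prop :=
  (∀ n, n ≠ 0 → IsZero (singularH n X)) ∧ Module.Finite ℤ (singularH 0 X) ∧
    Module.finrank ℤ (singularH 0 X) = m

lemma hasDiscreteHomology_of_homotopyEquiv {X D : Type} [TopologicalSpace X] [TopologicalSpace D]
    [DiscreteTopology D] [Finite D] (e : ContinuousMap.HomotopyEquiv X D) :
    HasDiscreteHomology X (Nat.card D) := by
  have e0 : singularH 0 D ≃ₗ[ℤ] (D →₀ ℤ) :=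
    ((singularHomologyFunctorZeroOfTotallyDisconnectedSpace (ModuleCat.{0} ℤ) (ModuleCat.of ℤ ℤ)
      (TopCat.of D)) ≪≫ IsColimit.coconePointUniqueUpToIso (coproductIsCoproduct _)
        (ModuleCat.finsuppCoconeIsColimit ℤ ℤ D)).toLinearEquiv
  have e1 : singularH 0 X ≃ₗ[ℤ] (D →₀ ℤ) :=
    (nonempty_singularH_iso e 0).some.toLinearEquiv.trans e0
  refine ⟨fun n hn => ?_, Module.Finite.equiv e1.symm, ?_⟩
  · exact (isZero_singularHomologyFunctor_of_totallyDisconnectedSpace (ModuleCat.{0} ℤ) n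
      (ModuleCat.of ℤ ℤ) (TopCat.of D) hn).of_iso (nonempty_singularH_iso e n).some
  · have := Fintype.ofFinite D
    rw [e1.finrank_eq, Module.finrank_finsupp_self, Nat.card_eq_fintype_card]

/-- The homotopy equivalence of disjoint unions. -/
def sumHomotopyEquiv {X Y X' Y' : Type} [TopologicalSpace X] [TopologicalSpace Y]
    [TopologicalSpace X'] [TopologicalSpace Y'] (e : ContinuousMap.HomotopyEquiv X X')
    (e' : ContinuousMap.HomotopyEquiv Y Y') :
    ContinuousMap.HomotopyEquiv (X ⊕ Y) (X' ⊕ Y') := by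
  have aux {A B : Type} [TopologicalSpace A] [TopologicalSpace B] {f : C(A, A)} {g : C(B, B)}
      (hf : f.Homotopic (ContinuousMap.id A)) (hg : g.Homotopic (ContinuousMap.id B)) :
      (ContinuousMap.mk (Sum.map f g) (by fun_prop)).Homotopic (ContinuousMap.id (A ⊕ B)) := by
    obtain ⟨F⟩ := hf
    obtain ⟨G⟩ := hg
    refine ⟨⟨(ContinuousMap.mk (Sum.map F G) (by fun_prop)).comp
      ⟨_, (Homeomorph.prodSumDistrib (X := unitInterval) (Y := A) (Z := B)).continuous⟩, ?_, ?_⟩⟩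
    · rintro (a | b)
      · exact congrArg Sum.inl (F.map_zero_left a)
      · exact congrArg Sum.inr (G.map_zero_left b)
    · rintro (a | b)
      · exact congrArg Sum.inl (F.map_one_left a)
      · exact congrArg Sum.inr (G.map_one_left b)
  refine ⟨⟨Sum.map e.toFun e'.toFun, by fun_prop⟩, ⟨Sum.map e.invFun e'.invFun, by fun_prop⟩,
    ?_, ?_⟩
  · convert aux e.left_inv e'.left_inv using 1
    ext1 x
    cases x <;> rfl
  · convert aux e.right_inv e'.right_inv using 1
    ext1 x
    cases x <;> rfl

/-! ### The Mayer–Vietoris argument -/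

/-- If `p` identifies each point of the range of `i` with the corresponding point of the range of
`j`, and makes no other identifications, then the induced sequence of chain modules is exact. -/
lemma exists_mapDomain_sub_mapDomain {W S T : Type*} {i j : W → S} {p : S → T}
    (hi : Function.Injective i) (hij : ∀ x y, i x ≠ j y) (hp : ∀ w, p (i w) = p (j w))
    (hinj : InjOn p (range i)ᶜ) (c : S →₀ ℤ) (hc : Finsupp.mapDomain p c = 0) :
    ∃ e : W →₀ ℤ, Finsupp.mapDomain i e - Finsupp.mapDomain j e = c := by
  refine ⟨Finsupp.comapDomain i c hi.injOn, ?_⟩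
  set e := Finsupp.comapDomain i c hi.injOn with he
  set c' := c - (Finsupp.mapDomain i e - Finsupp.mapDomain j e) with hc'
  have h1 : Finsupp.mapDomain p c' = 0 := by
    have h2 : Finsupp.mapDomain p (Finsupp.mapDomain i e) =
        Finsupp.mapDomain p (Finsupp.mapDomain j e) := by
      rw [← Finsupp.mapDomain_comp, ← Finsupp.mapDomain_comp, show p ∘ i = p ∘ j from funext hp]
    have hlin := map_sub (Finsupp.lmapDomain ℤ ℤ p)
    simp only [Finsupp.lmapDomain_apply] at hlin
    rw [hc', hlin, hlin, hc, h2, sub_self, sub_self]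
  have h3 : (c'.support : Set S) ⊆ (range i)ᶜ := by
    intro s hs
    rintro ⟨w, rfl⟩
    rw [Finset.mem_coe, Finsupp.mem_support_iff] at hs
    apply hs
    have : Finsupp.mapDomain j e (i w) = 0 :=
      Finsupp.mapDomain_of_notMem_range _ _ (by rintro ⟨y, hy⟩; exact hij _ _ hy.symm)
    rw [hc', Finsupp.sub_apply, Finsupp.sub_apply, Finsupp.mapDomain_apply hi, this, he,
      Finsupp.comapDomain_apply]
    ring
  have h4 : c' = 0 := by
    ext s
    by_cases hs : s ∈ (range i)ᶜ
    · have := Finsupp.mapDomain_apply' _ c' h3 hinj hs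
      rw [h1] at this
      simpa using this.symm
    · by_contra h
      exact hs (h3 (by simpa using h))
  rw [hc', sub_eq_zero] at h4
  exact h4.symm

section MayerVietoris

variable {X : Type} [TopologicalSpace X]

open Simplicial SingularChain AffineSimplex

/-- The singular simplicial set. -/
abbrev sing (X : Type) [TopologicalSpace X] : SSet.{0} := TopCat.toSSet.obj (TopCat.of X)

/-- The simplicial map induced by a continuous map. -/
abbrev singMap {X Y : Type} [TopologicalSpace X] [TopologicalSpace Y] (f : C(X, Y)) :
    sing X ⟶ sing Y := TopCat.toSSet.map (TopCat.ofHom f)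

/-- The `n`-simplices of the singular simplicial set as continuous maps. -/
def simplexEquiv (X : Type) [TopologicalSpace X] (n : ℕ) :
    (sing X) _⦋n⦌ ≃ C(Simplex (n + 1), X) := (TopCat.of X).toSSetObjEquiv (.op ⦋n⦌)

lemma simplexEquiv_map {Y : Type} [TopologicalSpace Y] (f : C(X, Y)) {n : ℕ} (x : (sing X) _⦋n⦌) :
    simplexEquiv Y n ((singMap f).app _ x) = f.comp (simplexEquiv X n x) := rfl

/-- Singular chains in coordinates. -/
def singularChainEquiv (X : Type) [TopologicalSpace X] (n : ℕ) :
    ((sing X).chainComplex (ModuleCat.of ℤ ℤ)).X n ≃ₗ[ℤ] SChain X (n + 1) :=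
  (chainEquiv (sing X) n).trans (Finsupp.domLCongr (simplexEquiv X n))

lemma singularChainEquiv_d (n : ℕ) (c : ((sing X).chainComplex (ModuleCat.of ℤ ℤ)).X (n + 1)) :
    singularChainEquiv X n (((sing X).chainComplex (ModuleCat.of ℤ ℤ)).d (n + 1) n c) =
      bd (n + 1) (singularChainEquiv X (n + 1) c) := by
  simp only [singularChainEquiv, LinearEquiv.trans_apply, chainEquiv_d]
  generalize chainEquiv (sing X) (n + 1) c = c
  induction c using Finsupp.induction_linear with
  | zero => simp
  | add x y hx hy => simp only [map_add, hx, hy]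
  | single x a =>
    have : Finsupp.single x a = a • Finsupp.single x (1 : ℤ) := by simp
    rw [this]
    simp only [map_zsmul]
    congr 1
    simp only [Finsupp.domLCongr_single, bd_single, LinearMap.sum_apply, LinearMap.smul_apply,
      Finsupp.lmapDomain_apply, Finsupp.mapDomain_single, map_sum, map_zsmul]
    rfl

variable (U V : Set X)

/-- The projection of the disjoint union of `U` and `V` to the space. -/
def coverMap : C(U ⊕ V, X) := ⟨Sum.elim Subtype.val Subtype.val, by fun_prop⟩

/-- The inclusion of `U ∩ V` into the first summand. -/
def interInl : C(↥(U ∩ V), U ⊕ V) := ⟨fun x => Sum.inl ⟨x, x.2.1⟩, by fun_prop⟩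

/-- The inclusion of `U ∩ V` into the second summand. -/
def interInr : C(↥(U ∩ V), U ⊕ V) := ⟨fun x => Sum.inr ⟨x, x.2.2⟩, by fun_prop⟩

/-- A connected space mapped to a disjoint union lies on one side. -/
lemma forall_isLeft_or_forall_isRight {A B S : Type*} [TopologicalSpace A] [TopologicalSpace B]
    [TopologicalSpace S] [PreconnectedSpace S] (s : C(S, A ⊕ B)) :
    (∀ x, (s x).isLeft) ∨ ∀ x, (s x).isRight := by
  have hclopen : IsClopen {x | (s x).isLeft} := by
    have : {x | (s x).isLeft} = s ⁻¹' (range Sum.inl) := by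
      ext x
      cases h : s x <;> simp [h]
    rw [this]
    exact isClopen_range_inl.preimage s.continuous
  rcases isClopen_iff.1 hclopen with h | h
  · right
    intro x
    have : x ∉ {x | (s x).isLeft} := by rw [h]; exact notMem_empty _
    simpa using this
  · left
    intro x
    have : x ∈ {x | (s x).isLeft} := by rw [h]; exact mem_univ _
    exact this

/-- The part of the singular simplicial set formed by the simplices in `U` and those in `V`. -/
abbrev smallSimplices : (sing X).Subcomplex := SSet.Subcomplex.range (singMap (coverMap U V))

lemma mem_smallSimplices_iff {n : ℕ} (x : (sing X) _⦋n⦌) :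
    x ∈ (smallSimplices U V).obj (.op ⦋n⦌) ↔
      range (simplexEquiv X n x) ⊆ U ∨ range (simplexEquiv X n x) ⊆ V := by
  constructor
  · rintro ⟨y, rfl⟩
    rw [simplexEquiv_map]
    rcases forall_isLeft_or_forall_isRight (simplexEquiv _ n y) with h | h
    · left
      rintro _ ⟨t, rfl⟩
      obtain ⟨u, hu⟩ := Sum.isLeft_iff.1 (h t)
      simp [coverMap, hu]
    · right
      rintro _ ⟨t, rfl⟩
      obtain ⟨u, hu⟩ := Sum.isRight_iff.1 (h t)
      simp [coverMap, hu]
  · rintro (h | h)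
    · refine ⟨(simplexEquiv _ n).symm ⟨fun t => Sum.inl ⟨simplexEquiv X n x t, h ⟨t, rfl⟩⟩,
        by fun_prop⟩, (simplexEquiv X n).injective ?_⟩
      rw [simplexEquiv_map, Equiv.apply_symm_apply]
      rfl
    · refine ⟨(simplexEquiv _ n).symm ⟨fun t => Sum.inr ⟨simplexEquiv X n x t, h ⟨t, rfl⟩⟩,
        by fun_prop⟩, (simplexEquiv X n).injective ?_⟩
      rw [simplexEquiv_map, Equiv.apply_symm_apply]
      rfl

/-- The small simplices compute the singular homology. -/
lemma isIso_homologyMap_smallSimplices (hU : IsOpen U) (hV : IsOpen V) (hUV : U ∪ V = univ)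
    (n : ℕ) :
    IsIso (homologyMap (SSet.chainComplexMap (smallSimplices U V).ι (ModuleCat.of ℤ ℤ)) n) := by
  have himage (n : ℕ) (z : ((sing X).chainComplex (ModuleCat.of ℤ ℤ)).X n) :
      singularChainEquiv X n z ∈ small U V (n + 1) ↔
        ∃ a, z = (SSet.chainComplexMap (smallSimplices U V).ι (ModuleCat.of ℤ ℤ)).f n a := by
    constructor
    · intro hz
      have hle : small U V (n + 1) ≤ LinearMap.range ((singularChainEquiv X n).toLinearMap ∘ₗ
          ((SSet.chainComplexMap (smallSimplices U V).ι (ModuleCat.of ℤ ℤ)).f n).hom) := by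
        rw [small, Finsupp.supported_eq_span_single, Submodule.span_le]
        rintro _ ⟨σ, hσ, rfl⟩
        obtain ⟨y, hy⟩ : ∃ y : (smallSimplices U V).toSSet _⦋n⦌,
            simplexEquiv X n ((smallSimplices U V).ι.app _ y) = σ := by
          refine ⟨⟨(simplexEquiv X n).symm σ, ?_⟩, (simplexEquiv X n).apply_symm_apply σ⟩
          rw [mem_smallSimplices_iff, Equiv.apply_symm_apply]
          exact hσ
        refine ⟨(chainEquiv _ n).symm (Finsupp.single y 1), ?_⟩
        have := chainEquiv_map (smallSimplices U V).ι n ((chainEquiv _ n).symm (Finsupp.single y 1))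
        rw [LinearEquiv.apply_symm_apply, Finsupp.lmapDomain_apply,
          Finsupp.mapDomain_single] at this
        have h2 := congrArg (Finsupp.domLCongr (R := ℤ) (simplexEquiv X n)) this
        rw [Finsupp.domLCongr_single, hy] at h2
        exact h2
      obtain ⟨a, ha⟩ := hle hz
      exact ⟨a, (singularChainEquiv X n).injective ha.symm⟩
    · rintro ⟨a, rfl⟩
      obtain ⟨c, rfl⟩ := (chainEquiv _ n).symm.surjective a
      rw [singularChainEquiv, LinearEquiv.trans_apply, chainEquiv_map, LinearEquiv.apply_symm_apply]
      induction c using Finsupp.induction_linear with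
      | zero => simp
      | add x y hx hy => simp only [map_add]; exact Submodule.add_mem _ hx hy
      | single x k =>
        rw [Finsupp.lmapDomain_apply, Finsupp.mapDomain_single, Finsupp.domLCongr_single]
        exact Finsupp.single_mem_supported _ _ ((mem_smallSimplices_iff U V _).1 x.2)
  have : Mono (SSet.chainComplexMap (smallSimplices U V).ι (ModuleCat.of ℤ ℤ)) := by
    have hmono : ∀ n, Mono
        ((SSet.chainComplexMap (smallSimplices U V).ι (ModuleCat.of ℤ ℤ)).f n) := by
      intro n
      rw [ModuleCat.mono_iff_injective]
      intro a b hab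
      apply (chainEquiv _ n).injective
      have := congrArg (chainEquiv _ n) hab
      rw [chainEquiv_map, chainEquiv_map] at this
      exact Finsupp.mapDomain_injective (fun x y h => Subtype.ext h) this
    exact HomologicalComplex.mono_of_mono_f _ hmono
  refine isIso_homologyMap_of_relative_cycles _ (fun n z hz => ?_) n
  obtain ⟨c, hc⟩ : ∃ c : SChain X (n + 2), singularChainEquiv X n z - bd (n + 1) c ∈
      small U V (n + 1) := by
    refine exists_sub_bd_mem_small hU hV hUV _ ?_
    cases n with
    | zero =>
      -- a simplex without vertices is empty, hence small
      intro σ _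
      left
      rintro _ ⟨x, rfl⟩
      have := x.2.2
      simp at this
    | succ m =>
      rw [← singularChainEquiv_d]
      exact (himage m _).2 (hz m rfl)
  obtain ⟨c, rfl⟩ := (singularChainEquiv X (n + 1)).surjective c
  rw [← singularChainEquiv_d, ← map_sub] at hc
  obtain ⟨a, ha⟩ := (himage n _).1 hc
  exact ⟨c, a, by rw [← ha, add_sub_cancel]⟩

/-- The chain map onto the chains on small simplices. -/
abbrev toSmall : singularComplex (U ⊕ V) ⟶
    (smallSimplices U V).toSSet.chainComplex (ModuleCat.of ℤ ℤ) :=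
  SSet.chainComplexMap (SSet.Subcomplex.toRange (singMap (coverMap U V))) (ModuleCat.of ℤ ℤ)

/-- The Mayer–Vietoris sequence of chain complexes; the middle term is realized as the chains on
the disjoint union of `U` and `V`. -/
def mayerVietoris : ShortComplex (ChainComplex (ModuleCat.{0} ℤ) ℕ) :=
  ShortComplex.mk (singularMap (interInl U V) - singularMap (interInr U V)) (toSmall U V) (by
    rw [Preadditive.sub_comp, sub_eq_zero]
    have h (i : C(↥(U ∩ V), U ⊕ V)) : singularMap i ≫ toSmall U V =
        SSet.chainComplexMap (singMap i ≫ SSet.Subcomplex.toRange (singMap (coverMap U V)))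
          (ModuleCat.of ℤ ℤ) :=
      (Functor.map_comp ((SSet.chainComplexFunctor (ModuleCat.{0} ℤ)).obj (ModuleCat.of ℤ ℤ))
        (singMap i) (SSet.Subcomplex.toRange (singMap (coverMap U V)))).symm
    rw [h, h]
    congr 1)

/-- In each degree the sequence is the one of `exists_mapDomain_sub_mapDomain` for the sets of
singular simplices, since a simplex of `U ⊕ V` lies on one side by connectedness. -/
lemma mayerVietoris_shortExact : (mayerVietoris U V).ShortExact := by
  have hi (n : ℕ) : Function.Injective
      (fun x : (sing ↥(U ∩ V)) _⦋n⦌ => (singMap (interInl U V)).app _ x) := by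
    intro x y hxy
    apply (simplexEquiv _ n).injective
    have := congrArg (simplexEquiv _ n) hxy
    simp only [simplexEquiv_map] at this
    ext t
    have := congr($this t)
    simpa [interInl] using congr($this)
  have hij (n : ℕ) (x y : (sing ↥(U ∩ V)) _⦋n⦌) :
      (singMap (interInl U V)).app _ x ≠ (singMap (interInr U V)).app _ y := by
    intro hxy
    have := congrArg (simplexEquiv _ n) hxy
    simp only [simplexEquiv_map] at this
    have := congr($this (stdSimplex.vertex 0))
    simp [interInl, interInr] at this
  have hinj (n : ℕ) : InjOn (fun s : (sing (U ⊕ V)) _⦋n⦌ =>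
      (SSet.Subcomplex.toRange (singMap (coverMap U V))).app _ s)
      (range fun x : (sing ↥(U ∩ V)) _⦋n⦌ => (singMap (interInl U V)).app _ x)ᶜ := by
    intro s hs s' hs' hss
    have hss : (coverMap U V).comp (simplexEquiv _ n s) =
        (coverMap U V).comp (simplexEquiv _ n s') :=
      congrArg (simplexEquiv X n) (congrArg Subtype.val hss)
    -- a pair of simplices on different sides comes from a simplex of the intersection
    have mixed : ∀ s s' : (sing (U ⊕ V)) _⦋n⦌,
        s ∉ (range fun x : (sing ↥(U ∩ V)) _⦋n⦌ => (singMap (interInl U V)).app _ x) →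
        (coverMap U V).comp (simplexEquiv _ n s) = (coverMap U V).comp (simplexEquiv _ n s') →
        (∀ t, (simplexEquiv _ n s t).isLeft) → ¬ ∀ t, (simplexEquiv _ n s' t).isRight := by
      intro s s' hs hss h h'
      have hU : ∀ t, coverMap U V (simplexEquiv _ n s t) ∈ U := by
        intro t
        obtain ⟨u, hu⟩ := Sum.isLeft_iff.1 (h t)
        simp [coverMap, hu]
      have hV : ∀ t, coverMap U V (simplexEquiv _ n s t) ∈ V := by
        intro t
        obtain ⟨u, hu⟩ := Sum.isRight_iff.1 (h' t)
        have := congr($hss t)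
        simp only [ContinuousMap.comp_apply] at this
        rw [this]
        simp [coverMap, hu]
      refine hs ⟨(simplexEquiv _ n).symm
        ⟨fun t => ⟨coverMap U V (simplexEquiv _ n s t), hU t, hV t⟩, by fun_prop⟩,
        (simplexEquiv _ n).injective ?_⟩
      simp only [simplexEquiv_map, Equiv.apply_symm_apply]
      ext1 t
      obtain ⟨u, hu⟩ := Sum.isLeft_iff.1 (h t)
      simp [interInl, coverMap, hu]
    apply (simplexEquiv _ n).injective
    rcases forall_isLeft_or_forall_isRight (simplexEquiv _ n s) with h | h <;>
      rcases forall_isLeft_or_forall_isRight (simplexEquiv _ n s') with h' | h'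
    · ext1 t
      obtain ⟨u, hu⟩ := Sum.isLeft_iff.1 (h t)
      obtain ⟨u', hu'⟩ := Sum.isLeft_iff.1 (h' t)
      have := congr($hss t)
      simp only [ContinuousMap.comp_apply, hu, hu', coverMap, ContinuousMap.coe_mk,
        Sum.elim_inl] at this
      rw [hu, hu', Subtype.ext this]
    · exact absurd h' (mixed s s' hs hss h)
    · exact absurd h (mixed s' s hs' hss.symm h')
    · ext1 t
      obtain ⟨u, hu⟩ := Sum.isRight_iff.1 (h t)
      obtain ⟨u', hu'⟩ := Sum.isRight_iff.1 (h' t)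
      have := congr($hss t)
      simp only [ContinuousMap.comp_apply, hu, hu', coverMap, ContinuousMap.coe_mk,
        Sum.elim_inr] at this
      rw [hu, hu', Subtype.ext this]
  have hf (n : ℕ) (c : (singularComplex ↥(U ∩ V)).X n) :
      chainEquiv (sing (U ⊕ V)) n ((mayerVietoris U V).f.f n c) =
        Finsupp.mapDomain (fun x : (sing ↥(U ∩ V)) _⦋n⦌ => (singMap (interInl U V)).app _ x)
          (chainEquiv (sing ↥(U ∩ V)) n c) -
        Finsupp.mapDomain (fun x : (sing ↥(U ∩ V)) _⦋n⦌ => (singMap (interInr U V)).app _ x)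
          (chainEquiv (sing ↥(U ∩ V)) n c) := by
    have h1 := chainEquiv_map (singMap (interInl U V)) n c
    have h2 := chainEquiv_map (singMap (interInr U V)) n c
    rw [Finsupp.lmapDomain_apply] at h1 h2
    rw [← h1, ← h2, ← map_sub]
    rfl
  have hg (n : ℕ) (c : (singularComplex (U ⊕ V)).X n) :
      chainEquiv (smallSimplices U V).toSSet n ((mayerVietoris U V).g.f n c) =
        Finsupp.mapDomain (fun s : (sing (U ⊕ V)) _⦋n⦌ =>
          (SSet.Subcomplex.toRange (singMap (coverMap U V))).app _ s)
          (chainEquiv (sing (U ⊕ V)) n c) := by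
    have h1 := chainEquiv_map (SSet.Subcomplex.toRange (singMap (coverMap U V))) n c
    rw [Finsupp.lmapDomain_apply] at h1
    exact h1
  refine HomologicalComplex.shortExact_of_degreewise_shortExact _ fun n => ?_
  refine ModuleCat.shortComplex_shortExact _
    (fun (c : (singularComplex (U ⊕ V)).X n) => ⟨fun hc => ?_, ?_⟩) ?_ ?_
  · have hc' : Finsupp.mapDomain (fun s : (sing (U ⊕ V)) _⦋n⦌ =>
          (SSet.Subcomplex.toRange (singMap (coverMap U V))).app _ s)
          (chainEquiv (sing (U ⊕ V)) n c) = 0 := by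
      exact (hg n c).symm.trans ((congrArg _ hc).trans (map_zero _))
    obtain ⟨e, he⟩ := exists_mapDomain_sub_mapDomain (hi n) (hij n) (fun w => rfl) (hinj n) _ hc'
    refine ⟨(chainEquiv _ n).symm e, (chainEquiv _ n).injective ?_⟩
    refine (hf n _).trans ?_
    rw [LinearEquiv.apply_symm_apply, he]
  · rintro ⟨e, rfl⟩
    exact congr(($((mayerVietoris U V).zero).f n) e)
  · refine (injective_iff_map_eq_zero ((mayerVietoris U V).f.f n).hom).2
      fun (c : (singularComplex ↥(U ∩ V)).X n) hc => ?_
    have h1 := hf n c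
    have h2 : chainEquiv (sing (U ⊕ V)) n ((mayerVietoris U V).f.f n c) = 0 :=
      (congrArg _ hc).trans (map_zero _)
    rw [h2] at h1
    refine (LinearEquiv.map_eq_zero_iff (chainEquiv (sing ↥(U ∩ V)) n)).1 ?_
    ext x
    have h3 := congr($h1 ((singMap (interInl U V)).app _ x))
    rw [Finsupp.sub_apply, Finsupp.mapDomain_apply (hi n), Finsupp.mapDomain_of_notMem_range,
      sub_zero] at h3
    · exact h3.symm
    · rintro ⟨y, hy⟩
      exact hij n _ _ hy.symm
  · intro c
    have hsurj : Function.Surjective (fun s : (sing (U ⊕ V)) _⦋n⦌ =>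
        (SSet.Subcomplex.toRange (singMap (coverMap U V))).app _ s) := by
      rintro ⟨_, y, rfl⟩
      exact ⟨y, rfl⟩
    obtain ⟨e, he⟩ := Finsupp.mapDomain_surjective hsurj (chainEquiv _ n c)
    refine ⟨(chainEquiv _ n).symm e, (chainEquiv _ n).injective ?_⟩
    refine (hg n _).trans ?_
    rw [LinearEquiv.apply_symm_apply, he]

/-- The Mayer–Vietoris principle for a cover by two open sets whose pieces are homologically
discrete. -/
theorem eulerCharacteristic_eq_sub {U V : Set X} (hU : IsOpen U) (hV : IsOpen V)
    (hUV : U ∪ V = univ) {m k : ℕ} (h₂ : HasDiscreteHomology (U ⊕ V) m)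
    (h₁ : HasDiscreteHomology ↥(U ∩ V) k) :
    eulerCharacteristic X = (((m : ℤ) - k : ℤ) : WithTop ℤ) := by
  obtain ⟨h3, h4, h5, h6⟩ := finite_and_finrank_of_shortExact (mayerVietoris_shortExact U V)
    h₁.1 h₂.1 h₁.2.1 h₂.2.1
  have e (n : ℕ) : (mayerVietoris U V).X₃.homology n ≃ₗ[ℤ] singularH n X :=
    have := isIso_homologyMap_smallSimplices U V hU hV hUV n
    (asIso (homologyMap (SSet.chainComplexMap (smallSimplices U V).ι
      (ModuleCat.of ℤ ℤ)) n)).toLinearEquiv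
  have hsub (n : ℕ) (hn : 2 ≤ n) : Subsingleton (singularH n X) :=
    have := ModuleCat.subsingleton_of_isZero (h3 n hn)
    (e n).symm.toEquiv.subsingleton
  have hfin (n : ℕ) : Module.Finite ℤ (singularH n X) := by
    match n with
    | 0 => exact Module.Finite.equiv (e 0)
    | 1 => exact Module.Finite.equiv (e 1)
    | n + 2 =>
      have := hsub (n + 2) (by omega)
      infer_instance
  have hHF : HasFiniteHomology X := ⟨hfin, 2, hsub⟩
  have hfinsum : ∑ᶠ k : ℕ, (-1 : ℤ) ^ k * (Module.finrank ℤ (singularH k X) : ℤ) =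
      Module.finrank ℤ (singularH 0 X) - Module.finrank ℤ (singularH 1 X) := by
    rw [finsum_eq_sum_of_support_subset (s := Finset.range 2)]
    · simp [Finset.sum_range_succ, sub_eq_add_neg]
    · intro n hn
      by_contra h
      have := hsub n (by simp at h; omega)
      exact hn (by simp [Module.finrank_zero_of_subsingleton])
  rw [eulerCharacteristic, if_pos hHF, hfinsum, ← (e 0).finrank_eq, ← (e 1).finrank_eq, h6]
  congr 2
  · exact congrArg _ h₂.2.2
  · exact congrArg _ h₁.2.2

end MayerVietoris

end ChainHomology

/-! ### The topology of one-dimensional complexes -/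

namespace OneComplex

open unitInterval

variable {V Λ : Type} (G : OneComplex V Λ)

lemma cell_zero (l : Λ) : G.cell l 0 = G.vertex (G.init l) := Quot.sound (.zero l)

lemma cell_one (l : Λ) : G.cell l 1 = G.vertex (G.term l) := Quot.sound (.one l)

lemma continuous_cell (l : Λ) : Continuous (G.cell l) := by
  let : TopologicalSpace V := ⊥
  have h : Continuous (Quot.mk G.Glue) := continuous_quot_mk
  exact h.comp (continuous_inr.comp continuous_sigmaMk)

/-- A map out of the complex is continuous if and only if it is so on each 1-cell. -/
lemma continuous_iff {Y : Type*} [TopologicalSpace Y] {f : G.Space → Y} :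
    Continuous f ↔ ∀ l, Continuous fun s => f (G.cell l s) := by
  refine ⟨fun h l => h.comp (G.continuous_cell l), fun h => ?_⟩
  let : TopologicalSpace V := ⊥
  have : DiscreteTopology V := ⟨rfl⟩
  refine continuous_coinduced_dom.2 (continuous_sum_dom.2 ⟨continuous_of_discreteTopology, ?_⟩)
  exact continuous_sigma fun l => h l

/-- Maps out of the complex, given by compatible maps on the 0-cells and the 1-cells. -/
def lift {Y : Type*} (g : V → Y) (h : Λ → I → Y) (h0 : ∀ l, h l 0 = g (G.init l))
    (h1 : ∀ l, h l 1 = g (G.term l)) : G.Space → Y :=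
  Quot.lift (Sum.elim g fun p => h p.1 p.2) (by
    rintro _ _ (l | l)
    · exact h0 l
    · exact h1 l)

section lift

variable {Y : Type*} (g : V → Y) (h : Λ → I → Y) (h0 : ∀ l, h l 0 = g (G.init l))
    (h1 : ∀ l, h l 1 = g (G.term l))

@[simp] lemma lift_vertex (x : V) : G.lift g h h0 h1 (G.vertex x) = g x := rfl

@[simp] lemma lift_cell (l : Λ) (s : I) : G.lift g h h0 h1 (G.cell l s) = h l s := rfl

lemma continuous_lift [TopologicalSpace Y] (hh : ∀ l, Continuous (h l)) :
    Continuous (G.lift g h h0 h1) := G.continuous_iff.2 hh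

end lift

lemma vertex_or_cell (z : G.Space) :
    (∃ x, z = G.vertex x) ∨ ∃ l s, 0 < s ∧ s < 1 ∧ z = G.cell l s := by
  induction z using Quot.ind with
  | mk p =>
    rcases p with x | ⟨l, s⟩
    · exact Or.inl ⟨x, rfl⟩
    · rcases eq_or_ne s 0 with rfl | h0
      · exact Or.inl ⟨_, G.cell_zero l⟩
      rcases eq_or_ne s 1 with rfl | h1
      · exact Or.inl ⟨_, G.cell_one l⟩
      exact Or.inr ⟨l, s, unitInterval.pos_iff_ne_zero.2 h0, unitInterval.lt_one_iff_ne_one.2 h1,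
        rfl⟩

/-- The function on the complex that vanishes on the 0-cells and is `φ l` on the `l`-th 1-cell. -/
def bump (φ : Λ → I → ℝ) (h0 : ∀ l, φ l 0 = 0) (h1 : ∀ l, φ l 1 = 0) : G.Space → ℝ :=
  G.lift (fun _ => 0) φ h0 h1

/-- The function `s (1 - s)` on the 1-cells; it vanishes exactly on the 0-cells. -/
def height : G.Space → ℝ := G.bump (fun _ s => s * (1 - s)) (by simp) (by simp)

/-- The function `s² (1 - s)` on the 1-cells; its quotient by `height` is the parameter `s`. -/
def skew : G.Space → ℝ := G.bump (fun _ s => s * (s * (1 - s))) (by simp) (by simp)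

open Classical in
/-- The function `s (1 - s)` on the `l`-th 1-cell, extended by zero. -/
def cellHeight (l : Λ) : G.Space → ℝ :=
  G.bump (fun l' s => if l' = l then s * (1 - s) else 0) (by simp) (by simp)

open Classical in
/-- The function that is `1` at the 0-cell `x`, `0` at the other 0-cells and linear on 1-cells. -/
def hat (x : V) : G.Space → ℝ :=
  G.lift (fun y => if y = x then 1 else 0)
    (fun l s => (1 - s) * (if G.init l = x then 1 else 0) + s * (if G.term l = x then 1 else 0))
    (by simp) (by simp)

lemma continuous_height : Continuous G.height :=
  G.continuous_iff.2 fun _ => by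
    change Continuous fun s : I => (s : ℝ) * (1 - s)
    fun_prop

lemma continuous_skew : Continuous G.skew :=
  G.continuous_iff.2 fun _ => by
    change Continuous fun s : I => (s : ℝ) * (s * (1 - s))
    fun_prop

open Classical in
lemma continuous_cellHeight (l : Λ) : Continuous (G.cellHeight l) :=
  G.continuous_iff.2 fun l' => by
    change Continuous fun s : I => if l' = l then (s : ℝ) * (1 - s) else 0
    by_cases h : l' = l
    · simp only [h, if_true]
      fun_prop
    · simp only [h, if_false]
      fun_prop

lemma continuous_hat (x : V) : Continuous (G.hat x) := by
  refine G.continuous_lift _ _ _ _ fun _ => ?_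
  fun_prop

@[simp] lemma height_vertex (x : V) : G.height (G.vertex x) = 0 := rfl

@[simp] lemma height_cell (l : Λ) (s : I) : G.height (G.cell l s) = s * (1 - s) := rfl

@[simp] lemma skew_cell (l : Λ) (s : I) : G.skew (G.cell l s) = s * (s * (1 - s)) := rfl

lemma cellHeight_cell (l : Λ) (s : I) : G.cellHeight l (G.cell l s) = s * (1 - s) := by
  simp [cellHeight, bump]

lemma cellHeight_cell_of_ne {l l' : Λ} (h : l' ≠ l) (s : I) : G.cellHeight l (G.cell l' s) = 0 := by
  simp [cellHeight, bump, h]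

lemma mul_one_sub_pos {s : I} (h0 : 0 < s) (h1 : s < 1) : (0 : ℝ) < s * (1 - s) :=
  mul_pos h0 (sub_pos.2 h1)

/-- The characteristic maps are injective on the open 1-cells: `cellHeight` detects the 1-cell, and
the quotient of `skew` by `height` the parameter. -/
lemma cell_inj {l l' : Λ} {s s' : I} (h0 : 0 < s) (h1 : s < 1)
    (h : G.cell l s = G.cell l' s') : l = l' ∧ s = s' := by
  have hpos := mul_one_sub_pos h0 h1
  have hl : l = l' := by
    by_contra hne
    have := congrArg (G.cellHeight l) h
    rw [cellHeight_cell, G.cellHeight_cell_of_ne (Ne.symm hne)] at this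
    linarith
  have e1 := congrArg G.height h
  have e2 := congrArg G.skew h
  simp only [height_cell, skew_cell] at e1 e2
  rw [← e1] at e2
  exact ⟨hl, Subtype.ext (mul_right_cancel₀ hpos.ne' e2)⟩

lemma vertex_ne_cell {x : V} {l : Λ} {s : I} (h0 : 0 < s) (h1 : s < 1) :
    G.vertex x ≠ G.cell l s := by
  intro h
  have e1 := congrArg G.height h
  simp only [height_cell, height_vertex] at e1
  exact (mul_one_sub_pos h0 h1).ne e1

lemma vertex_injective : Function.Injective G.vertex := by
  intro x y h
  have := congrArg (G.hat y) h
  simp only [hat, lift_vertex, if_true] at this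
  by_contra hne
  simp [hne] at this

lemma height_pos_iff (z : G.Space) :
    0 < G.height z ↔ ∃ l s, 0 < s ∧ s < 1 ∧ z = G.cell l s := by
  constructor
  · intro h
    rcases G.vertex_or_cell z with ⟨x, rfl⟩ | h'
    · simp at h
    · exact h'
  · rintro ⟨l, s, h0, h1, rfl⟩
    exact mul_one_sub_pos h0 h1

/-- The continuous functions `hat`, `cellHeight`, `skew` and `height` separate the points. -/
instance : T2Space G.Space := by
  refine T2Space.of_injective_continuous
    (f := fun z => ((fun x => G.hat x z), (fun l => G.cellHeight l z), G.skew z, G.height z)) ?_ ?_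
  · intro z w hzw
    simp only [Prod.mk.injEq] at hzw
    obtain ⟨e1, e2, e3, e4⟩ := hzw
    rcases G.vertex_or_cell z with ⟨x, rfl⟩ | ⟨l, s, h0, h1, rfl⟩ <;>
      rcases G.vertex_or_cell w with ⟨y, rfl⟩ | ⟨l', s', h0', h1', rfl⟩
    · have := congrFun e1 y
      by_cases h : x = y
      · rw [h]
      · simp [hat, h] at this
    · exact absurd e4 (by simpa using (mul_one_sub_pos h0' h1').ne)
    · exact absurd e4 (by simpa using (mul_one_sub_pos h0 h1).ne')
    · have hpos := mul_one_sub_pos h0 h1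
      have hl : l = l' := by
        by_contra hne
        have := congrFun e2 l
        rw [cellHeight_cell, G.cellHeight_cell_of_ne (Ne.symm hne)] at this
        linarith
      simp only [height_cell, skew_cell] at e3 e4
      rw [← e4] at e3
      rw [hl, Subtype.ext (mul_right_cancel₀ hpos.ne' e3)]
  · exact (continuous_pi G.continuous_hat).prodMk ((continuous_pi G.continuous_cellHeight).prodMk
      (G.continuous_skew.prodMk G.continuous_height))

instance [Finite V] [Finite Λ] : CompactSpace G.Space := by
  refine ⟨?_⟩
  have : (univ : Set G.Space) = range G.vertex ∪ ⋃ l, range (G.cell l) := by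
    refine (eq_univ_of_forall fun z => ?_).symm
    rcases G.vertex_or_cell z with ⟨x, rfl⟩ | ⟨l, s, -, -, rfl⟩
    · exact Or.inl ⟨x, rfl⟩
    · exact Or.inr (mem_iUnion.2 ⟨l, s, rfl⟩)
  rw [this]
  exact (finite_range _).isCompact.union
    (isCompact_iUnion fun l => isCompact_range (G.continuous_cell l))

/-! ### The Euler characteristic of a finite one-dimensional complex -/

/-- The point dividing the segment from `s` to `m` in the ratio `τ : 1 - τ`. -/
def slide (τ s m : I) : I :=
  ⟨(1 - τ) * s + τ * m, by
    have h1 := τ.2.1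
    have h2 := τ.2.2
    exact (convex_Icc (0 : ℝ) 1) s.2 m.2 (sub_nonneg.2 h2) h1 (by ring)⟩

@[simp] lemma slide_zero (s m : I) : slide 0 s m = s := by ext; simp [slide]

@[simp] lemma slide_one (s m : I) : slide 1 s m = m := by ext; simp [slide]

@[simp] lemma slide_self (τ s : I) : slide τ s s = s := by ext; simp [slide]; ring

@[fun_prop]
lemma continuous_slide {X : Type*} [TopologicalSpace X] {a b c : X → I} (ha : Continuous a)
    (hb : Continuous b) (hc : Continuous c) : Continuous fun x => slide (a x) (b x) (c x) := by
  unfold slide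
  fun_prop

lemma slide_mem {S : Set ℝ} (hS : Convex ℝ S) {s m : I} (hs : (s : ℝ) ∈ S) (hm : (m : ℝ) ∈ S)
    (τ : I) : (slide τ s m : ℝ) ∈ S :=
  hS hs hm (sub_nonneg.2 τ.2.2) τ.2.1 (by ring)

/-- The map `s ↦ 3 s - 1` cut off to `[0,1]`: it collapses the outer thirds to the endpoints. -/
def stretch (s : I) : I := projIcc 0 1 zero_le_one (3 * (s : ℝ) - 1)

lemma continuous_stretch : Continuous stretch := continuous_projIcc.comp (by fun_prop)

lemma stretch_of_le {s : I} (h : (s : ℝ) ≤ 1 / 3) : stretch s = 0 :=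
  projIcc_of_le_left _ (by linarith)

lemma stretch_of_ge {s : I} (h : 2 / 3 ≤ (s : ℝ)) : stretch s = 1 :=
  projIcc_of_right_le _ (by linarith)

/-- The path along which each point of the complex is moved when the 1-cells are stretched. -/
def stretchPath : G.Space → C(I, G.Space) :=
  G.lift (fun x => ContinuousMap.const _ (G.vertex x))
    (fun l => (ContinuousMap.curry ⟨fun p : I × I => G.cell l (slide p.2 p.1 (stretch p.1)), by
      have := continuous_stretch
      exact (G.continuous_cell l).comp (by fun_prop)⟩))
    (fun l => by
      ext τ
      simp [stretch_of_le, cell_zero])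
    (fun l => by
      ext τ
      have : stretch 1 = 1 := stretch_of_ge (by norm_num)
      simp [this, cell_one])

lemma continuous_stretchPath : Continuous G.stretchPath :=
  G.continuous_lift _ _ _ _ fun _ => ContinuousMap.continuous _

@[simp] lemma stretchPath_vertex (x : V) (τ : I) : G.stretchPath (G.vertex x) τ = G.vertex x := rfl

@[simp] lemma stretchPath_cell (l : Λ) (s τ : I) :
    G.stretchPath (G.cell l s) τ = G.cell l (slide τ s (stretch s)) := rfl

/-- The points near the 0-cells: on the 1-cells the outer thirds, as `2 / 9` is the height at
`1 / 3` and `2 / 3`. -/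
def nearVertices : Set G.Space := {z | G.height z < 2 / 9}

/-- The union of the open 1-cells. -/
def openCells : Set G.Space := {z | 0 < G.height z}

lemma height_cell_lt_iff (l : Λ) (s : I) :
    G.height (G.cell l s) < 2 / 9 ↔ (s : ℝ) < 1 / 3 ∨ 2 / 3 < (s : ℝ) := by
  rw [height_cell]
  constructor
  · intro h
    by_contra! hc
    nlinarith [mul_nonneg (sub_nonneg.2 hc.1) (sub_nonneg.2 hc.2)]
  · rintro (h | h) <;> nlinarith [s.2.1, s.2.2]

lemma stretchPath_mem {z : G.Space} (hz : z ∈ G.nearVertices) (τ : I) :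
    G.stretchPath z τ ∈ G.nearVertices := by
  rcases G.vertex_or_cell z with ⟨x, rfl⟩ | ⟨l, s, -, -, rfl⟩
  · exact hz
  · rw [stretchPath_cell]
    refine (G.height_cell_lt_iff l _).2 ?_
    rcases (G.height_cell_lt_iff l s).1 hz with h | h
    · exact Or.inl (slide_mem (convex_Iio _) h (by rw [stretch_of_le h.le]; norm_num) τ)
    · exact Or.inr (slide_mem (convex_Ioi _) h (by rw [stretch_of_ge h.le]; norm_num) τ)

lemma exists_stretchPath_one_eq {z : G.Space} (hz : z ∈ G.nearVertices) :
    ∃ x, G.stretchPath z 1 = G.vertex x := by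
  rcases G.vertex_or_cell z with ⟨x, rfl⟩ | ⟨l, s, -, -, rfl⟩
  · exact ⟨x, rfl⟩
  · rw [stretchPath_cell, slide_one]
    rcases (G.height_cell_lt_iff l s).1 hz with h | h
    · exact ⟨_, by rw [stretch_of_le h.le, cell_zero]⟩
    · exact ⟨_, by rw [stretch_of_ge h.le, cell_one]⟩

/-- The neighbourhood of the 0-cells is homotopy equivalent to the set of 0-cells. -/
lemma nonempty_nearVertices_homotopyEquiv [Finite V] [Finite Λ] [TopologicalSpace V]
    [DiscreteTopology V] : Nonempty (ContinuousMap.HomotopyEquiv G.nearVertices V) := by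
  choose c hc using fun z : G.nearVertices => G.exists_stretchPath_one_eq z.2
  have hemb : Topology.IsClosedEmbedding G.vertex :=
    continuous_of_discreteTopology.isClosedEmbedding G.vertex_injective
  have hH : Continuous fun p : I × G.nearVertices => G.stretchPath p.2 p.1 := by
    have := ContinuousMap.continuous_uncurry_of_continuous ⟨G.stretchPath, G.continuous_stretchPath⟩
    exact this.comp ((continuous_subtype_val.comp continuous_snd).prodMk continuous_fst)
  have hcc : Continuous c := by
    rw [hemb.isEmbedding.continuous_iff]
    have : G.vertex ∘ c = fun z : G.nearVertices => G.stretchPath z 1 := funext fun z => (hc z).symm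
    rw [this]
    exact hH.comp (continuous_const.prodMk continuous_id)
  refine ⟨⟨⟨c, hcc⟩, ⟨fun x => ⟨G.vertex x, by norm_num [nearVertices]⟩,
    continuous_of_discreteTopology⟩, ⟨ContinuousMap.Homotopy.symm ⟨⟨fun p =>
      ⟨G.stretchPath p.2 p.1, G.stretchPath_mem p.2.2 p.1⟩, hH.subtype_mk _⟩, ?_, ?_⟩⟩, ?_⟩⟩
  · rintro ⟨z, hz⟩
    apply Subtype.ext
    rcases G.vertex_or_cell z with ⟨x, rfl⟩ | ⟨l, s, -, -, rfl⟩ <;> simp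
  · intro z
    exact Subtype.ext (hc z)
  · convert ContinuousMap.Homotopic.refl _
    ext x
    exact G.vertex_injective (hc ⟨G.vertex x, by norm_num [nearVertices]⟩)

/-- The 1-cell and the parameter are continuous functions on the union of the open 1-cells. -/
lemma exists_openCells_coordinates [TopologicalSpace Λ] [DiscreteTopology Λ] :
    ∃ (c : G.openCells → Λ) (s : G.openCells → I), Continuous c ∧ Continuous s ∧
      ∀ z, 0 < s z ∧ s z < 1 ∧ (z : G.Space) = G.cell (c z) (s z) := by
  choose c s hs0 hs1 hcs using fun z : G.openCells => (G.height_pos_iff z).1 z.2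
  refine ⟨c, s, ?_, ?_, fun z => ⟨hs0 z, hs1 z, hcs z⟩⟩
  · refine continuous_discrete_rng.2 fun l => ?_
    have : c ⁻¹' {l} = {z : G.openCells | 0 < G.cellHeight l z} := by
      ext z
      simp only [mem_preimage, mem_singleton_iff, mem_ofPred_eq]
      rw [hcs z]
      constructor
      · rintro rfl
        rw [cellHeight_cell]
        exact mul_one_sub_pos (hs0 z) (hs1 z)
      · intro h
        by_contra hne
        rw [G.cellHeight_cell_of_ne hne] at h
        exact h.false
    rw [this]
    exact isOpen_lt continuous_const ((G.continuous_cellHeight l).comp continuous_subtype_val)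
  · rw [Topology.IsInducing.subtypeVal.continuous_iff]
    have : Subtype.val ∘ s = fun z : G.openCells => G.skew z / G.height z := by
      ext z
      have hpos := mul_one_sub_pos (hs0 z) (hs1 z)
      rw [hcs z, skew_cell, height_cell, mul_div_assoc, div_self hpos.ne', mul_one]
      rfl
    rw [this]
    exact (G.continuous_skew.comp continuous_subtype_val).div
      (G.continuous_height.comp continuous_subtype_val) fun z => ne_of_gt z.2

lemma continuous_uncurry_cell [TopologicalSpace Λ] [DiscreteTopology Λ] :
    Continuous fun p : Λ × I => G.cell p.1 p.2 :=
  continuous_prod_of_discrete_left.2 G.continuous_cell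

/-- The middle of the unit interval. -/
def half : I := ⟨1 / 2, by norm_num, by norm_num⟩

lemma cell_mem_openCells {l : Λ} {s : I} : G.cell l s ∈ G.openCells ↔ (s : ℝ) ∈ Ioo (0 : ℝ) 1 := by
  simp only [openCells, mem_ofPred_eq, height_cell, mem_Ioo]
  have h1 := s.2.1
  have h2 := s.2.2
  constructor
  · intro h
    refine ⟨h1.lt_of_ne fun h' => ?_, h2.lt_of_ne fun h' => ?_⟩
    · rw [← h'] at h
      simp at h
    · rw [h'] at h
      simp at h
  · rintro ⟨h, h'⟩
    exact mul_pos h (sub_pos.2 h')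

/-- The union of the open 1-cells is homotopy equivalent to the set of 1-cells. -/
lemma nonempty_openCells_homotopyEquiv [TopologicalSpace Λ] [DiscreteTopology Λ] :
    Nonempty (ContinuousMap.HomotopyEquiv G.openCells Λ) := by
  obtain ⟨c, s, hc, hs, hcs⟩ := G.exists_openCells_coordinates
  have hhalf : ((half : I) : ℝ) ∈ Ioo (0 : ℝ) 1 := by norm_num [half]
  have hH : Continuous fun p : I × G.openCells =>
      G.cell (c p.2) (slide p.1 (s p.2) half) :=
    G.continuous_uncurry_cell.comp ((hc.comp continuous_snd).prodMk
      (continuous_slide continuous_fst (hs.comp continuous_snd) continuous_const))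
  refine ⟨⟨⟨c, hc⟩, ⟨fun l => ⟨G.cell l half, G.cell_mem_openCells.2 hhalf⟩,
    continuous_of_discreteTopology⟩, ⟨ContinuousMap.Homotopy.symm ⟨⟨fun p =>
      ⟨G.cell (c p.2) (slide p.1 (s p.2) half), G.cell_mem_openCells.2
        (slide_mem (convex_Ioo _ _) ⟨(hcs _).1, (hcs _).2.1⟩ hhalf _)⟩,
      Continuous.subtype_mk hH _⟩, ?_, ?_⟩⟩, ?_⟩⟩
  · intro z
    apply Subtype.ext
    simp [← (hcs z).2.2]
  · intro z
    apply Subtype.ext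
    simp
  · convert ContinuousMap.Homotopic.refl _
    ext l
    have := (hcs ⟨G.cell l half, G.cell_mem_openCells.2 hhalf⟩).2.2
    exact (G.cell_inj hhalf.1 hhalf.2 this).1

/-- The points of the open 1-cells that are near the 0-cells form two contractible pieces for each
1-cell. -/
lemma nonempty_inter_homotopyEquiv [TopologicalSpace Λ] [DiscreteTopology Λ] :
    Nonempty (ContinuousMap.HomotopyEquiv ↥(G.nearVertices ∩ G.openCells) (Λ × Bool)) := by
  obtain ⟨c', s', hc', hs', hcs'⟩ := G.exists_openCells_coordinates
  let j : ↥(G.nearVertices ∩ G.openCells) → G.openCells := fun z => ⟨z, z.2.2⟩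
  have hj : Continuous j := by fun_prop
  obtain ⟨c, hc⟩ : ∃ c, c = c' ∘ j := ⟨_, rfl⟩
  obtain ⟨s, hs⟩ : ∃ s, s = s' ∘ j := ⟨_, rfl⟩
  have hcc : Continuous c := hc ▸ hc'.comp hj
  have hsc : Continuous s := hs ▸ hs'.comp hj
  have hcs : ∀ z, 0 < s z ∧ s z < 1 ∧ (z : G.Space) = G.cell (c z) (s z) := by
    rw [hc, hs]
    exact fun z => hcs' (j z)
  have hside : ∀ z, (s z : ℝ) < 1 / 3 ∨ 2 / 3 < (s z : ℝ) := by
    intro z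
    have := z.2.1
    rw [(hcs z).2.2] at this
    exact (G.height_cell_lt_iff _ _).1 this
  -- the set of parameters of the piece with label `b`, and its middle
  let S : Bool → Set ℝ := fun b => if b then Ioo (2 / 3) 1 else Ioo 0 (1 / 3)
  have hSconv : ∀ b, Convex ℝ (S b) := fun b => by
    cases b <;> simp only [S] <;> exact convex_Ioo _ _
  let μ : Bool → I := fun b => if b then ⟨5 / 6, by norm_num, by norm_num⟩ else
    ⟨1 / 6, by norm_num, by norm_num⟩
  have hμ : ∀ b, (μ b : ℝ) ∈ S b := by
    intro b
    cases b <;> norm_num [μ, S]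
  have hS : ∀ b l (t : I), (t : ℝ) ∈ S b → G.cell l t ∈ G.nearVertices ∩ G.openCells := by
    intro b l t ht
    refine ⟨(G.height_cell_lt_iff _ _).2 ?_, G.cell_mem_openCells.2 ?_⟩ <;> cases b <;>
      simp only [S, if_true, Bool.false_eq_true, if_false, mem_Ioo] at ht
    · exact Or.inl ht.2
    · exact Or.inr ht.1
    · exact ⟨ht.1, by linarith⟩
    · exact ⟨by linarith, ht.2⟩
  obtain ⟨β, hβ⟩ : ∃ β : ↥(G.nearVertices ∩ G.openCells) → Bool,
      β = fun z => decide (2 / 3 < (s z : ℝ)) := ⟨_, rfl⟩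
  have hβS : ∀ z, (s z : ℝ) ∈ S (β z) := by
    intro z
    have h0 : (0 : ℝ) < s z := (hcs z).1
    have h1 : (s z : ℝ) < 1 := (hcs z).2.1
    by_cases h : 2 / 3 < (s z : ℝ)
    · simp [hβ, S, h, h1]
    · have := (hside z).resolve_right h
      simp [hβ, S, h, h0]
      linarith
  have hsv : Continuous fun z => (s z : ℝ) := by fun_prop
  have hβc : Continuous β := by
    refine continuous_discrete_rng.2 fun b => ?_
    cases b
    · have : β ⁻¹' {false} = {z | (s z : ℝ) < 1 / 3} := by
        ext z
        rcases hside z with h | h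
        · simp only [hβ, mem_preimage, mem_singleton_iff, decide_eq_false_iff_not, mem_ofPred_eq]
          exact ⟨fun _ => h, fun _ => by linarith⟩
        · simp only [hβ, mem_preimage, mem_singleton_iff, decide_eq_false_iff_not, mem_ofPred_eq]
          exact ⟨fun h' => absurd h h', fun _ => by linarith⟩
      rw [this]
      exact isOpen_lt hsv continuous_const
    · have : β ⁻¹' {true} = {z | 2 / 3 < (s z : ℝ)} := by
        ext z
        simp [hβ]
      rw [this]
      exact isOpen_lt continuous_const hsv
  have hμc : Continuous fun z => μ (β z) :=
    (continuous_of_discreteTopology (f := μ)).comp hβc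
  have hH : Continuous fun p : I × ↥(G.nearVertices ∩ G.openCells) =>
      G.cell (c p.2) (slide p.1 (s p.2) (μ (β p.2))) :=
    G.continuous_uncurry_cell.comp ((hcc.comp continuous_snd).prodMk
      (continuous_slide continuous_fst (hsc.comp continuous_snd) (hμc.comp continuous_snd)))
  refine ⟨⟨⟨fun z => (c z, β z), by fun_prop⟩,
    ⟨fun p => ⟨G.cell p.1 (μ p.2), hS p.2 p.1 _ (hμ _)⟩, continuous_of_discreteTopology⟩,
    ⟨ContinuousMap.Homotopy.symm ⟨⟨fun p =>
      ⟨G.cell (c p.2) (slide p.1 (s p.2) (μ (β p.2))),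
        hS (β p.2) _ _ (slide_mem (hSconv _) (hβS _) (hμ _) _)⟩,
      Continuous.subtype_mk hH _⟩, ?_, ?_⟩⟩, ?_⟩⟩
  · intro z
    apply Subtype.ext
    simp [← (hcs z).2.2]
  · intro z
    apply Subtype.ext
    simp
  · convert ContinuousMap.Homotopic.refl _
    ext p
    all_goals
      have h1 := (hcs ⟨G.cell p.1 (μ p.2), hS p.2 p.1 _ (hμ _)⟩)
      obtain ⟨e1, e2⟩ := G.cell_inj (G.cell_mem_openCells.1 (hS p.2 p.1 _ (hμ _)).2).1
        (G.cell_mem_openCells.1 (hS p.2 p.1 _ (hμ _)).2).2 h1.2.2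
    · exact e1
    · obtain ⟨l, b⟩ := p
      simp only [ContinuousMap.comp_apply, ContinuousMap.coe_mk, ContinuousMap.id_apply, hβ, ← e2]
      cases b <;> norm_num [μ]

/-- The Euler characteristic of a finite one-dimensional complex is the number of 0-cells minus
the number of 1-cells. -/
theorem eulerCharacteristic_space [Finite V] [Finite Λ] :
    eulerCharacteristic G.Space = (((Nat.card V : ℤ) - Nat.card Λ : ℤ) : WithTop ℤ) := by
  let : TopologicalSpace V := ⊥
  have : DiscreteTopology V := ⟨rfl⟩
  let : TopologicalSpace Λ := ⊥
  have : DiscreteTopology Λ := ⟨rfl⟩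
  have h2 := ChainHomology.hasDiscreteHomology_of_homotopyEquiv
    (ChainHomology.sumHomotopyEquiv G.nonempty_nearVertices_homotopyEquiv.some
      G.nonempty_openCells_homotopyEquiv.some)
  have h1 := ChainHomology.hasDiscreteHomology_of_homotopyEquiv
    G.nonempty_inter_homotopyEquiv.some
  rw [ChainHomology.eulerCharacteristic_eq_sub (isOpen_lt G.continuous_height continuous_const)
    (isOpen_lt continuous_const G.continuous_height) ?_ h2 h1]
  · rw [Nat.card_sum, Nat.card_prod, Nat.card_eq_fintype_card (α := Bool), Fintype.card_bool]
    congr 1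
    push_cast
    ring
  · refine eq_univ_of_forall fun z => ?_
    by_cases h : 0 < G.height z
    · exact Or.inr h
    · exact Or.inl (by simp only [mem_ofPred_eq]; linarith)

end OneComplex

/-! ### Subcomplexes and sublevel sets -/

lemma eulerCharacteristic_congr {X Y : Type} [TopologicalSpace X] [TopologicalSpace Y]
    (e : X ≃ₜ Y) : eulerCharacteristic X = eulerCharacteristic Y := by
  have h (k : ℕ) : Nonempty (singularH k X ≃ₗ[ℤ] singularH k Y) :=
    ⟨(ChainHomology.nonempty_singularH_iso e.toHomotopyEquiv k).some.toLinearEquiv⟩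
  have hr (k : ℕ) : Module.finrank ℤ (singularH k X) = Module.finrank ℤ (singularH k Y) :=
    (h k).some.finrank_eq
  have hf : HasFiniteHomology X ↔ HasFiniteHomology Y := by
    unfold HasFiniteHomology
    refine and_congr (forall_congr' fun k => ?_) (exists_congr fun N => forall₂_congr fun k _ => ?_)
    · exact ⟨fun _ => Module.Finite.equiv (h k).some, fun _ => Module.Finite.equiv (h k).some.symm⟩
    · exact (h k).some.toEquiv.subsingleton_congr
  unfold eulerCharacteristic
  simp only [hr]
  classical exact if_congr hf rfl rfl

namespace OneComplex

open unitInterval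

variable {V Λ : Type} (G : OneComplex V Λ)

/-- A set `W` of arcs `Φ_l ((p, q))`, given as triples `(l, p, q)`, that do not meet the set `B` but
have their endpoints in `B`. -/
structure IsArcSystem (B : Set G.Space) (W : Set (Λ × I × I)) : Prop where
  lt : ∀ e ∈ W, e.2.1 < e.2.2
  left_mem : ∀ e ∈ W, G.cell e.1 e.2.1 ∈ B
  right_mem : ∀ e ∈ W, G.cell e.1 e.2.2 ∈ B
  notMem : ∀ e ∈ W, ∀ s, e.2.1 < s → s < e.2.2 → G.cell e.1 s ∉ B

namespace IsArcSystem

variable {G} {B : Set G.Space} {W : Set (Λ × I × I)}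

/-- Arcs of the system that meet are equal: otherwise one would contain an endpoint of the other. -/
lemma eq_of_mem (h : G.IsArcSystem B W) {e e' : Λ × I × I} (he : e ∈ W) (he' : e' ∈ W)
    (hl : e.1 = e'.1) {s : I}
    (h1 : e.2.1 < s) (h2 : s < e.2.2) (h1' : e'.2.1 < s) (h2' : s < e'.2.2) : e = e' := by
  obtain ⟨l, p, q⟩ := e
  obtain ⟨l', p', q'⟩ := e'
  obtain rfl : l = l' := hl
  have a1 := h.left_mem _ he
  have a2 := h.right_mem _ he
  have b1 := h.left_mem _ he'
  have b2 := h.right_mem _ he'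
  have hp : p = p' := by
    rcases lt_trichotomy p p' with hlt | heq | hlt
    · exact absurd b1 (h.notMem _ he p' hlt (h1'.trans h2))
    · exact heq
    · exact absurd a1 (h.notMem _ he' p hlt (h1.trans h2'))
  have hq : q = q' := by
    rcases lt_trichotomy q q' with hlt | heq | hlt
    · exact absurd a2 (h.notMem _ he' q (h1'.trans h2) hlt)
    · exact heq
    · exact absurd b2 (h.notMem _ he q' (h1.trans h2') hlt)
  rw [hp, hq]

variable (h : G.IsArcSystem B W)

/-- The one-dimensional complex with 0-cells `B` and 1-cells the arcs in `W`. -/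
def complex : OneComplex B W where
  init e := ⟨G.cell e.1.1 e.1.2.1, h.left_mem _ e.2⟩
  term e := ⟨G.cell e.1.1 e.1.2.2, h.right_mem _ e.2⟩

/-- The realisation of the complex of arcs as a subset of the ambient complex. -/
def inclusion : h.complex.Space → G.Space :=
  h.complex.lift (fun b => b.1) (fun e s => G.cell e.1.1 (slide s e.1.2.1 e.1.2.2))
    (fun e => by rw [slide_zero]; rfl) (fun e => by rw [slide_one]; rfl)

lemma continuous_inclusion : Continuous h.inclusion :=
  h.complex.continuous_lift _ _ _ _ fun e => (G.continuous_cell e.1.1).comp (by fun_prop)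

lemma lt_slide {p q s : I} (hpq : p < q) (hs : 0 < s) : p < slide s p q := by
  have h1 : (p : ℝ) < q := hpq
  have h2 : (0 : ℝ) < s := hs
  change (p : ℝ) < (1 - s) * p + s * q
  nlinarith

lemma slide_lt {p q s : I} (hpq : p < q) (hs : s < 1) : slide s p q < q := by
  have h1 : (p : ℝ) < q := hpq
  have h2 : (s : ℝ) < 1 := hs
  change (1 - s) * p + s * q < (q : ℝ)
  nlinarith

lemma slide_inj {p q s s' : I} (hpq : p < q) (hs : slide s p q = slide s' p q) : s = s' := by
  have h1 : (p : ℝ) < q := hpq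
  have h2 : (1 - (s : ℝ)) * p + s * q = (1 - s') * p + s' * q := congrArg Subtype.val hs
  have h3 : ((s : ℝ) - s') * (q - p) = 0 := by linear_combination h2
  rcases mul_eq_zero.1 h3 with h4 | h4
  · exact Subtype.ext (sub_eq_zero.1 h4)
  · linarith

lemma exists_slide_eq {p q s : I} (hp : p < s) (hq : s < q) : ∃ r, slide r p q = s := by
  have h1 : (p : ℝ) < s := hp
  have h2 : (s : ℝ) < q := hq
  have h3 : (0 : ℝ) < q - p := by linarith
  refine ⟨⟨(s - p) / (q - p), div_nonneg (by linarith) h3.le, (div_le_one h3).2 (by linarith)⟩, ?_⟩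
  apply Subtype.ext
  change (1 - ((s : ℝ) - p) / (q - p)) * p + (s - p) / (q - p) * q = s
  field_simp
  ring

lemma inclusion_injective : Function.Injective h.inclusion := by
  have hlt (e : W) : e.1.2.1 < e.1.2.2 := h.lt _ e.2
  have hnot (b : B) (e : W) (s : I) (h0 : 0 < s) (h1 : s < 1) :
      b.1 ≠ G.cell e.1.1 (slide s e.1.2.1 e.1.2.2) := fun heq =>
    h.notMem _ e.2 _ (lt_slide (hlt e) h0) (slide_lt (hlt e) h1) (heq ▸ b.2)
  intro x y hxy
  rcases h.complex.vertex_or_cell x with ⟨b, rfl⟩ | ⟨e, s, h0, h1, rfl⟩ <;>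
  rcases h.complex.vertex_or_cell y with ⟨b', rfl⟩ | ⟨e', s', h0', h1', rfl⟩
  · exact congrArg _ (Subtype.ext hxy)
  · exact absurd hxy (hnot _ _ _ h0' h1')
  · exact absurd hxy.symm (hnot _ _ _ h0 h1)
  · have a0 := lt_slide (hlt e) h0
    have a1 := slide_lt (hlt e) h1
    obtain ⟨hl, hs⟩ := G.cell_inj ((zero_le).trans_lt a0) (a1.trans_le le_one') hxy
    obtain rfl : e = e' := Subtype.ext (h.eq_of_mem e.2 e'.2 hl a0 a1
      (hs ▸ lt_slide (hlt e') h0') (hs ▸ slide_lt (hlt e') h1'))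
    rw [slide_inj (hlt e) hs]

lemma mem_range_inclusion {z : G.Space} : z ∈ range h.inclusion ↔
    z ∈ B ∨ ∃ e ∈ W, ∃ s, e.2.1 < s ∧ s < e.2.2 ∧ z = G.cell e.1 s := by
  constructor
  · rintro ⟨x, rfl⟩
    rcases h.complex.vertex_or_cell x with ⟨b, rfl⟩ | ⟨e, s, h0, h1, rfl⟩
    · exact Or.inl b.2
    · exact Or.inr ⟨e.1, e.2, _, lt_slide (h.lt _ e.2) h0, slide_lt (h.lt _ e.2) h1, rfl⟩
  · rintro (hz | ⟨e, he, s, h0, h1, rfl⟩)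
    · exact ⟨h.complex.vertex ⟨z, hz⟩, rfl⟩
    · obtain ⟨r, hr⟩ := exists_slide_eq h0 h1
      exact ⟨h.complex.cell ⟨e, he⟩ r, congrArg (G.cell e.1) hr⟩

/-- The union of finitely many points and of finitely many arcs joining them has Euler
characteristic the number of points minus the number of arcs. -/
lemma eulerCharacteristic_range (hB : B.Finite) (hW : W.Finite) :
    eulerCharacteristic (range h.inclusion) = (((B.ncard : ℤ) - W.ncard : ℤ) : WithTop ℤ) := by
  have := hB.to_subtype
  have := hW.to_subtype
  have he : Topology.IsEmbedding h.inclusion :=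
    (h.continuous_inclusion.isClosedEmbedding h.inclusion_injective).isEmbedding
  rw [← eulerCharacteristic_congr he.toHomeomorph, h.complex.eulerCharacteristic_space,
    Nat.card_coe_set_eq, Nat.card_coe_set_eq]

end IsArcSystem

/-- The parameters on the `l`-th 1-cell of the points of a set. -/
def params (B : Set G.Space) (l : Λ) : Set I := {s | G.cell l s ∈ B}

lemma finite_params {B : Set G.Space} (hB : B.Finite) (l : Λ) : (G.params B l).Finite := by
  have h : ((G.cell l) ⁻¹' B ∩ Ioo 0 1).Finite := by
    refine Finite.of_finite_image (f := G.cell l) (hB.subset ?_) ?_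
    · rintro _ ⟨s, hs, rfl⟩
      exact hs.1
    · intro s hs s' _ heq
      exact (G.cell_inj hs.2.1 hs.2.2 heq).2
  refine (h.union (toFinite {0, 1})).subset fun s hs => ?_
  rcases eq_or_ne s 0 with rfl | h0
  · exact Or.inr (by simp)
  rcases eq_or_ne s 1 with rfl | h1
  · exact Or.inr (by simp)
  exact Or.inl ⟨hs, unitInterval.pos_iff_ne_zero.2 h0, unitInterval.lt_one_iff_ne_one.2 h1⟩

lemma finite_openCurves [Finite Λ] (A : Finset G.Space) : (G.openCurves A).Finite := by
  have h : (⋃ l : Λ, ({l} : Set Λ) ×ˢ (G.params A l ×ˢ G.params A l)).Finite :=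
    finite_iUnion fun l => (finite_singleton l).prod
      ((G.finite_params A.finite_toSet l).prod (G.finite_params A.finite_toSet l))
  refine h.subset fun e he => mem_iUnion.2 ⟨e.1, rfl, ?_, ?_⟩
  · exact Finset.mem_coe.2 he.2.1
  · exact Finset.mem_coe.2 he.2.2.1

/-- Every point off a finite set that contains the 0-cells lies on exactly one of the open curves
in the complement; this is the existence part. -/
lemma exists_openCurve {A : Finset G.Space} (hA : ∀ x, G.vertex x ∈ A) {l : Λ} {s : I}
    (hs : G.cell l s ∉ A) : ∃ p q, p < s ∧ s < q ∧ (l, p, q) ∈ G.openCurves A := by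
  have hfin := G.finite_params A.finite_toSet l
  have h0 : (0 : I) ∈ G.params A l ∩ Iic s :=
    ⟨by simp [params, cell_zero, hA], mem_Iic.2 zero_le⟩
  have h1 : (1 : I) ∈ G.params A l ∩ Ici s :=
    ⟨by simp [params, cell_one, hA], le_one'⟩
  obtain ⟨p, hp⟩ := (hfin.inter_of_left _).exists_maximal ⟨_, h0⟩
  obtain ⟨q, hq⟩ := (hfin.inter_of_left _).exists_minimal ⟨_, h1⟩
  have hps : p < s := lt_of_le_of_ne hp.prop.2 fun h => hs (h ▸ hp.prop.1)
  have hsq : s < q := lt_of_le_of_ne hq.prop.2 fun h => hs (h ▸ hq.prop.1)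
  refine ⟨p, q, hps, hsq, hps.trans hsq, hp.prop.1, hq.prop.1, fun r hr hr' hmem => ?_⟩
  rcases le_total r s with h | h
  · exact hr.not_ge (hp.le_of_ge ⟨hmem, h⟩ hr.le)
  · exact hr'.not_ge (hq.le_of_le ⟨hmem, h⟩ hr'.le)

/-- A sublevel set of a continuous function whose level set is finite is a union of points and arcs
of the subdivision of the complex at the level set. -/
lemma eulerCharacteristic_sublevel [Finite Λ] {h : G.Space → ℝ} (hh : Continuous h) {t : ℝ}
    {B : Finset G.Space} (hV : ∀ x, G.vertex x ∈ B) (hB : ∀ z, h z = t → z ∈ B) :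
    eulerCharacteristic {z | h z ≤ t} = ((({b | b ∈ B ∧ h b ≤ t}.ncard : ℤ) -
      {e | e ∈ G.openCurves B ∧ ∀ s, e.2.1 < s → s < e.2.2 → h (G.cell e.1 s) < t}.ncard : ℤ) :
        WithTop ℤ) := by
  have hcont (l : Λ) : Continuous fun s => h (G.cell l s) := hh.comp (G.continuous_cell l)
  have hsys : G.IsArcSystem {b | b ∈ B ∧ h b ≤ t}
      {e | e ∈ G.openCurves B ∧ ∀ s, e.2.1 < s → s < e.2.2 → h (G.cell e.1 s) < t} := by
    have key (e : Λ × I × I) (he : e.2.1 < e.2.2)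
        (H : ∀ s, e.2.1 < s → s < e.2.2 → h (G.cell e.1 s) < t) :
        ∀ s ∈ Icc e.2.1 e.2.2, h (G.cell e.1 s) ≤ t := by
      intro s hs
      rw [← closure_Ioo he.ne] at hs
      exact closure_minimal (fun r hr => (H r hr.1 hr.2).le)
        (isClosed_le (hcont e.1) continuous_const) hs
    refine ⟨fun e he => he.1.1, fun e he => ⟨he.1.2.1, key e he.1.1 he.2 _ ⟨le_rfl, he.1.1.le⟩⟩,
      fun e he => ⟨he.1.2.2.1, key e he.1.1 he.2 _ ⟨he.1.1.le, le_rfl⟩⟩,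
      fun e he s h1 h2 hs => he.1.2.2.2 s h1 h2 hs.1⟩
  have hrange : range hsys.inclusion = {z | h z ≤ t} := by
    ext z
    rw [hsys.mem_range_inclusion]
    constructor
    · rintro (hz | ⟨e, he, s, h1, h2, rfl⟩)
      · exact hz.2
      · exact (he.2 s h1 h2).le
    · intro hz
      by_cases hzB : z ∈ B
      · exact Or.inl ⟨hzB, hz⟩
      rcases G.vertex_or_cell z with ⟨x, rfl⟩ | ⟨l, s, -, -, rfl⟩
      · exact absurd (hV x) hzB
      obtain ⟨p, q, hp, hq, he⟩ := G.exists_openCurve hV hzB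
      refine Or.inr ⟨(l, p, q), ⟨he, fun r hr hr' => ?_⟩, s, hp, hq, rfl⟩
      -- the function does not take the value `t` on the curve, hence stays below `t`
      by_contra! hge
      have hst : h (G.cell l s) < t := lt_of_le_of_ne hz fun heq => hzB (hB _ heq)
      obtain ⟨c, hc, hct⟩ := (isPreconnected_Ioo (a := p) (b := q)).intermediate_value
        ⟨hp, hq⟩ ⟨hr, hr'⟩ (hcont l).continuousOn ⟨hst.le, hge⟩
      exact he.2.2.2 c hc.1 hc.2 (hB _ hct)
  have := hsys.eulerCharacteristic_range (B.finite_toSet.subset fun b hb => hb.1)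
    ((G.finite_openCurves B).subset fun e he => he.1)
  rwa [hrange] at this

end OneComplex

/-! ### Counting points and arcs -/

section consecutive

variable {α M : Type*} [LinearOrder α] [AddCommMonoid M]

/-- The pairs `p < q` of consecutive elements of a finite set. -/
def consecutive (S : Finset α) : Finset (α × α) :=
  {x ∈ S ×ˢ S | x.1 < x.2 ∧ ∀ s ∈ S, x.1 < s → ¬ s < x.2}

lemma mem_consecutive {S : Finset α} {x : α × α} :
    x ∈ consecutive S ↔ x.1 ∈ S ∧ x.2 ∈ S ∧ x.1 < x.2 ∧ ∀ s ∈ S, x.1 < s → ¬ s < x.2 := by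
  simp [consecutive, and_assoc]

lemma sum_consecutive_fst {S : Finset α} {b : α} (hb : b ∈ S) (hmax : ∀ s ∈ S, s ≤ b)
    (φ : α → M) : ∑ x ∈ consecutive S, φ x.1 = ∑ s ∈ S.erase b, φ s := by
  refine Finset.sum_nbij Prod.fst ?_ ?_ ?_ fun _ _ => rfl
  · intro x hx
    obtain ⟨h1, h2, h3, -⟩ := mem_consecutive.1 hx
    exact Finset.mem_erase.2 ⟨(h3.trans_le (hmax _ h2)).ne, h1⟩
  · rintro ⟨p, q⟩ hx ⟨p', q'⟩ hx' heq
    obtain rfl : p = p' := heq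
    obtain ⟨-, h2, h3, h4⟩ := mem_consecutive.1 hx
    obtain ⟨-, h2', h3', h4'⟩ := mem_consecutive.1 hx'
    exact congrArg (Prod.mk p) (le_antisymm (not_lt.1 (h4 q' h2' h3')) (not_lt.1 (h4' q h2 h3)))
  · intro p hp
    obtain ⟨hne, hpS⟩ := Finset.mem_erase.1 (Finset.mem_coe.1 hp)
    obtain ⟨q, hq⟩ := (S.filter (p < ·)).exists_minimal
      ⟨b, Finset.mem_filter.2 ⟨hb, lt_of_le_of_ne (hmax p hpS) hne⟩⟩
    obtain ⟨hqS, hpq⟩ := Finset.mem_filter.1 hq.prop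
    refine ⟨(p, q), Finset.mem_coe.2 (mem_consecutive.2 ⟨hpS, hqS, hpq, fun s hs h1 h2 => ?_⟩), rfl⟩
    exact h2.not_ge (hq.le_of_le (Finset.mem_filter.2 ⟨hs, h1⟩) h2.le)

lemma sum_consecutive_snd {S : Finset α} {a : α} (ha : a ∈ S) (hmin : ∀ s ∈ S, a ≤ s)
    (φ : α → M) : ∑ x ∈ consecutive S, φ x.2 = ∑ s ∈ S.erase a, φ s := by
  refine Finset.sum_nbij Prod.snd ?_ ?_ ?_ fun _ _ => rfl
  · intro x hx
    obtain ⟨h1, h2, h3, -⟩ := mem_consecutive.1 hx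
    exact Finset.mem_erase.2 ⟨((hmin _ h1).trans_lt h3).ne', h2⟩
  · rintro ⟨p, q⟩ hx ⟨p', q'⟩ hx' heq
    obtain rfl : q = q' := heq
    obtain ⟨h2, -, h3, h4⟩ := mem_consecutive.1 hx
    obtain ⟨h2', -, h3', h4'⟩ := mem_consecutive.1 hx'
    rw [le_antisymm (not_lt.1 fun h => h4' p h2 h h3) (not_lt.1 fun h => h4 p' h2' h h3')]
  · intro q hq
    obtain ⟨hne, hqS⟩ := Finset.mem_erase.1 (Finset.mem_coe.1 hq)
    obtain ⟨p, hp⟩ := (S.filter (· < q)).exists_maximal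
      ⟨a, Finset.mem_filter.2 ⟨ha, lt_of_le_of_ne (hmin q hqS) hne.symm⟩⟩
    obtain ⟨hpS, hpq⟩ := Finset.mem_filter.1 hp.prop
    refine ⟨(p, q), Finset.mem_coe.2 (mem_consecutive.2 ⟨hpS, hqS, hpq, fun s hs h1 h2 => ?_⟩), rfl⟩
    exact h1.not_ge (hp.le_of_ge (Finset.mem_filter.2 ⟨hs, h2⟩) h1.le)

/-- A sum over the two ends of all gaps of a finite set, sorted by points. -/
lemma sum_consecutive_ends {S : Finset α} {a b : α} (hab : a < b) (ha : a ∈ S) (hb : b ∈ S)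
    (hmin : ∀ s ∈ S, a ≤ s) (hmax : ∀ s ∈ S, s ≤ b) (φ ψ : α → M) :
    ∑ x ∈ consecutive S, (φ x.1 + ψ x.2) =
      φ a + ψ b + ∑ s ∈ S.filter (fun s => a < s ∧ s < b), (φ s + ψ s) := by
  have e1 : S.erase b = insert a (S.filter fun s => a < s ∧ s < b) := by
    ext s
    simp only [Finset.mem_erase, Finset.mem_insert, Finset.mem_filter]
    constructor
    · rintro ⟨h1, h2⟩
      rcases (hmin s h2).eq_or_lt with h | h
      · exact Or.inl h.symm
      · exact Or.inr ⟨h2, h, lt_of_le_of_ne (hmax s h2) h1⟩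
    · rintro (rfl | ⟨h1, -, h3⟩)
      · exact ⟨hab.ne, ha⟩
      · exact ⟨h3.ne, h1⟩
  have e2 : S.erase a = insert b (S.filter fun s => a < s ∧ s < b) := by
    ext s
    simp only [Finset.mem_erase, Finset.mem_insert, Finset.mem_filter]
    constructor
    · rintro ⟨h1, h2⟩
      rcases (hmax s h2).eq_or_lt with h | h
      · exact Or.inl h
      · exact Or.inr ⟨h2, lt_of_le_of_ne (hmin s h2) (Ne.symm h1), h⟩
    · rintro (rfl | ⟨h1, h2, -⟩)
      · exact ⟨hab.ne', hb⟩
      · exact ⟨h2.ne', h1⟩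
  rw [Finset.sum_add_distrib, sum_consecutive_fst hb hmax, sum_consecutive_snd ha hmin, e1, e2,
    Finset.sum_insert (by simp), Finset.sum_insert (by simp), Finset.sum_add_distrib]
  abel

end consecutive

open Classical in
/-- The number `1` if `P` is true and `0` if `P` is false. -/
def truth (P : Prop) : ℝ := if P then 1 else 0

lemma truth_of {P : Prop} (h : P) : truth P = 1 := by simp [truth, h]

lemma truth_of_not {P : Prop} (h : ¬ P) : truth P = 0 := by simp [truth, h]

lemma ncard_eq_sum_truth {α : Type*} (S : Finset α) (P : α → Prop) :
    (({x | x ∈ S ∧ P x}.ncard : ℕ) : ℝ) = ∑ x ∈ S, truth (P x) := by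
  classical
  have h : {x | x ∈ S ∧ P x} = ((S.filter P : Finset α) : Set α) := by
    ext
    simp
  rw [h, Set.ncard_coe_finset, Finset.card_filter]
  push_cast
  exact Finset.sum_congr rfl fun x _ => by unfold truth; congr

namespace OneComplex

open unitInterval Filter Topology

variable {V Λ : Type} (G : OneComplex V Λ)

/-- The interior parameters on the `l`-th 1-cell of the points of a finite set. -/
def innerParams (B : Finset G.Space) (l : Λ) : Finset I :=
  (G.finite_params B.finite_toSet l).toFinset.filter fun s => 0 < s ∧ s < 1

lemma mem_innerParams {B : Finset G.Space} {l : Λ} {s : I} :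
    s ∈ G.innerParams B l ↔ G.cell l s ∈ B ∧ 0 < s ∧ s < 1 := by
  simp [innerParams, params]

/-- The open curves in the complement of a finite set, as a finite set. -/
def openCurvesFinset [Finite Λ] (B : Finset G.Space) : Finset (Λ × I × I) :=
  (G.finite_openCurves B).toFinset

@[simp] lemma mem_openCurvesFinset [Finite Λ] {B : Finset G.Space} {e : Λ × I × I} :
    e ∈ G.openCurvesFinset B ↔ e ∈ G.openCurves B := by simp [openCurvesFinset]

lemma isArcSystem_openCurves (B : Finset G.Space) : G.IsArcSystem (B : Set G.Space)
    (G.openCurves B) :=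
  ⟨fun _ h => h.1, fun _ h => h.2.1, fun _ h => h.2.2.1, fun _ h => h.2.2.2⟩

section sums

variable [Fintype Λ] {M : Type*} [AddCommMonoid M] {B : Finset G.Space}

/-- A sum over the two ends of all open curves, sorted by points. -/
lemma sum_openCurves_ends (hV : ∀ x, G.vertex x ∈ B) (φ ψ : Λ → I → M) :
    ∑ e ∈ G.openCurvesFinset B, (φ e.1 e.2.1 + ψ e.1 e.2.2) =
      ∑ l, (φ l 0 + ψ l 1) + ∑ l, ∑ s ∈ G.innerParams B l, (φ l s + ψ l s) := by
  rw [Finset.sum_finset_product (G.openCurvesFinset B) Finset.univ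
    (fun l => consecutive (G.finite_params B.finite_toSet l).toFinset), ← Finset.sum_add_distrib]
  · refine Finset.sum_congr rfl fun l _ => ?_
    exact sum_consecutive_ends (φ := φ l) (ψ := ψ l) zero_lt_one
      (by simp [params, cell_zero, hV]) (by simp [params, cell_one, hV]) (fun _ _ => zero_le)
      (fun _ _ => le_one')
  · rintro ⟨l, p, q⟩
    simp only [mem_openCurvesFinset, openCurves, mem_ofPred_eq, Finset.mem_univ, true_and,
      mem_consecutive, Finite.mem_toFinset, params, Finset.mem_coe]
    constructor
    · rintro ⟨h1, h2, h3, h4⟩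
      exact ⟨h2, h3, h1, fun s hs h5 h6 => h4 s h5 h6 hs⟩
    · rintro ⟨h2, h3, h1, h4⟩
      exact ⟨h1, h2, h3, fun s h5 h6 hs => h4 s hs h5 h6⟩

lemma sum_points [Fintype V] (hV : ∀ x, G.vertex x ∈ B) (φ : G.Space → M) :
    ∑ z ∈ B, φ z = ∑ x, φ (G.vertex x) + ∑ l, ∑ s ∈ G.innerParams B l, φ (G.cell l s) := by
  classical
  have hB : B = (Finset.univ.image G.vertex).disjUnion
      (Finset.univ.biUnion fun l => (G.innerParams B l).image (G.cell l)) (by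
        rw [Finset.disjoint_left]
        simp only [Finset.mem_image, Finset.mem_univ, true_and, Finset.mem_biUnion]
        rintro _ ⟨x, rfl⟩ ⟨l, s, hs, heq⟩
        have := G.mem_innerParams.1 hs
        exact G.vertex_ne_cell this.2.1 this.2.2 heq.symm) := by
    ext z
    simp only [Finset.mem_disjUnion, Finset.mem_image, Finset.mem_univ, true_and,
      Finset.mem_biUnion]
    constructor
    · intro hz
      rcases G.vertex_or_cell z with ⟨x, rfl⟩ | ⟨l, s, h0, h1, rfl⟩
      · exact Or.inl ⟨x, rfl⟩
      · exact Or.inr ⟨l, s, G.mem_innerParams.2 ⟨hz, h0, h1⟩, rfl⟩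
    · rintro (⟨x, rfl⟩ | ⟨l, s, hs, rfl⟩)
      · exact hV x
      · exact (G.mem_innerParams.1 hs).1
  conv_lhs => rw [hB]
  rw [Finset.sum_disjUnion, Finset.sum_image G.vertex_injective.injOn, Finset.sum_biUnion]
  · refine congrArg _ (Finset.sum_congr rfl fun l _ => Finset.sum_image ?_)
    intro s hs s' _ heq
    have := G.mem_innerParams.1 (Finset.mem_coe.1 hs)
    exact (G.cell_inj this.2.1 this.2.2 heq).2
  · intro l _ l' _ hne
    rw [Function.onFun, Finset.disjoint_left]
    simp only [Finset.mem_image]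
    rintro _ ⟨s, hs, rfl⟩ ⟨s', _, heq⟩
    have := G.mem_innerParams.1 hs
    exact hne (G.cell_inj this.2.1 this.2.2 heq.symm).1

end sums

variable [Fintype Λ]

/-- The contribution of the 0-cells and of the ends of the 1-cells to the Euler characteristic of
the sublevel set at `t`, where each end of a 1-cell counts for one half. -/
def endCount [Fintype V] (h : G.Space → ℝ) (t : ℝ) : ℝ :=
  ∑ x, truth (h (G.vertex x) ≤ t) -
    2⁻¹ * ∑ l, (truth (h (G.cell l 0) ≤ t) + truth (h (G.cell l 1) ≤ t))

lemma ncard_sub_ncard_eq [Fintype V] {A : Finset G.Space} (hV : ∀ x, G.vertex x ∈ A)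
    (h : G.Space → ℝ) (t : ℝ) :
    (({b | b ∈ A ∧ h b ≤ t}.ncard : ℕ) : ℝ) - (({e | e ∈ G.openCurves A ∧
      max (h (G.cell e.1 e.2.1)) (h (G.cell e.1 e.2.2)) ≤ t}.ncard : ℕ) : ℝ) =
    G.endCount h t + 2⁻¹ * ∑ e ∈ G.openCurvesFinset A,
      truth (min (h (G.cell e.1 e.2.1)) (h (G.cell e.1 e.2.2)) ≤ t ∧
        t < max (h (G.cell e.1 e.2.1)) (h (G.cell e.1 e.2.2))) := by
  have h1 : (({e | e ∈ G.openCurves A ∧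
      max (h (G.cell e.1 e.2.1)) (h (G.cell e.1 e.2.2)) ≤ t}.ncard : ℕ) : ℝ) =
      ∑ e ∈ G.openCurvesFinset A,
        truth (max (h (G.cell e.1 e.2.1)) (h (G.cell e.1 e.2.2)) ≤ t) := by
    rw [← ncard_eq_sum_truth]
    simp only [mem_openCurvesFinset]
  have h2 (a b : ℝ) : truth (max a b ≤ t) =
      2⁻¹ * (truth (a ≤ t) + truth (b ≤ t)) - 2⁻¹ * truth (min a b ≤ t ∧ t < max a b) := by
    by_cases ha : a ≤ t <;> by_cases hb : b ≤ t <;> simp [truth, ha, hb, ← not_le]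
    norm_num
  rw [h1, ncard_eq_sum_truth, G.sum_points hV]
  simp only [h2]
  rw [Finset.sum_sub_distrib, ← Finset.mul_sum, ← Finset.mul_sum, G.sum_openCurves_ends hV
    (fun l s => truth (h (G.cell l s) ≤ t)) (fun l s => truth (h (G.cell l s) ≤ t)), endCount]
  simp only [← two_mul, ← Finset.mul_sum]
  ring

variable {G} {h : G.Space → ℝ} {t : ℝ}

/-- For a regular value of a function, the Euler characteristic of the sublevel set is the
contribution of the ends plus half of the number of points in the level set. -/
lemma exists_eulerCharacteristic_sublevel [Fintype V] (hh : Continuous h) {B : Finset G.Space}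
    (hB : ∀ z, z ∈ B ↔ z ∈ range G.vertex ∨ h z = t) (hV : ∀ x, h (G.vertex x) ≠ t)
    (hcross : ∀ l s, 0 < s → s < 1 → h (G.cell l s) = t →
      truth (∀ᶠ r in 𝓝[>] s, h (G.cell l r) < t) + truth (∀ᶠ r in 𝓝[<] s, h (G.cell l r) < t) = 1) :
    ∃ m : ℤ, eulerCharacteristic {z | h z ≤ t} = (m : WithTop ℤ) ∧
      (m : ℝ) = G.endCount h t + 2⁻¹ * ∑ l, ((G.innerParams B l).card : ℝ) := by
  have hcont (l : Λ) : Continuous fun s => h (G.cell l s) := hh.comp (G.continuous_cell l)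
  have hVB (x : V) : G.vertex x ∈ B := (hB _).2 (Or.inl ⟨x, rfl⟩)
  refine ⟨_, G.eulerCharacteristic_sublevel hh hVB fun z hz => (hB z).2 (Or.inr hz), ?_⟩
  have hinner {l : Λ} {s : I} (hs : s ∈ G.innerParams B l) : h (G.cell l s) = t := by
    obtain ⟨h1, h2, h3⟩ := G.mem_innerParams.1 hs
    rcases (hB _).1 h1 with ⟨x, hx⟩ | h4
    · exact absurd hx (G.vertex_ne_cell h2 h3)
    · exact h4
  have h0 (l : Λ) : h (G.cell l 0) ≠ t := by rw [cell_zero]; exact hV _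
  have h1 (l : Λ) : h (G.cell l 1) ≠ t := by rw [cell_one]; exact hV _
  -- whether an open curve lies below the level `t` is visible at either of its ends
  have hbelow (e : Λ × I × I) (he : e ∈ G.openCurves B) :
      truth (∀ s, e.2.1 < s → s < e.2.2 → h (G.cell e.1 s) < t) =
        2⁻¹ * (truth (∀ᶠ r in 𝓝[>] e.2.1, h (G.cell e.1 r) < t) +
          truth (∀ᶠ r in 𝓝[<] e.2.2, h (G.cell e.1 r) < t)) := by
    obtain ⟨l, p, q⟩ := e
    have hpq : p < q := he.1
    have hne (s : I) (hs : s ∈ Ioo p q) : h (G.cell l s) ≠ t := fun heq =>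
      he.2.2.2 s hs.1 hs.2 ((hB _).2 (Or.inr heq))
    have hright : ∀ᶠ r in 𝓝[>] p, r ∈ Ioo p q := Ioo_mem_nhdsGT hpq
    have hleft : ∀ᶠ r in 𝓝[<] q, r ∈ Ioo p q := Ioo_mem_nhdsLT hpq
    have : (𝓝[>] p).NeBot := nhdsGT_neBot_of_exists_gt ⟨q, hpq⟩
    have : (𝓝[<] q).NeBot := nhdsLT_neBot_of_exists_lt ⟨p, hpq⟩
    by_cases hlt : ∀ s, p < s → s < q → h (G.cell l s) < t
    · rw [truth_of hlt, truth_of (hright.mono fun r hr => hlt r hr.1 hr.2),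
        truth_of (hleft.mono fun r hr => hlt r hr.1 hr.2)]
      norm_num
    · have hgt (r : I) (hr : r ∈ Ioo p q) : ¬ h (G.cell l r) < t := fun hr' => by
        push Not at hlt
        obtain ⟨s, hs, hs', hst⟩ := hlt
        obtain ⟨c, hc, hct⟩ := (isPreconnected_Ioo (a := p) (b := q)).intermediate_value
          hr ⟨hs, hs'⟩ (hcont l).continuousOn ⟨hr'.le, hst⟩
        exact hne c hc hct
      rw [truth_of_not hlt, truth_of_not, truth_of_not]
      · norm_num
      · intro H
        obtain ⟨r, hr, hr'⟩ := (H.and hleft).exists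
        exact hgt r hr' hr
      · intro H
        obtain ⟨r, hr, hr'⟩ := (H.and hright).exists
        exact hgt r hr' hr
  have hend (F : Filter I) [F.NeBot] (l : Λ) (s : I) (hF : F ≤ 𝓝 s) (hs : h (G.cell l s) ≠ t) :
      truth (∀ᶠ r in F, h (G.cell l r) < t) = truth (h (G.cell l s) ≤ t) := by
    rcases lt_or_gt_of_ne hs with hlt | hgt
    · rw [truth_of hlt.le,
        truth_of (((hcont l).continuousAt.eventually_lt_const hlt).filter_mono hF)]
    · rw [truth_of_not hgt.not_ge, truth_of_not]
      intro H
      obtain ⟨r, hr, hr'⟩ :=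
        (H.and (((hcont l).continuousAt.eventually_const_lt hgt).filter_mono hF)).exists
      exact lt_asymm hr hr'
  have : (𝓝[>] (0 : I)).NeBot := nhdsGT_neBot_of_exists_gt ⟨1, zero_lt_one⟩
  have : (𝓝[<] (1 : I)).NeBot := nhdsLT_neBot_of_exists_lt ⟨0, zero_lt_one⟩
  push_cast
  have e1 : (({e | e ∈ G.openCurves B ∧
      ∀ s, e.2.1 < s → s < e.2.2 → h (G.cell e.1 s) < t}.ncard : ℕ) : ℝ) =
      ∑ e ∈ G.openCurvesFinset B,
        truth (∀ s, e.2.1 < s → s < e.2.2 → h (G.cell e.1 s) < t) := by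
    rw [← ncard_eq_sum_truth]
    simp only [mem_openCurvesFinset]
  rw [e1, ncard_eq_sum_truth, G.sum_points hVB,
    Finset.sum_congr rfl fun e he => hbelow e (G.mem_openCurvesFinset.1 he), ← Finset.mul_sum,
    G.sum_openCurves_ends hVB (fun l s => truth (∀ᶠ r in 𝓝[>] s, h (G.cell l r) < t))
      (fun l s => truth (∀ᶠ r in 𝓝[<] s, h (G.cell l r) < t)),
    Finset.sum_congr rfl fun l _ => Finset.sum_congr rfl fun s hs => truth_of (hinner hs).le,
    Finset.sum_congr rfl fun l _ => congrArg₂ (· + ·)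
      (hend _ l 0 nhdsWithin_le_nhds (h0 l)) (hend _ l 1 nhdsWithin_le_nhds (h1 l)),
    Finset.sum_congr (g := fun l => ∑ s ∈ G.innerParams B l, (1 : ℝ)) rfl fun l _ =>
      Finset.sum_congr rfl fun s hs => hcross l s (G.mem_innerParams.1 hs).2.1
        (G.mem_innerParams.1 hs).2.2 (hinner hs), endCount]
  simp only [Finset.sum_const, nsmul_eq_mul, mul_one]
  ring

/-- The number of times a function takes the value `t` on an open curve; it is `0` by convention if
this is infinite. -/
def crossings (h : G.Space → ℝ) (e : Λ × I × I) (t : ℝ) : ℕ :=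
  {s | e.2.1 < s ∧ s < e.2.2 ∧ h (G.cell e.1 s) = t}.ncard

lemma sum_card_innerParams_eq {A B : Finset G.Space} (hA : ∀ x, G.vertex x ∈ A)
    (hAt : ∀ z ∈ A, h z ≠ t) (hB : ∀ z, z ∈ B ↔ z ∈ range G.vertex ∨ h z = t) :
    ∑ l, ((G.innerParams B l).card : ℝ) =
      ∑ e ∈ G.openCurvesFinset A, (crossings h e t : ℝ) := by
  have hinner {l : Λ} {s : I} : s ∈ G.innerParams B l ↔ h (G.cell l s) = t := by
    rw [G.mem_innerParams, hB]
    constructor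
    · rintro ⟨⟨x, hx⟩ | h1, h2, h3⟩
      · exact absurd hx (G.vertex_ne_cell h2 h3)
      · exact h1
    · intro h1
      refine ⟨Or.inr h1, unitInterval.pos_iff_ne_zero.2 ?_, unitInterval.lt_one_iff_ne_one.2 ?_⟩
      · rintro rfl
        exact hAt _ (hA _) (G.cell_zero l ▸ h1)
      · rintro rfl
        exact hAt _ (hA _) (G.cell_one l ▸ h1)
  have e1 (l : Λ) : ((G.innerParams B l).card : ℝ) = ∑ s ∈ G.innerParams B l,
      ∑ e ∈ G.openCurvesFinset A, truth (e.1 = l ∧ e.2.1 < s ∧ s < e.2.2) := by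
    rw [Finset.cast_card]
    refine Finset.sum_congr rfl fun s hs => ?_
    obtain ⟨p, q, hp, hq, he⟩ := G.exists_openCurve hA (l := l) (s := s)
      fun h1 => hAt _ h1 (hinner.1 hs)
    rw [Finset.sum_eq_single_of_mem (l, p, q) (G.mem_openCurvesFinset.2 he),
      truth_of ⟨rfl, hp, hq⟩]
    rintro e he' hne
    refine truth_of_not ?_
    rintro ⟨h1, h2, h3⟩
    exact hne ((G.isArcSystem_openCurves A).eq_of_mem (G.mem_openCurvesFinset.1 he') he h1 h2 h3
      hp hq)
  rw [Finset.sum_congr rfl fun l _ => (e1 l).trans Finset.sum_comm, Finset.sum_comm]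
  refine Finset.sum_congr rfl fun e _ => ?_
  rw [Finset.sum_eq_single_of_mem e.1 (Finset.mem_univ _), ← ncard_eq_sum_truth, crossings]
  · congr 2
    ext s
    simp only [mem_ofPred_eq, hinner, true_and]
    tauto
  · intro l _ hne
    exact Finset.sum_eq_zero fun s _ => truth_of_not fun H => hne H.1.symm

/-- The error made by replacing a function by its piecewise linear interpolation on `A`: at a
regular value `t`, twice the difference of the Euler characteristics of the sublevel sets is the
number of times the function takes the value `t` minus the number of times that the interpolation
does. -/
theorem exists_eulerCharacteristic_sublevel_sub [Finite V] (hh : Continuous h) {A : Finset G.Space}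
    (hA : ∀ x, G.vertex x ∈ A) (hAt : ∀ z ∈ A, h z ≠ t) (hfin : {z | h z = t}.Finite)
    (hcross : ∀ l s, 0 < s → s < 1 → h (G.cell l s) = t →
      truth (∀ᶠ r in 𝓝[>] s, h (G.cell l r) < t) + truth (∀ᶠ r in 𝓝[<] s, h (G.cell l r) < t) = 1) :
    ∃ m : ℤ, eulerCharacteristic {z | h z ≤ t} = (m : WithTop ℤ) ∧
      2 * ((m : ℝ) - ((({b | b ∈ A ∧ h b ≤ t}.ncard : ℕ) : ℝ) - (({e | e ∈ G.openCurves A ∧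
        max (h (G.cell e.1 e.2.1)) (h (G.cell e.1 e.2.2)) ≤ t}.ncard : ℕ) : ℝ))) =
      ∑ e ∈ G.openCurvesFinset A, ((crossings h e t : ℝ) -
        truth (min (h (G.cell e.1 e.2.1)) (h (G.cell e.1 e.2.2)) ≤ t ∧
          t < max (h (G.cell e.1 e.2.1)) (h (G.cell e.1 e.2.2)))) := by
  have := Fintype.ofFinite V
  have hB (z : G.Space) : z ∈ ((finite_range G.vertex).union hfin).toFinset ↔
      z ∈ range G.vertex ∨ h z = t := by simp
  obtain ⟨m, hm, hm'⟩ := exists_eulerCharacteristic_sublevel hh hB (fun x => hAt _ (hA x)) hcross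
  refine ⟨m, hm, ?_⟩
  rw [G.ncard_sub_ncard_eq hA, hm', sum_card_innerParams_eq hA hAt hB, Finset.sum_sub_distrib]
  ring

end OneComplex

/-! ### The number of preimages of a value of a differentiable function -/

section Banach

/-- The number of times the function `g` takes the value `t` on the open interval `(p, q)`, which
may be infinite. -/
def preimageCount (g : ℝ → ℝ) (p q t : ℝ) : ℝ≥0∞ := Measure.count {s | s ∈ Ioo p q ∧ g s = t}

variable {g g' : ℝ → ℝ} {p q : ℝ}

/-- The set of critical values of a differentiable function has measure zero. -/
lemma volume_image_critical (hg : ∀ s ∈ Ioo p q, HasDerivAt g (g' s) s) :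
    volume (g '' {s | s ∈ Ioo p q ∧ g' s = 0}) = 0 := by
  refine addHaar_image_eq_zero_of_det_fderivWithin_eq_zero volume
    (f' := fun s => ContinuousLinearMap.toSpanSingleton ℝ (g' s))
    (fun s hs => (hg s hs.1).hasDerivWithinAt.hasFDerivWithinAt) fun s hs => ?_
  rw [ContinuousLinearMap.det_toSpanSingleton, hs.2]

/-- Rolle's theorem: a function without interior critical points is injective. -/
lemma injOn_of_hasDerivAt_ne_zero {s : Set ℝ} (hs : s.OrdConnected)
    (hg : ContinuousOn g s) (hg' : ∀ x ∈ interior s, HasDerivAt g (g' x) x)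
    (h0 : ∀ x ∈ interior s, g' x ≠ 0) : InjOn g s := by
  have key {x y : ℝ} (hx : x ∈ s) (hy : y ∈ s) (hxy : x < y) : g x ≠ g y := by
    intro heq
    have hsub : Icc x y ⊆ s := hs.out hx hy
    have hint : Ioo x y ⊆ interior s :=
      isOpen_Ioo.subset_interior_iff.2 (Ioo_subset_Icc_self.trans hsub)
    obtain ⟨c, hc, hc0⟩ := exists_hasDerivAt_eq_zero hxy (hg.mono hsub) heq
      fun z hz => hg' z (hint hz)
    exact h0 c (hint hc) hc0
  intro x hx y hy heq
  rcases lt_trichotomy x y with h | h | h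
  · exact absurd heq (key hx hy h)
  · exact h
  · exact absurd heq.symm (key hy hx h)

/-- The regular points of a `C¹` function on an interval are covered by countably many disjoint
measurable sets on which the function is injective. -/
lemma exists_injOn_cover (hg : ∀ s ∈ Ioo p q, HasDerivAt g (g' s) s)
    (hg' : ContinuousOn g' (Ioo p q)) :
    ∃ S : ℕ → Set ℝ, (∀ n, MeasurableSet (S n)) ∧ Pairwise (Function.onFun Disjoint S) ∧
      (∀ n, InjOn g (S n)) ∧ ⋃ n, S n = {s | s ∈ Ioo p q ∧ g' s ≠ 0} := by
  classical
  set R : Set ℝ := {s | s ∈ Ioo p q ∧ g' s ≠ 0} with hR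
  have hRo : IsOpen R := hg'.isOpen_inter_preimage isOpen_Ioo isOpen_compl_singleton
  let U (x : ℚ × ℚ) : Set ℝ := if Ioo (x.1 : ℝ) x.2 ⊆ R then Ioo (x.1 : ℝ) x.2 else ∅
  have hUR (x : ℚ × ℚ) : U x ⊆ R := by
    by_cases h : Ioo (x.1 : ℝ) x.2 ⊆ R <;> simp [U, h]
  have hUm (x : ℚ × ℚ) : MeasurableSet (U x) := by
    by_cases h : Ioo (x.1 : ℝ) x.2 ⊆ R <;> simp [U, h]
  have hUc (x : ℚ × ℚ) : (U x).OrdConnected := by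
    by_cases h : Ioo (x.1 : ℝ) x.2 ⊆ R <;> simp [U, h, ordConnected_Ioo, ordConnected_empty]
  have hUi (x : ℚ × ℚ) : InjOn g (U x) :=
    injOn_of_hasDerivAt_ne_zero (hUc x)
      (fun s hs => (hg s (hUR x hs).1).continuousAt.continuousWithinAt)
      (fun s hs => hg s (hUR x (interior_subset hs)).1) fun s hs => (hUR x (interior_subset hs)).2
  let T (n : ℕ) : Set ℝ := U ((Denumerable.eqv (ℚ × ℚ)).symm n)
  refine ⟨disjointed T, fun n => MeasurableSet.disjointed (fun k => hUm _) n, disjoint_disjointed T,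
    fun n => (hUi _).mono (disjointed_subset T n), ?_⟩
  rw [iUnion_disjointed]
  refine (iUnion_subset fun n => hUR _).antisymm fun s hs => ?_
  obtain ⟨I, hI, hsI, hIR⟩ := Real.isTopologicalBasis_Ioo_rat.exists_subset_of_mem_open hs hRo
  simp only [mem_iUnion, mem_singleton_iff] at hI
  obtain ⟨a, b, -, rfl⟩ := hI
  refine mem_iUnion.2 ⟨Denumerable.eqv (ℚ × ℚ) (a, b), ?_⟩
  simpa [T, U, hIR] using hsI

/-- **Banach indicatrix**: the number of preimages of `t` is a measurable function of `t`, whose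
integral is at most the total variation. -/
theorem lintegral_preimageCount_le (hg : ∀ s ∈ Ioo p q, HasDerivAt g (g' s) s)
    (hg' : ContinuousOn g' (Ioo p q)) :
    AEMeasurable (preimageCount g p q) ∧
      ∫⁻ t, preimageCount g p q t ≤ ∫⁻ s in Ioo p q, ENNReal.ofReal |g' s| := by
  obtain ⟨S, hSm, hSd, hSi, hSR⟩ := exists_injOn_cover hg hg'
  have hSsub (n : ℕ) : S n ⊆ {s | s ∈ Ioo p q ∧ g' s ≠ 0} := hSR ▸ subset_iUnion S n
  have hIm (n : ℕ) : MeasurableSet (g '' S n) :=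
    (hSm n).image_of_continuousOn_injOn
      (fun s hs => (hg s (hSsub n hs).1).continuousAt.continuousWithinAt) (hSi n)
  have hae : preimageCount g p q =ᵐ[volume]
      fun t => ∑' n, (g '' S n).indicator (1 : ℝ → ℝ≥0∞) t := by
    filter_upwards [measure_eq_zero_iff_ae_notMem.1 (volume_image_critical hg)] with t ht
    have hset : {s | s ∈ Ioo p q ∧ g s = t} = ⋃ n, {s | s ∈ S n ∧ g s = t} := by
      ext s
      simp only [mem_ofPred_eq, mem_iUnion]
      constructor
      · rintro ⟨hs, hst⟩
        have hmem : s ∈ ⋃ n, S n :=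
          hSR ▸ ⟨hs, fun h0 => ht ⟨s, ⟨hs, h0⟩, hst⟩⟩
        obtain ⟨n, hn⟩ := mem_iUnion.1 hmem
        exact ⟨n, hn, hst⟩
      · rintro ⟨n, hn, hst⟩
        exact ⟨(hSsub n hn).1, hst⟩
    have hsub (n : ℕ) : {s | s ∈ S n ∧ g s = t}.Subsingleton := fun x hx y hy =>
      hSi n hx.1 hy.1 (hx.2.trans hy.2.symm)
    rw [preimageCount, hset, measure_iUnion (fun i j hij => ?_) fun n => (hsub n).measurableSet]
    · refine tsum_congr fun n => ?_
      by_cases hn : t ∈ g '' S n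
      · obtain ⟨s, hs, hst⟩ := hn
        rw [indicator_of_mem (mem_image_of_mem g hs |> hst.subst),
          (hsub n).eq_singleton_of_mem ⟨hs, hst⟩]
        simp
      · have : {s | s ∈ S n ∧ g s = t} = ∅ :=
          eq_empty_of_forall_notMem fun s hs => hn ⟨s, hs⟩
        rw [this, indicator_of_notMem hn, measure_empty]
    · exact (hSd hij).mono (fun _ h => h.1) fun _ h => h.1
  have hmeas (n : ℕ) : Measurable ((g '' S n).indicator (1 : ℝ → ℝ≥0∞)) :=
    measurable_one.indicator (hIm n)
  refine ⟨⟨_, Measurable.tsum hmeas, hae⟩, ?_⟩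
  rw [lintegral_congr_ae hae, lintegral_tsum fun n => (hmeas n).aemeasurable]
  calc ∑' n, ∫⁻ t, (g '' S n).indicator (1 : ℝ → ℝ≥0∞) t
      = ∑' n, ∫⁻ s in S n, ENNReal.ofReal |g' s| := by
        refine tsum_congr fun n => ?_
        have := lintegral_image_eq_lintegral_abs_deriv_mul (hSm n)
          (fun s hs => (hg s (hSsub n hs).1).hasDerivWithinAt) (hSi n) 1
        rw [lintegral_indicator (hIm n), this]
        simp
    _ = ∫⁻ s in ⋃ n, S n, ENNReal.ofReal |g' s| := (lintegral_iUnion hSm hSd _).symm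
    _ ≤ ∫⁻ s in Ioo p q, ENNReal.ofReal |g' s| :=
        lintegral_mono_set (hSR ▸ fun _ h => h.1)

/-- The number `1` if `t` lies between the two numbers `a` and `b`, and `0` otherwise. -/
def between (a b t : ℝ) : ℝ≥0∞ := (Ico (min a b) (max a b)).indicator 1 t

/-- On an interval without interior critical points a function takes each value other than those at
the ends at most once, and only if it lies between the values at the ends. -/
lemma preimageCount_le_between (hpq : p ≤ q) (hgc : ContinuousOn g (Icc p q))
    (hg : ∀ s ∈ Ioo p q, HasDerivAt g (g' s) s) (h0 : ∀ s ∈ Ioo p q, g' s ≠ 0) (t : ℝ) :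
    preimageCount g p q t ≤ between (g p) (g q) t := by
  have hinj : InjOn g (Icc p q) := by
    refine injOn_of_hasDerivAt_ne_zero (g' := g') ordConnected_Icc hgc ?_ ?_ <;>
      rwa [interior_Icc]
  by_cases hne : ∃ s, s ∈ Ioo p q ∧ g s = t
  · obtain ⟨s, hs, hst⟩ := hne
    have hset : {s | s ∈ Ioo p q ∧ g s = t} = {s} :=
      eq_singleton_iff_unique_mem.2 ⟨⟨hs, hst⟩, fun r hr =>
        hinj (Ioo_subset_Icc_self hr.1) (Ioo_subset_Icc_self hs) (hr.2.trans hst.symm)⟩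
    have hp : p ∈ Icc p q := left_mem_Icc.2 hpq
    have hq : q ∈ Icc p q := right_mem_Icc.2 hpq
    have hs' := Ioo_subset_Icc_self hs
    have hmem : t ∈ Ico (min (g p) (g q)) (max (g p) (g q)) := by
      rw [← hst]
      rcases hgc.strictMonoOn_of_injOn_Icc' hpq hinj with h | h
      · exact ⟨min_le_of_left_le (h hp hs' hs.1).le, lt_max_of_lt_right (h hs' hq hs.2)⟩
      · exact ⟨min_le_of_right_le (h hs' hq hs.2).le, lt_max_of_lt_left (h hp hs' hs.1)⟩
    rw [preimageCount, hset, between, indicator_of_mem hmem]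
    simp
  · have hset : {s | s ∈ Ioo p q ∧ g s = t} = ∅ :=
      eq_empty_of_forall_notMem fun s hs => hne ⟨s, hs⟩
    rw [preimageCount, hset, measure_empty]
    exact zero_le

/-- The number of preimages in excess of those that the values at the ends enforce is controlled by
the total variation, and only matters if there is an interior critical point. -/
lemma lintegral_preimageCount_sub_between_le (hpq : p ≤ q) (hgc : ContinuousOn g (Icc p q))
    (hg : ∀ s ∈ Ioo p q, HasDerivAt g (g' s) s) (hg' : ContinuousOn g' (Ioo p q)) {C : ℝ≥0∞}
    (hC : ∀ s ∈ Ioo p q, g' s = 0 → ∫⁻ r in Ioo p q, ENNReal.ofReal |g' r| ≤ C) :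
    ∫⁻ t, (preimageCount g p q t - between (g p) (g q) t) ≤ C := by
  by_cases h0 : ∃ s ∈ Ioo p q, g' s = 0
  · obtain ⟨s, hs, hs0⟩ := h0
    exact ((lintegral_mono fun t => tsub_le_self).trans
      (lintegral_preimageCount_le hg hg').2).trans (hC s hs hs0)
  · push Not at h0
    simp [tsub_eq_zero_of_le (preimageCount_le_between hpq hgc hg h0 _)]

end Banach

/-! ### The variation of a linear function along a curve of bounded curvature -/

section Curves

variable {d : ℕ} {γ : ℝ → EuclideanSpace ℝ (Fin d)}

lemma continuousOn_velocity (hγ : ContDiffOn ℝ 2 γ (Icc 0 1)) :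
    ContinuousOn (velocity γ) (Icc 0 1) :=
  hγ.continuousOn_derivWithin (uniqueDiffOn_Icc zero_lt_one) (by norm_num)

lemma hasDerivAt_velocity (hγ : ContDiffOn ℝ 2 γ (Icc 0 1)) {s : ℝ} (hs : s ∈ Ioo (0 : ℝ) 1) :
    HasDerivAt γ (velocity γ s) s :=
  ((hγ.differentiableOn (by norm_num) s (Ioo_subset_Icc_self hs)).hasDerivWithinAt).hasDerivAt
    (Icc_mem_nhds hs.1 hs.2)

lemma differentiableOn_unitTangent (hγ : ContDiffOn ℝ 2 γ (Icc 0 1))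
    (h0 : ∀ s ∈ Icc (0 : ℝ) 1, velocity γ s ≠ 0) :
    DifferentiableOn ℝ (unitTangent γ) (Icc 0 1) := by
  have hv : ContDiffOn ℝ 1 (velocity γ) (Icc 0 1) :=
    hγ.derivWithin (uniqueDiffOn_Icc zero_lt_one) (by norm_num)
  exact (((hv.norm ℝ h0).inv fun s hs => norm_ne_zero_iff.2 (h0 s hs)).smul hv).differentiableOn
    (by norm_num)

/-- The arc length parameter of a curve: a differentiable function on the line whose derivative on
`[0,1]` is the speed. -/
lemma exists_arcLength_parameter (hγ : ContDiffOn ℝ 2 γ (Icc 0 1)) :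
    ∃ ℓ w : ℝ → ℝ, Continuous w ∧ (∀ s, 0 ≤ w s) ∧ (∀ s, HasDerivAt ℓ (w s) s) ∧
      (∀ s ∈ Icc (0 : ℝ) 1, w s = ‖velocity γ s‖) ∧
      ∀ p q, 0 ≤ p → p ≤ q → q ≤ 1 → arcLength γ p q = ℓ q - ℓ p := by
  have hc : Continuous
      (IccExtend zero_le_one ((Icc (0 : ℝ) 1).domRestrict fun s => ‖velocity γ s‖)) :=
    (continuousOn_iff_continuous_domRestrict.1 (continuousOn_velocity hγ).norm).Icc_extend'
  have heq (s : ℝ) (hs : s ∈ Icc (0 : ℝ) 1) :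
      IccExtend zero_le_one ((Icc (0 : ℝ) 1).domRestrict fun s => ‖velocity γ s‖) s =
        ‖velocity γ s‖ := IccExtend_of_mem _ _ hs
  refine ⟨fun s => ∫ r in (0 : ℝ)..s, _, _, hc, fun s => norm_nonneg _,
    fun s => (hc.integral_hasStrictDerivAt 0 s).hasDerivAt, heq, fun p q hp hpq hq => ?_⟩
  rw [intervalIntegral.integral_interval_sub_left (hc.intervalIntegrable _ _)
    (hc.intervalIntegrable _ _)]
  refine intervalIntegral.integral_congr fun s hs => (heq s ?_).symm
  rw [uIcc_of_le hpq] at hs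
  exact ⟨hp.trans hs.1, hs.2.trans hq⟩

/-- A function whose derivative is bounded by `M` times that of `ℓ` has increments bounded by `M`
times those of `ℓ`. -/
lemma abs_sub_le_of_abs_deriv_le {φ φ' ℓ w : ℝ → ℝ} {M p q : ℝ} (hφc : ContinuousOn φ (Icc p q))
    (hφ : ∀ s ∈ Ioo p q, HasDerivAt φ (φ' s) s) (hℓ : ∀ s, HasDerivAt ℓ (w s) s)
    (hle : ∀ s ∈ Ioo p q, |φ' s| ≤ M * w s) {x y : ℝ} (hx : x ∈ Icc p q) (hy : y ∈ Icc p q)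
    (hxy : x ≤ y) : |φ y - φ x| ≤ M * (ℓ y - ℓ x) := by
  have hℓc : ContinuousOn ℓ (Icc p q) := fun s _ => (hℓ s).continuousAt.continuousWithinAt
  have h1 : MonotoneOn (fun s => M * ℓ s - φ s) (Icc p q) := by
    refine monotoneOn_of_hasDerivWithinAt_nonneg (f' := fun s => M * w s - φ' s) (convex_Icc p q)
      ((continuousOn_const.mul hℓc).sub hφc) ?_ ?_ <;> rw [interior_Icc] <;> intro s hs
    · exact (((hℓ s).const_mul M).sub (hφ s hs)).hasDerivWithinAt
    · linarith [(abs_le.1 (hle s hs)).2]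
  have h2 : MonotoneOn (fun s => M * ℓ s + φ s) (Icc p q) := by
    refine monotoneOn_of_hasDerivWithinAt_nonneg (f' := fun s => M * w s + φ' s) (convex_Icc p q)
      ((continuousOn_const.mul hℓc).add hφc) ?_ ?_ <;> rw [interior_Icc] <;> intro s hs
    · exact (((hℓ s).const_mul M).add (hφ s hs)).hasDerivWithinAt
    · linarith [(abs_le.1 (hle s hs)).1]
  have a1 := h1 hx hy hxy
  have a2 := h2 hx hy hxy
  simp only at a1 a2
  rw [abs_le]
  constructor <;> linarith

/-- The integral of `w |ℓ - ℓ s₀|`, where `w ≥ 0` is the derivative of `ℓ`. -/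
lemma lintegral_mul_abs_sub_le {ℓ w : ℝ → ℝ} (hw : Continuous w) (hw0 : ∀ s, 0 ≤ w s)
    (hℓ : ∀ s, HasDerivAt ℓ (w s) s) {M p q s₀ : ℝ} (hM : 0 ≤ M) (hs₀ : s₀ ∈ Ioo p q) :
    ∫⁻ s in Ioo p q, ENNReal.ofReal (M * (w s * |ℓ s - ℓ s₀|)) ≤
      ENNReal.ofReal (M * (ℓ q - ℓ p) ^ 2 / 2) := by
  have hℓc : Continuous ℓ := continuous_iff_continuousAt.2 fun s => (hℓ s).continuousAt
  have hmono : Monotone ℓ := monotone_of_hasDerivAt_nonneg hℓ hw0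
  have hc : Continuous fun s => M * (w s * |ℓ s - ℓ s₀|) := by fun_prop
  have hint (x y : ℝ) : ∫ s in x..y, M * (w s * (ℓ s - ℓ s₀)) =
      M * (ℓ y - ℓ s₀) ^ 2 / 2 - M * (ℓ x - ℓ s₀) ^ 2 / 2 := by
    refine intervalIntegral.integral_eq_sub_of_hasDerivAt
      (f := fun s => M * (ℓ s - ℓ s₀) ^ 2 / 2) (fun s _ => ?_)
      (Continuous.intervalIntegrable (by fun_prop) _ _)
    refine (((((hℓ s).sub_const (ℓ s₀)).pow 2).const_mul M).div_const 2).congr_deriv ?_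
    push_cast
    ring
  have h1 : ∫ s in p..s₀, M * (w s * |ℓ s - ℓ s₀|) = M * (ℓ p - ℓ s₀) ^ 2 / 2 := by
    have : ∫ s in p..s₀, M * (w s * |ℓ s - ℓ s₀|) = ∫ s in p..s₀, -(M * (w s * (ℓ s - ℓ s₀))) := by
      refine intervalIntegral.integral_congr fun s hs => ?_
      rw [uIcc_of_le hs₀.1.le] at hs
      simp only [abs_of_nonpos (sub_nonpos.2 (hmono hs.2))]
      ring
    rw [this, intervalIntegral.integral_neg, hint]
    ring
  have h2 : ∫ s in s₀..q, M * (w s * |ℓ s - ℓ s₀|) = M * (ℓ q - ℓ s₀) ^ 2 / 2 := by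
    have : ∫ s in s₀..q, M * (w s * |ℓ s - ℓ s₀|) = ∫ s in s₀..q, M * (w s * (ℓ s - ℓ s₀)) := by
      refine intervalIntegral.integral_congr fun s hs => ?_
      rw [uIcc_of_le hs₀.2.le] at hs
      simp only [abs_of_nonneg (sub_nonneg.2 (hmono hs.1))]
    rw [this, hint]
    ring
  rw [← ofReal_integral_eq_lintegral_ofReal, ← integral_Ioc_eq_integral_Ioo,
    ← intervalIntegral.integral_of_le (hs₀.1.trans hs₀.2).le,
    ← intervalIntegral.integral_add_adjacent_intervals (hc.intervalIntegrable _ s₀)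
      (hc.intervalIntegrable _ _), h1, h2]
  · refine ENNReal.ofReal_le_ofReal ?_
    have a1 := hmono hs₀.1.le
    have a2 := hmono hs₀.2.le
    nlinarith [mul_nonneg hM (mul_nonneg (sub_nonneg.2 a1) (sub_nonneg.2 a2))]
  · exact (hc.continuousOn.integrableOn_Icc (a := p) (b := q)).mono_set Ioo_subset_Icc_self
  · exact Filter.Eventually.of_forall fun s => mul_nonneg hM (mul_nonneg (hw0 s) (abs_nonneg _))

/-- A linear function with a critical point on an arc of length `ℓ` of a curve with curvature at
most `M` has variation at most `M ℓ² / 2` along the arc: by the curvature bound, the unit tangent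
vector has turned by at most `M u` at arc length distance `u` from the critical point. -/
theorem lintegral_abs_inner_velocity_le (hγ : ContDiffOn ℝ 2 γ (Icc 0 1)) {M : ℝ} (hM : 0 ≤ M)
    (hcurv : HasCurvatureLE γ M) {v : EuclideanSpace ℝ (Fin d)} (hv : ‖v‖ = 1) {p q s₀ : ℝ}
    (hp : 0 ≤ p) (hq : q ≤ 1) (hs₀ : s₀ ∈ Ioo p q) (hcrit : inner ℝ (velocity γ s₀) v = 0) :
    ∫⁻ s in Ioo p q, ENNReal.ofReal |inner ℝ (velocity γ s) v| ≤
      ENNReal.ofReal (M * arcLength γ p q ^ 2 / 2) := by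
  obtain ⟨ℓ, w, hwc, hw0, hℓ, hw, hlen⟩ := exists_arcLength_parameter hγ
  have hT := differentiableOn_unitTangent hγ fun s hs => (hcurv s hs).1
  have hsub : Icc p q ⊆ Icc (0 : ℝ) 1 := Icc_subset_Icc hp hq
  have hsub' : Ioo p q ⊆ Ioo (0 : ℝ) 1 := Ioo_subset_Ioo hp hq
  have hinc {x y : ℝ} (hx : x ∈ Icc p q) (hy : y ∈ Icc p q) (hxy : x ≤ y) :
      |inner ℝ (unitTangent γ y) v - inner ℝ (unitTangent γ x) v| ≤ M * (ℓ y - ℓ x) := by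
    refine abs_sub_le_of_abs_deriv_le (φ := fun s => inner ℝ (unitTangent γ s) v)
      (φ' := fun s => inner ℝ (derivWithin (unitTangent γ) (Icc 0 1) s) v)
      ((hT.continuousOn.mono hsub).inner continuousOn_const) (fun s hs => ?_) hℓ (fun s hs => ?_)
      hx hy hxy
    · have := ((hT s (Ioo_subset_Icc_self (hsub' hs))).hasDerivWithinAt.hasDerivAt
        (Icc_mem_nhds (hsub' hs).1 (hsub' hs).2)).inner ℝ (hasDerivAt_const s v)
      simpa using this
    · have hs' := Ioo_subset_Icc_self (hsub' hs)
      have h1 := (hcurv s hs').2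
      rw [curvature, div_le_iff₀ (norm_pos_iff.2 (hcurv s hs').1)] at h1
      rw [hw s hs']
      calc |inner ℝ (derivWithin (unitTangent γ) (Icc 0 1) s) v|
          ≤ ‖derivWithin (unitTangent γ) (Icc 0 1) s‖ * ‖v‖ := abs_real_inner_le_norm _ _
        _ ≤ M * ‖velocity γ s‖ := by rwa [hv, mul_one]
  have hvel {s : ℝ} (hs : s ∈ Icc (0 : ℝ) 1) :
      inner ℝ (velocity γ s) v = w s * inner ℝ (unitTangent γ s) v := by
    rw [hw s hs, unitTangent, real_inner_smul_left, mul_inv_cancel_left₀]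
    exact norm_ne_zero_iff.2 (hcurv s hs).1
  have hcrit' : inner ℝ (unitTangent γ s₀) v = 0 := by
    rw [unitTangent, real_inner_smul_left, hcrit, mul_zero]
  have hmono : Monotone ℓ := monotone_of_hasDerivAt_nonneg hℓ hw0
  rw [hlen p q hp (hs₀.1.trans hs₀.2).le hq]
  refine (setLIntegral_mono' measurableSet_Ioo fun s hs => ?_).trans
    (lintegral_mul_abs_sub_le hwc hw0 hℓ hM hs₀)
  refine ENNReal.ofReal_le_ofReal ?_
  rw [hvel (hsub (Ioo_subset_Icc_self hs)), abs_mul, abs_of_nonneg (hw0 s), mul_left_comm]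
  refine mul_le_mul_of_nonneg_left ?_ (hw0 s)
  rcases le_total s₀ s with hle | hle
  · have := hinc (Ioo_subset_Icc_self hs₀) (Ioo_subset_Icc_self hs) hle
    rwa [hcrit', sub_zero, ← abs_of_nonneg (sub_nonneg.2 (hmono hle))] at this
  · have := hinc (Ioo_subset_Icc_self hs) (Ioo_subset_Icc_self hs₀) hle
    rwa [hcrit', zero_sub, abs_neg, ← abs_of_nonneg (sub_nonneg.2 (hmono hle)), abs_sub_comm]
      at this

end Curves

/-! ### Regular values of height functions and the error of the interpolation -/

lemma HasDerivAt.eventually_lt_lt {g : ℝ → ℝ} {c s : ℝ} (hg : HasDerivAt g c s) (hc : 0 < c) :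
    (∀ᶠ r in nhdsWithin s (Ioi s), g s < g r) ∧ ∀ᶠ r in nhdsWithin s (Iio s), g r < g s := by
  have h := (hasDerivAt_iff_tendsto_slope.1 hg).eventually_const_lt hc
  constructor
  · filter_upwards [h.filter_mono (nhdsWithin_mono _ fun r hr => ne_of_gt hr), self_mem_nhdsWithin]
      with r hr hsr
    rw [slope_def_field, div_pos_iff_of_pos_right (sub_pos.2 hsr)] at hr
    exact sub_pos.1 hr
  · filter_upwards [h.filter_mono (nhdsWithin_mono _ fun r hr => ne_of_lt hr), self_mem_nhdsWithin]
      with r hr hsr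
    rw [slope_def_field, ← neg_div_neg_eq, neg_sub, neg_sub,
      div_pos_iff_of_pos_right (sub_pos.2 hsr)] at hr
    exact sub_pos.1 hr

lemma extAbs_coe (n : ℤ) : extAbs (n : WithTop ℤ) = ENNReal.ofReal |(n : ℝ)| := by
  change ((n.natAbs : ℕ) : ℝ≥0∞) = _
  rw [← ENNReal.ofReal_natCast, Nat.cast_natAbs, Int.cast_abs]

namespace OneComplex

open unitInterval Filter Topology

variable {V Λ : Type} {G : OneComplex V Λ} {d : ℕ} {f : G.Space → EuclideanSpace ℝ (Fin d)}
  {v : EuclideanSpace ℝ (Fin d)}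

@[simp] lemma edgeCurve_coe (l : Λ) (s : I) : G.edgeCurve f l s = f (G.cell l s) :=
  IccExtend_val _ _ _

variable (f v) in
/-- The height `⟨f z, v⟩` along the `l`-th 1-cell. -/
def edgeHeight (l : Λ) (s : ℝ) : ℝ := inner ℝ (G.edgeCurve f l s) v

@[simp] lemma edgeHeight_coe (l : Λ) (s : I) :
    edgeHeight f v l s = inner ℝ (f (G.cell l s)) v := by
  rw [edgeHeight, edgeCurve_coe]

variable (f v) in
/-- The derivative of the height along the `l`-th 1-cell. -/
def edgeSlope (l : Λ) (s : ℝ) : ℝ := inner ℝ (velocity (G.edgeCurve f l) s) v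

lemma hasDerivAt_edgeHeight (hf : G.IsCrMap 2 f) (l : Λ) {s : ℝ} (hs : s ∈ Ioo (0 : ℝ) 1) :
    HasDerivAt (edgeHeight f v l) (edgeSlope f v l s) s := by
  have := (hasDerivAt_velocity (hf.2 l) hs).inner ℝ (hasDerivAt_const s v)
  simp only [inner_zero_right, zero_add] at this
  exact this

lemma continuousOn_edgeSlope (hf : G.IsCrMap 2 f) (l : Λ) :
    ContinuousOn (edgeSlope f v l) (Icc 0 1) :=
  (continuousOn_velocity (hf.2 l)).inner continuousOn_const

lemma continuousOn_edgeHeight (hf : G.IsCrMap 2 f) (l : Λ) :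
    ContinuousOn (edgeHeight f v l) (Icc 0 1) :=
  (hf.2 l).continuousOn.inner continuousOn_const

/-- At a regular point, the height is below its value on exactly one side. -/
lemma truth_add_truth_eq_one (hf : G.IsCrMap 2 f) {l : Λ} {s : I} (h0 : 0 < s) (h1 : s < 1)
    (hs : edgeSlope f v l s ≠ 0) {t : ℝ} (ht : inner ℝ (f (G.cell l s)) v = t) :
    truth (∀ᶠ r in 𝓝[>] s, inner ℝ (f (G.cell l r)) v < t) +
      truth (∀ᶠ r in 𝓝[<] s, inner ℝ (f (G.cell l r)) v < t) = 1 := by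
  have hd : HasDerivAt (edgeHeight f v l) (edgeSlope f v l s) s :=
    hasDerivAt_edgeHeight hf l ⟨h0, h1⟩
  have hR : Tendsto (Subtype.val : I → ℝ) (𝓝[>] s) (𝓝[>] (s : ℝ)) :=
    continuous_subtype_val.continuousWithinAt.tendsto_nhdsWithin fun r hr => hr
  have hL : Tendsto (Subtype.val : I → ℝ) (𝓝[<] s) (𝓝[<] (s : ℝ)) :=
    continuous_subtype_val.continuousWithinAt.tendsto_nhdsWithin fun r hr => hr
  have : (𝓝[>] s).NeBot := nhdsGT_neBot_of_exists_gt ⟨1, h1⟩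
  have : (𝓝[<] s).NeBot := nhdsLT_neBot_of_exists_lt ⟨0, h0⟩
  have hnot {F : Filter I} [F.NeBot] (hF : ∀ᶠ r in F, t < inner ℝ (f (G.cell l r)) v) :
      ¬ ∀ᶠ r in F, inner ℝ (f (G.cell l r)) v < t := fun H => by
    obtain ⟨r, hr, hr'⟩ := (hF.and H).exists
    exact lt_asymm hr hr'
  rcases lt_or_gt_of_ne hs with hlt | hgt
  · obtain ⟨hr, hl⟩ := hd.neg.eventually_lt_lt (neg_pos.2 hlt)
    have hr' := hR.eventually hr
    have hl' := hL.eventually hl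
    simp only [Pi.neg_apply, neg_lt_neg_iff, edgeHeight_coe, ht] at hr' hl'
    rw [truth_of hr', truth_of_not (hnot hl'), add_zero]
  · obtain ⟨hr, hl⟩ := hd.eventually_lt_lt hgt
    have hr' := hR.eventually hr
    have hl' := hL.eventually hl
    simp only [edgeHeight_coe, ht] at hr' hl'
    rw [truth_of hl', truth_of_not (hnot hr'), zero_add]

lemma preimageCount_edgeHeight_eq {e : Λ × I × I} {t : ℝ}
    (hfin : {z | inner ℝ (f z) v = t}.Finite) :
    preimageCount (edgeHeight f v e.1) e.2.1 e.2.2 t =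
      (crossings (fun z => inner ℝ (f z) v) e t : ℝ≥0∞) := by
  have hset : {s : ℝ | s ∈ Ioo (e.2.1 : ℝ) e.2.2 ∧ edgeHeight f v e.1 s = t} = Subtype.val ''
      {s : I | e.2.1 < s ∧ s < e.2.2 ∧ inner ℝ (f (G.cell e.1 s)) v = t} := by
    ext s
    constructor
    · rintro ⟨⟨h1, h2⟩, h3⟩
      lift s to I using ⟨e.2.1.2.1.trans h1.le, h2.le.trans e.2.2.2.2⟩
      exact ⟨s, ⟨h1, h2, by rwa [edgeHeight_coe] at h3⟩, rfl⟩
    · rintro ⟨s, ⟨h1, h2, h3⟩, rfl⟩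
      exact ⟨⟨h1, h2⟩, by rwa [edgeHeight_coe]⟩
  have hfin' : {s : I | e.2.1 < s ∧ s < e.2.2 ∧ inner ℝ (f (G.cell e.1 s)) v = t}.Finite :=
    (G.finite_params hfin e.1).subset fun s hs => hs.2.2
  rw [preimageCount, hset, Measure.count_apply (hfin'.image _).measurableSet,
    Subtype.val_injective.encard_image, ← hfin'.cast_ncard_eq, crossings]
  rfl

/-- By the intermediate value theorem, values between those at the ends are attained. -/
lemma truth_le_crossings {h : G.Space → ℝ} (hh : Continuous h) {t : ℝ}
    (hfin : {z | h z = t}.Finite) {e : Λ × I × I} (he : e.2.1 < e.2.2)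
    (hp : h (G.cell e.1 e.2.1) ≠ t) (hq : h (G.cell e.1 e.2.2) ≠ t) :
    truth (min (h (G.cell e.1 e.2.1)) (h (G.cell e.1 e.2.2)) ≤ t ∧
      t < max (h (G.cell e.1 e.2.1)) (h (G.cell e.1 e.2.2))) ≤ crossings h e t := by
  obtain ⟨l, p, q⟩ := e
  by_cases hbtw : min (h (G.cell l p)) (h (G.cell l q)) ≤ t ∧
      t < max (h (G.cell l p)) (h (G.cell l q))
  · have hc : ContinuousOn (fun s => h (G.cell l s)) (Icc p q) :=
      (hh.comp (G.continuous_cell l)).continuousOn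
    have hs : ∃ s ∈ Ioo p q, h (G.cell l s) = t := by
      rcases le_total (h (G.cell l p)) (h (G.cell l q)) with hle | hle
      · rw [min_eq_left hle, max_eq_right hle] at hbtw
        exact intermediate_value_Ioo he.le hc ⟨lt_of_le_of_ne hbtw.1 hp, hbtw.2⟩
      · rw [min_eq_right hle, max_eq_left hle] at hbtw
        exact intermediate_value_Ioo' he.le hc ⟨lt_of_le_of_ne hbtw.1 hq, hbtw.2⟩
    obtain ⟨s, ⟨h1, h2⟩, h3⟩ := hs
    have hpos : 0 < crossings h (l, p, q) t :=
      (ncard_pos ((G.finite_params hfin l).subset fun s hs => hs.2.2)).2 ⟨s, h1, h2, h3⟩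
    rw [truth_of hbtw]
    exact_mod_cast hpos
  · rw [truth_of_not hbtw]
    exact Nat.cast_nonneg _

lemma ofReal_truth_between (a b t : ℝ) :
    ENNReal.ofReal (truth (min a b ≤ t ∧ t < max a b)) = between a b t := by
  by_cases h : t ∈ Ico (min a b) (max a b)
  · rw [between, indicator_of_mem h, truth_of (P := _ ∧ _) h]
    simp
  · rw [between, indicator_of_notMem h, truth_of_not (P := _ ∧ _) h]
    simp

variable (f v) in
/-- The number of times the height takes the value `t` on an open curve, in excess of the number of
times that its linear interpolation does. Almost everywhere the truncated subtraction is a true one,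
by `truth_le_crossings`. -/
def excess (e : Λ × I × I) (t : ℝ) : ℝ≥0∞ :=
  preimageCount (edgeHeight f v e.1) e.2.1 e.2.2 t -
    between (edgeHeight f v e.1 e.2.1) (edgeHeight f v e.1 e.2.2) t

lemma Ioo_subset_Ioo_zero_one (p q : I) : Ioo (p : ℝ) q ⊆ Ioo 0 1 :=
  Ioo_subset_Ioo p.2.1 q.2.2

lemma aemeasurable_excess (hf : G.IsCrMap 2 f) (e : Λ × I × I) : AEMeasurable (excess f v e) := by
  refine AEMeasurable.sub ?_ (measurable_one.indicator measurableSet_Ico).aemeasurable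
  exact (lintegral_preimageCount_le
    (fun _ hs => hasDerivAt_edgeHeight hf e.1 (Ioo_subset_Ioo_zero_one _ _ hs))
    ((continuousOn_edgeSlope hf e.1).mono
      ((Ioo_subset_Ioo_zero_one _ _).trans Ioo_subset_Icc_self))).1

lemma lintegral_excess_le (hf : G.IsCrMap 2 f) {M : ℝ} (hM : 0 ≤ M)
    (hcurv : G.CurvatureBoundedBy f M) (hv : ‖v‖ = 1) {e : Λ × I × I} (he : e.2.1 < e.2.2) :
    ∫⁻ t, excess f v e t ≤
      ENNReal.ofReal (M * arcLength (G.edgeCurve f e.1) e.2.1 e.2.2 ^ 2 / 2) :=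
  lintegral_preimageCount_sub_between_le (g := edgeHeight f v e.1) (g' := edgeSlope f v e.1)
    (le_of_lt he)
    ((continuousOn_edgeHeight hf e.1).mono (Icc_subset_Icc e.2.1.2.1 e.2.2.2.2))
    (fun _ hs => hasDerivAt_edgeHeight hf e.1 (Ioo_subset_Ioo_zero_one _ _ hs))
    ((continuousOn_edgeSlope hf e.1).mono
      ((Ioo_subset_Ioo_zero_one _ _).trans Ioo_subset_Icc_self))
    fun _ hs h0 => lintegral_abs_inner_velocity_le (hf.2 e.1) hM (hcurv e.1) hv e.2.1.2.1
      e.2.2.2.2 hs h0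

/-- Almost every value is taken at finitely many points, on 1-cells only at regular points. -/
lemma ae_regular [Finite V] [Finite Λ] (hf : G.IsCrMap 2 f) (A : Finset G.Space) :
    ∀ᵐ t, {z | inner ℝ (f z) v = t}.Finite ∧ (∀ z ∈ A, inner ℝ (f z) v ≠ t) ∧
      ∀ l, ∀ s : I, 0 < s → s < 1 → inner ℝ (f (G.cell l s)) v = t → edgeSlope f v l s ≠ 0 := by
  have hcont (l : Λ) : ContinuousOn (edgeSlope f v l) (Ioo 0 1) :=
    (continuousOn_edgeSlope hf l).mono Ioo_subset_Icc_self
  have hfinite (l : Λ) : ∀ᵐ t, preimageCount (edgeHeight f v l) 0 1 t < ∞ := by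
    obtain ⟨h1, h2⟩ := lintegral_preimageCount_le
      (fun s hs => hasDerivAt_edgeHeight (v := v) hf l hs) (hcont l)
    refine ae_lt_top' h1 (h2.trans_lt ?_).ne
    have hint : IntegrableOn (edgeSlope f v l) (Ioo 0 1) :=
      (continuousOn_edgeSlope hf l).integrableOn_Icc.mono_set Ioo_subset_Icc_self
    simpa only [HasFiniteIntegral, Real.enorm_eq_ofReal_abs] using hint.2
  have hcrit (l : Λ) := measure_eq_zero_iff_ae_notMem.1 (volume_image_critical
    fun s hs => hasDerivAt_edgeHeight (v := v) hf l hs)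
  have hA := measure_eq_zero_iff_ae_notMem.1
    ((A.finite_toSet.image fun z => (inner ℝ (f z) v : ℝ)).measure_zero volume)
  filter_upwards [ae_all_iff.2 hfinite, ae_all_iff.2 hcrit, hA] with t h1 h2 h3
  refine ⟨?_, fun z hz heq => h3 ⟨z, hz, heq⟩, fun l s h0 hs1 heq hs => ?_⟩
  · have hl (l : Λ) := Measure.count_apply_lt_top.1 (h1 l)
    refine ((finite_range G.vertex).union (finite_iUnion fun l => ((hl l).preimage
      Subtype.val_injective.injOn).image (G.cell l))).subset fun z hz => ?_
    rcases G.vertex_or_cell z with ⟨x, rfl⟩ | ⟨l, s, h0, hs1, rfl⟩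
    · exact Or.inl ⟨x, rfl⟩
    · refine Or.inr (mem_iUnion.2 ⟨l, s, ⟨⟨h0, hs1⟩, ?_⟩, rfl⟩)
      rwa [edgeHeight_coe]
  · exact h2 l ⟨s, ⟨⟨h0, hs1⟩, hs⟩, by rwa [edgeHeight_coe]⟩

variable [Fintype Λ]

/-- Almost everywhere, the difference of the two Euler characteristic transforms is half of the
total excess of the open curves. -/
theorem ae_extAbs_ectError_eq [Finite V] (hf : G.IsCrMap 2 f) {A : Finset G.Space}
    (hA : ∀ x, G.vertex x ∈ A) (v : UnitSphere d) :
    ∀ᵐ t, extAbs (G.ectError f A v t) = 2⁻¹ * ∑ e ∈ G.openCurvesFinset A, excess f v.1 e t := by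
  filter_upwards [ae_regular (v := v.1) hf A] with t ⟨hfin, hAt, hreg⟩
  have hh : Continuous fun z => (inner ℝ (f z) v.1 : ℝ) := hf.1.inner continuous_const
  obtain ⟨m, hm, hm'⟩ := exists_eulerCharacteristic_sublevel_sub hh hA hAt hfin
    fun l s h0 h1 hs => truth_add_truth_eq_one hf h0 h1 (hreg l s h0 h1 hs) hs
  have herr : G.ectError f A v t = ((m - G.interpolatedECT f A v t : ℤ) : WithTop ℤ) := by
    have hECT : ECT f v t = (m : WithTop ℤ) := hm
    rw [ectError, hECT]
    rfl
  have hexcess (e) (he : e ∈ G.openCurvesFinset A) : excess f v.1 e t =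
      ENNReal.ofReal ((crossings (fun z => inner ℝ (f z) v.1) e t : ℝ) -
        truth (min (inner ℝ (f (G.cell e.1 e.2.1)) v.1) (inner ℝ (f (G.cell e.1 e.2.2)) v.1) ≤ t ∧
          t < max (inner ℝ (f (G.cell e.1 e.2.1)) v.1) (inner ℝ (f (G.cell e.1 e.2.2)) v.1))) := by
    rw [ENNReal.ofReal_sub _ (by unfold truth; split_ifs <;> norm_num), ENNReal.ofReal_natCast,
      ofReal_truth_between, excess, preimageCount_edgeHeight_eq hfin, edgeHeight_coe,
      edgeHeight_coe]
  have hnonneg (e) (he : e ∈ G.openCurvesFinset A) :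
      0 ≤ (crossings (fun z => inner ℝ (f z) v.1) e t : ℝ) -
        truth (min (inner ℝ (f (G.cell e.1 e.2.1)) v.1) (inner ℝ (f (G.cell e.1 e.2.2)) v.1) ≤ t ∧
          t < max (inner ℝ (f (G.cell e.1 e.2.1)) v.1) (inner ℝ (f (G.cell e.1 e.2.2)) v.1)) := by
    have he' := G.mem_openCurvesFinset.1 he
    exact sub_nonneg.2 (truth_le_crossings hh hfin he'.1 (hAt _ he'.2.1) (hAt _ he'.2.2.1))
  rw [herr, extAbs_coe, Finset.sum_congr rfl hexcess, ← ENNReal.ofReal_sum_of_nonneg hnonneg,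
    ← hm', ENNReal.ofReal_mul zero_le_two, ENNReal.ofReal_ofNat, ← mul_assoc,
    ENNReal.inv_mul_cancel two_ne_zero ENNReal.ofNat_ne_top, one_mul, abs_of_nonneg]
  · congr 1
    rw [interpolatedECT]
    push_cast
    rfl
  · have h0 := Finset.sum_nonneg hnonneg
    rw [← hm'] at h0
    have h1 := nonneg_of_mul_nonneg_right h0 zero_lt_two
    rw [interpolatedECT]
    push_cast
    exact h1

/-- The lengths of the open curves add up to the total length. -/
lemma sum_arcLength_eq (hf : G.IsCrMap 2 f) {A : Finset G.Space} (hA : ∀ x, G.vertex x ∈ A) :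
    ∑ e ∈ G.openCurvesFinset A, arcLength (G.edgeCurve f e.1) e.2.1 e.2.2 = G.totalLength f := by
  choose ℓ w _ _ _ _ hℓ using fun l => exists_arcLength_parameter (hf.2 l)
  have h1 (e) (he : e ∈ G.openCurvesFinset A) : arcLength (G.edgeCurve f e.1) e.2.1 e.2.2 =
      -ℓ e.1 e.2.1 + ℓ e.1 e.2.2 := by
    rw [hℓ e.1 _ _ e.2.1.2.1 (G.mem_openCurvesFinset.1 he).1.le e.2.2.2.2]
    ring
  rw [Finset.sum_congr rfl h1, G.sum_openCurves_ends hA (fun l s => -ℓ l s) (fun l s => ℓ l s),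
    totalLength]
  simp only [neg_add_cancel, Finset.sum_const_zero, add_zero]
  refine Finset.sum_congr rfl fun l _ => ?_
  rw [hℓ l 0 1 le_rfl zero_le_one le_rfl]
  change -ℓ l 0 + ℓ l 1 = ℓ l 1 - ℓ l 0
  ring

lemma arcLength_nonneg (γ : ℝ → EuclideanSpace ℝ (Fin d)) {p q : ℝ} (h : p ≤ q) :
    0 ≤ arcLength γ p q := intervalIntegral.integral_nonneg h fun _ _ => norm_nonneg _

lemma totalLength_nonneg : 0 ≤ G.totalLength f :=
  Finset.sum_nonneg fun _ _ => arcLength_nonneg _ zero_le_one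

/-- The integral of the error is at most `M L ε / 4`. -/
theorem lintegral_extAbs_ectError_le [Finite V] (hf : G.IsCrMap 2 f) {M : ℝ} (hM : 0 ≤ M)
    (hcurv : G.CurvatureBoundedBy f M) {ε : ℝ} {A : Finset G.Space} (hA : G.EpsDense f A ε)
    (v : UnitSphere d) :
    ∫⁻ t, extAbs (G.ectError f A v t) ≤ ENNReal.ofReal (M * G.totalLength f * ε / 4) := by
  have hv : ‖v.1‖ = 1 := mem_sphere_zero_iff_norm.1 v.2
  rw [lintegral_congr_ae (ae_extAbs_ectError_eq hf hA.1.1 v), lintegral_const_mul' _ _ (by simp),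
    lintegral_finsetSum' _ fun e _ => aemeasurable_excess hf e]
  calc 2⁻¹ * ∑ e ∈ G.openCurvesFinset A, ∫⁻ t, excess f v.1 e t
      ≤ 2⁻¹ * ∑ e ∈ G.openCurvesFinset A,
          ENNReal.ofReal (M * arcLength (G.edgeCurve f e.1) e.2.1 e.2.2 ^ 2 / 2) := by
        gcongr with e he
        exact lintegral_excess_le hf hM hcurv hv (G.mem_openCurvesFinset.1 he).1
    _ = ENNReal.ofReal (2⁻¹ * ∑ e ∈ G.openCurvesFinset A,
          M * arcLength (G.edgeCurve f e.1) e.2.1 e.2.2 ^ 2 / 2) := by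
        rw [ENNReal.ofReal_mul (by norm_num), ENNReal.ofReal_sum_of_nonneg fun e _ => by positivity,
          ENNReal.ofReal_inv_of_pos two_pos, ENNReal.ofReal_ofNat]
    _ ≤ ENNReal.ofReal (M * G.totalLength f * ε / 4) := by
        refine ENNReal.ofReal_le_ofReal ?_
        calc 2⁻¹ * ∑ e ∈ G.openCurvesFinset A,
              M * arcLength (G.edgeCurve f e.1) e.2.1 e.2.2 ^ 2 / 2
            ≤ 2⁻¹ * ∑ e ∈ G.openCurvesFinset A,
              M * ε / 2 * arcLength (G.edgeCurve f e.1) e.2.1 e.2.2 := by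
              refine mul_le_mul_of_nonneg_left (Finset.sum_le_sum fun e he => ?_) (by norm_num)
              have he' := G.mem_openCurvesFinset.1 he
              have h0 := arcLength_nonneg (G.edgeCurve f e.1)
                (show (e.2.1 : ℝ) ≤ e.2.2 from he'.1.le)
              have := mul_nonneg hM (mul_nonneg h0 (sub_nonneg.2 (hA.2 e he').le))
              linarith
          _ = M * G.totalLength f * ε / 4 := by
              rw [← Finset.mul_sum, sum_arcLength_eq hf hA.1.1]
              ring

end OneComplex

end

theorem theorem3p12 {d : ℕ} {V Λ : Type} [Finite V] [Fintype Λ] (G : OneComplex V Λ)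
    [ConnectedSpace G.Space] (f : G.Space → EuclideanSpace ℝ (Fin d)) (hf : G.IsCrMap 2 f)
    (M : ℝ) (hM : 0 ≤ M) (hcurv : G.CurvatureBoundedBy f M)
    (ε : ℝ) (hε : 0 < ε) (hεM : M * ε < Real.pi)
    (A : Finset G.Space) (hA : G.EpsDense f A ε)
    (a : ℝ) (ha : ∀ z, ‖f z‖ < a) :
    (∀ v : UnitSphere d, AEMeasurable (fun t => extAbs (G.ectError f A v t))
      (volume.restrict (Icc (-a) a))) ∧
    ectNorm a (G.ectError f A) ≤
      ENNReal.ofReal (1 / Real.sqrt 12 * M * G.totalLength f * ε) := by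
  refine ⟨fun v => ?_, iSup_le fun v => ?_⟩
  · have hmeas : AEMeasurable fun t => 2⁻¹ * ∑ e ∈ G.openCurvesFinset A, G.excess f v.1 e t :=
      (Finset.aemeasurable_fun_sum _ fun e _ => OneComplex.aemeasurable_excess hf e).const_mul _
    exact (hmeas.congr ((OneComplex.ae_extAbs_ectError_eq hf hA.1.1 v).mono
      fun t ht => ht.symm)).restrict
  · refine (setLIntegral_le_lintegral _ _).trans
      ((OneComplex.lintegral_extAbs_ectError_le hf hM hcurv hA v).trans
        (ENNReal.ofReal_le_ofReal ?_))
    -- the constant obtained is `1 / 4 = 1 / √16`, which is less than `1 / √12`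
    have h4 : (1 : ℝ) / 4 ≤ 1 / Real.sqrt 12 :=
      one_div_le_one_div_of_le (by positivity) (Real.sqrt_le_iff.2 ⟨by norm_num, by norm_num⟩)
    have h0 : 0 ≤ M * G.totalLength f * ε :=
      mul_nonneg (mul_nonneg hM OneComplex.totalLength_nonneg) hε.le
    nlinarith [mul_le_mul_of_nonneg_right h4 h0]
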